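/- Consider the problem $(n-k)$-Base-Size: given permutations $g_1,\dots,g_m$ of $[n]=\{1,\dots,n\}$ and a number $k\in\mathbb N$ (the parameter), is there a base of the group $G=\langle g_1,\dots,g_m\rangle\le S_n$ that consists of all but $k$ of the points, i.e. a set $S\subseteq[n]$ with $|S|=n-k$ such that no nontrivial element of $G$ fixes every point of $S$? (If $k>n$, the answer is no.) Running times are numbers of steps of a random access machine with addition and truncated subtraction, each of unit cost, on the input $n,m,k$ and the value tables of the $g_i$. (1) $(n-k)$-Base-Size can be decided in time $k^{O(k^2)}+k\,(n+m)^{O(1)}$; that is, there are a program that decides it and a constant $C$ such that on every input the program halts after at most $C\bigl(k^{Ck^2}+k\,(n+m+1)^{C}\bigr)$ steps, where $0^0=1$. In particular, the time is $k^{O(k^2)}+k\,n^{O(1)}$ when the number $m$ of generators is polynomially bounded in $n$. (2) $(n-k)$-Base-Size has a kernel whose domain has at most $k^{2k+1}$ points, and it can be computed in polynomial time: there are a program and a constant $C$ such that on every input $(g_1,\dots,g_m;k)$ on $[n]$ the program halts after at most $C\,(n+m+1)^{C}$ steps and outputs an instance $(g'_1,\dots,g'_{m'};k)$ on $[n']$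 with the same parameter $k$ that has the same answer as the input and satisfies $n'\le k^{2k+1}$ and $m'\le n'^2$ (so that the size of the whole output is bounded in terms of $k$). -/

import Mathlib

/-! ### The combinatorial problem -/

/-- `S` is a base of the permutation group `G`: only the identity of `G` fixes every point
of `S`. -/
def IsPermBase {Ω : Type*} (G : Subgroup (Equiv.Perm Ω)) (S : Set Ω) : Prop :=
  ∀ g ∈ G, (∀ i ∈ S, g i = i) → g = 1

/-- An input of `(n-k)`-Base-Size: `m` generators of a permutation group on `n` points, and a
number `k`, which is the parameter. -/
structure CoBaseInstance where
  n : ℕ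
  m : ℕ
  gens : Fin m → Equiv.Perm (Fin n)
  k : ℕ

namespace CoBaseInstance

/-- The permutation group generated by the given permutations. -/
def group (I : CoBaseInstance) : Subgroup (Equiv.Perm (Fin I.n)) :=
  Subgroup.closure (Set.range I.gens)

/-- The question: is there a base that consists of all but `k` points?
(The answer is no when `k` exceeds `n`.) -/
def IsYes (I : CoBaseInstance) : Prop :=
  ∃ S : Finset (Fin I.n), S.card + I.k = I.n ∧ IsPermBase I.group (S : Set (Fin I.n))

end CoBaseInstance

/-! ### The machine model

A random access machine with addition and truncated subtraction, in structured form.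
The memory has variables and arrays, named by numbers; an array is indexed by natural numbers,
so that addresses can be computed.  A program is a finite text and so names only
finitely many variables and arrays.  Each operation has cost one.  As there is no multiplication,
numbers grow by at most about one bit per step, and the model is polynomially equivalent
to Turing machines. -/

/-- The memory: the contents of the variables and of the array cells. -/
structure RamStore where
  var : ℕ → ℕ
  arr : ℕ → ℕ → ℕ

namespace RamStore

/-- Write `v` into the variable `x`. -/
def setVar (s : RamStore) (x v : ℕ) : RamStore :=
  { s with var := Function.update s.var x v }

/-- Write `v` into the cell `i` of the array `a`. -/
def setArr (s : RamStore) (a i v : ℕ) : RamStore :=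
  { s with arr := Function.update s.arr a (Function.update (s.arr a) i v) }

end RamStore

/-- Expressions: constants, variables, array cells, addition, truncated subtraction. -/
inductive RamExpr where
  | const (c : ℕ)
  | var (x : ℕ)
  | cell (a : ℕ) (i : RamExpr)
  | add (e f : RamExpr)
  | sub (e f : RamExpr)

namespace RamExpr

/-- The value of an expression. -/
def eval (s : RamStore) : RamExpr → ℕ
  | const c => c
  | var x => s.var x
  | cell a i => s.arr a (i.eval s)
  | add e f => e.eval s + f.eval s
  | sub e f => e.eval s - f.eval s

/-- The number of steps that the evaluation of an expression takes: one for every operation,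
constant and variable in it. -/
def cost : RamExpr → ℕ
  | const _ => 1
  | var _ => 1
  | cell _ i => i.cost + 1
  | add e f => e.cost + f.cost + 1
  | sub e f => e.cost + f.cost + 1

end RamExpr

/-- Programs.  A test succeeds when the value of its expression is not zero. -/
inductive RamProg where
  | skip
  | assign (x : ℕ) (e : RamExpr)
  | write (a : ℕ) (i e : RamExpr)
  | seq (p q : RamProg)
  | ite (b : RamExpr) (p q : RamProg)
  | loop (b : RamExpr) (p : RamProg)

/-- `RamExec p s t s'`: started with the memory `s`, the program `p` halts after exactly `t` steps
with the memory `s'`. -/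
inductive RamExec : RamProg → RamStore → ℕ → RamStore → Prop where
  | skip (s : RamStore) : RamExec RamProg.skip s 1 s
  | assign (s : RamStore) (x : ℕ) (e : RamExpr) :
      RamExec (RamProg.assign x e) s (e.cost + 1) (s.setVar x (e.eval s))
  | write (s : RamStore) (a : ℕ) (i e : RamExpr) :
      RamExec (RamProg.write a i e) s (i.cost + e.cost + 1) (s.setArr a (i.eval s) (e.eval s))
  | seq {p q : RamProg} {s s₁ s₂ : RamStore} {t₁ t₂ : ℕ} :
      RamExec p s t₁ s₁ → RamExec q s₁ t₂ s₂ → RamExec (RamProg.seq p q) s (t₁ + t₂) s₂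
  | iteTrue {b : RamExpr} {p q : RamProg} {s s₁ : RamStore} {t : ℕ} :
      b.eval s ≠ 0 → RamExec p s t s₁ → RamExec (RamProg.ite b p q) s (b.cost + 1 + t) s₁
  | iteFalse {b : RamExpr} {p q : RamProg} {s s₁ : RamStore} {t : ℕ} :
      b.eval s = 0 → RamExec q s t s₁ → RamExec (RamProg.ite b p q) s (b.cost + 1 + t) s₁
  | loopDone {b : RamExpr} {p : RamProg} {s : RamStore} :
      b.eval s = 0 → RamExec (RamProg.loop b p) s (b.cost + 1) s
  | loopNext {b : RamExpr} {p : RamProg} {s s₁ s₂ : RamStore} {t₁ t₂ : ℕ} :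
      b.eval s ≠ 0 → RamExec p s t₁ s₁ → RamExec (RamProg.loop b p) s₁ t₂ s₂ →
      RamExec (RamProg.loop b p) s (b.cost + 1 + t₁ + t₂) s₂

/-- A program has at most one result, and at most one running time, on each memory. -/
theorem RamExec.deterministic {p : RamProg} {s s₁ s₂ : RamStore} {t₁ t₂ : ℕ}
    (h₁ : RamExec p s t₁ s₁) (h₂ : RamExec p s t₂ s₂) : t₁ = t₂ ∧ s₁ = s₂ := by
  induction h₁ generalizing t₂ s₂ with
  | skip => cases h₂; exact ⟨rfl, rfl⟩
  | assign => cases h₂; exact ⟨rfl, rfl⟩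
  | write => cases h₂; exact ⟨rfl, rfl⟩
  | seq _ _ ihp ihq =>
    cases h₂ with
    | seq hp hq =>
      obtain ⟨rfl, rfl⟩ := ihp hp
      obtain ⟨rfl, rfl⟩ := ihq hq
      exact ⟨rfl, rfl⟩
  | iteTrue hb _ ih =>
    cases h₂ with
    | iteTrue _ h => obtain ⟨rfl, rfl⟩ := ih h; exact ⟨rfl, rfl⟩
    | iteFalse hb' _ => exact absurd hb' hb
  | iteFalse hb _ ih =>
    cases h₂ with
    | iteTrue hb' _ => exact absurd hb hb'
    | iteFalse _ h => obtain ⟨rfl, rfl⟩ := ih h; exact ⟨rfl, rfl⟩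
  | loopDone hb =>
    cases h₂ with
    | loopDone _ => exact ⟨rfl, rfl⟩
    | loopNext hb' _ _ => exact absurd hb hb'
  | loopNext hb _ _ ihp ihq =>
    cases h₂ with
    | loopDone hb' => exact absurd hb' hb
    | loopNext _ hp hq =>
      obtain ⟨rfl, rfl⟩ := ihp hp
      obtain ⟨rfl, rfl⟩ := ihq hq
      exact ⟨rfl, rfl⟩

/-! ### Instances in memory -/

namespace CoBaseInstance

/-- The memory at the start: variables `0`, `1`, `2` contain `n`, `m`, `k`, array `0` contains the
value tables of the generators one after the other, and everything else is zero. -/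
def input (I : CoBaseInstance) : RamStore where
  var x := if x = 0 then I.n else if x = 1 then I.m else if x = 2 then I.k else 0
  arr a p :=
    if h : a = 0 ∧ p < I.m * I.n then
      ((I.gens (finProdFinEquiv.symm ⟨p, h.2⟩).1 (finProdFinEquiv.symm ⟨p, h.2⟩).2 : Fin I.n) : ℕ)
    else 0

/-- The memory `s` presents the instance `I`, in the format of the input; the remaining variables
and cells are arbitrary. -/
def IsStoredIn (I : CoBaseInstance) (s : RamStore) : Prop :=
  s.var 0 = I.n ∧ s.var 1 = I.m ∧ s.var 2 = I.k ∧
    ∀ (i : Fin I.m) (j : Fin I.n), s.arr 0 ((i : ℕ) * I.n + (j : ℕ)) = ((I.gens i j : Fin I.n) : ℕ)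

theorem isStoredIn_input (I : CoBaseInstance) : I.IsStoredIn I.input := by
  refine ⟨rfl, rfl, rfl, fun i j => ?_⟩
  have h : (i : ℕ) * I.n + (j : ℕ) = (finProdFinEquiv (i, j) : ℕ) := by
    simp [finProdFinEquiv, mul_comm, add_comm]
  have hlt : (finProdFinEquiv (i, j) : ℕ) < I.m * I.n := (finProdFinEquiv (i, j)).isLt
  simp only [input, h, hlt, true_and, dif_pos, Fin.eta, Equiv.symm_apply_apply]

end CoBaseInstance

/-- The program `p` decides `(n-k)`-Base-Size within the time bound `T`: on every instance it
halts after at most `T` steps, and variable `0` then contains `1` if the answer is yes, and `0`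
if it is no. -/
def DecidesCoBase (p : RamProg) (T : CoBaseInstance → ℕ) : Prop :=
  ∀ I : CoBaseInstance, ∃ (t : ℕ) (s : RamStore), RamExec p I.input t s ∧ t ≤ T I ∧
    (I.IsYes → s.var 0 = 1) ∧ (¬ I.IsYes → s.var 0 = 0)

/-- The program `p` is a kernelization of `(n-k)`-Base-Size within the time bound `T`, with a
kernel on at most `d k` points: on every instance it halts after at most `T` steps with an
equivalent instance in memory, which has the same parameter and a domain of at most `d k`
points.  The number of generators in the kernel is at most the square of the number of its points,
so that the whole kernel, and not only its domain, is bounded in terms of `k`. -/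
def KernelizesCoBase (p : RamProg) (T : CoBaseInstance → ℕ) (d : ℕ → ℕ) : Prop :=
  ∀ I : CoBaseInstance, ∃ (t : ℕ) (s : RamStore) (J : CoBaseInstance),
    RamExec p I.input t s ∧ t ≤ T I ∧ J.IsStoredIn s ∧
    (J.IsYes ↔ I.IsYes) ∧ J.k = I.k ∧ J.n ≤ d I.k ∧ J.m ≤ J.n ^ 2

/-! ### Structured programs with counting loops -/

namespace RamStore

/-! The complement of a base is a set `T` such that only the identity of the group moves points of
`T` alone; `CoBase.Indep` expresses this, and the question is whether an independent set of `k`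
points exists. The combinatorics rests on the three-cycles in the group. Conjugating three-cycles
with a common point by each other yields further ones, so being equal or on a common three-cycle is
an equivalence relation, and any three points of a class lie on a three-cycle of the group
(`CycRel.hasCyc`, `CycRel.trans`).

Reduction: in each class only the `k + 1` smallest points matter. An independent set of at most `k`
points that contains a larger point `x` misses two of them, `y` and `z`, and its image under the
cycle `x ↦ y ↦ z ↦ x` is independent and has `y` in place of `x` (`exists_indep_sdiff_excess`). It
remains to consider subsets of the non-excess points, and for these only the pointwise stabilizer of
the excess points counts.

Size: if more than `k ^ (2 * k + 1)` points remain, the answer is yes (`exists_indep_of_card_lt`).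
Take a maximal set without two related points and in it a maximal independent set `I`, and suppose
that `I` has fewer than `k` points. Each further point `x` of the first set has a group element that
moves `x` and otherwise moves only points of `I`. If two such elements induce the same partial map
on `I`, they differ by a three-cycle through their two outer points (`hasCyc_of_same_pattern`),
which are then related. So there are at most as many further points as partial maps, and each class
contributes at most `k + 1` points.

Algorithm: stabilizer chains in the manner of Schreier, Sims, Furst, Hopcroft and Luks. A table of
coset representatives is extended by sifting the generators and the products of representatives
until it is closed (`run_chain`). When a set of points is numbered last, the last rows generate the
pointwise stabilizer of all other points. This one computation, `markedChain`, detects three-cycles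
on three given points, provides the generators of the kernel, and tests a set for independence. The
decision procedure tests all sequences of `k` points of the kernel; there are at most `(k ^ (2 * k +
1)) ^ k` of them.

Running times: apart from a few top-level branches, the programs are written in `ForProg`, where
loop bounds are variables that the program leaves alone. Correctness is then a statement about the
function `run`, and the time is polynomial in the loop bounds by `exists_exec_le`. -/

@[simp] theorem setVar_var (s : RamStore) (x v y : ℕ) :
    (s.setVar x v).var y = if y = x then v else s.var y := by
  simp [setVar, Function.update_apply]

@[simp] theorem setVar_arr (s : RamStore) (x v : ℕ) : (s.setVar x v).arr = s.arr := rfl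

@[simp] theorem setArr_var (s : RamStore) (a i v : ℕ) : (s.setArr a i v).var = s.var := rfl

@[simp] theorem setArr_arr (s : RamStore) (a i v b j : ℕ) :
    (s.setArr a i v).arr b j = if b = a ∧ j = i then v else s.arr b j := by
  by_cases h : b = a
  · subst h; simp [setArr, Function.update_apply]
  · simp [setArr, h]

theorem setArr_arr_of_ne (s : RamStore) {a b : ℕ} (i v : ℕ) (h : b ≠ a) :
    (s.setArr a i v).arr b = s.arr b := by
  simp [setArr, h]

end RamStore

/-- Programs in which all loops are counting loops: `count x b p` executes `p` for
`x = 0, 1, …, b - 1`, where `b` is a variable. -/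
inductive ForProg where
  | skip
  | assign (x : ℕ) (e : RamExpr)
  | write (a : ℕ) (i e : RamExpr)
  | seq (p q : ForProg)
  | ite (b : RamExpr) (p q : ForProg)
  | count (x b : ℕ) (p : ForProg)

namespace ForProg

/-- The machine program. -/
def compile : ForProg → RamProg
  | skip => .skip
  | assign x e => .assign x e
  | write a i e => .write a i e
  | seq p q => .seq p.compile q.compile
  | ite b p q => .ite b p.compile q.compile
  | count x b p => .seq (.assign x (.const 0))
      (.loop (.sub (.var b) (.var x))
        (.seq p.compile (.assign x (.add (.var x) (.const 1)))))

/-- The memory after the execution. -/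
def run : ForProg → RamStore → RamStore
  | skip, s => s
  | assign x e, s => s.setVar x (e.eval s)
  | write a i e, s => s.setArr a (i.eval s) (e.eval s)
  | seq p q, s => q.run (p.run s)
  | ite b p q, s => if b.eval s = 0 then q.run s else p.run s
  | count x b p, s =>
      Nat.rec (s.setVar x 0) (fun i st => (p.run st).setVar x (i + 1)) (s.var b)

/-- The variables that may change. -/
def vars : ForProg → List ℕ
  | skip => []
  | assign x _ => [x]
  | write _ _ _ => []
  | seq p q => p.vars ++ q.vars
  | ite _ p q => p.vars ++ q.vars
  | count x _ p => x :: p.vars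

/-- The arrays that may change. -/
def arrs : ForProg → List ℕ
  | skip => []
  | assign _ _ => []
  | write a _ _ => [a]
  | seq p q => p.arrs ++ q.arrs
  | ite _ p q => p.arrs ++ q.arrs
  | count _ _ p => p.arrs

/-- All loop bounds are among the variables `B`, and no variable in `L` and no counter of a
running loop is assigned to. -/
def ok (B : List ℕ) : List ℕ → ForProg → Bool
  | _, skip => true
  | L, assign x _ => !L.contains x
  | _, write _ _ _ => true
  | L, seq p q => ok B L p && ok B L q
  | L, ite _ p q => ok B L p && ok B L q
  | L, count x b p => B.contains b && !L.contains x && ok B (x :: L) p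

/-- A bound on the running time when all loop bounds are at most `N`. -/
def time (N : ℕ) : ForProg → ℕ
  | skip => 1
  | assign _ e => e.cost + 1
  | write _ i e => i.cost + e.cost + 1
  | seq p q => p.time N + q.time N
  | ite b p q => b.cost + 1 + (p.time N + q.time N)
  | count _ _ p => 6 + N * (p.time N + 8)

/-- A frame rule. As `vars` is a computable list, its side condition can be settled by `decide` for
a concrete program. -/
theorem run_var (p : ForProg) (s : RamStore) {y : ℕ} (h : y ∉ p.vars) :
    (p.run s).var y = s.var y := by
  induction p generalizing s with
  | skip => rfl
  | assign x e => simp [vars] at h; simp [run, h]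
  | write a i e => rfl
  | seq p q ihp ihq =>
    simp only [vars, List.mem_append, not_or] at h
    rw [run, ihq _ h.2, ihp _ h.1]
  | ite b p q ihp ihq =>
    simp only [vars, List.mem_append, not_or] at h
    rw [run]; split_ifs
    · exact ihq _ h.2
    · exact ihp _ h.1
  | count x b p ih =>
    simp only [vars, List.mem_cons, not_or] at h
    rw [run]
    generalize s.var b = N
    induction N with
    | zero => simp [h.1]
    | succ N ihN => simp [h.1, ih _ h.2, ihN]

theorem run_arr (p : ForProg) (s : RamStore) {a : ℕ} (h : a ∉ p.arrs) :
    (p.run s).arr a = s.arr a := by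
  induction p generalizing s with
  | skip => rfl
  | assign x e => rfl
  | write b i e =>
    simp only [arrs, List.mem_singleton] at h
    exact RamStore.setArr_arr_of_ne _ _ _ h
  | seq p q ihp ihq =>
    simp only [arrs, List.mem_append, not_or] at h
    rw [run, ihq _ h.2, ihp _ h.1]
  | ite b p q ihp ihq =>
    simp only [arrs, List.mem_append, not_or] at h
    rw [run]; split_ifs
    · exact ihq _ h.2
    · exact ihp _ h.1
  | count x b p ih =>
    simp only [arrs] at h
    rw [run]
    generalize s.var b = N
    induction N with
    | zero => rfl
    | succ N ihN => simp [ih _ h, ihN]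

/-- `L` collects the protected variables: the loop bounds and the counters of the enclosing loops.
That they survive the body of a loop is what makes a compiled loop run exactly as often as its bound
says. -/
theorem run_var_of_ok {B L : List ℕ} {p : ForProg} (hp : p.ok B L = true) (s : RamStore)
    {y : ℕ} (h : y ∈ L) : (p.run s).var y = s.var y := by
  apply run_var
  induction p generalizing L with
  | skip => simp [vars]
  | assign x e =>
    simp only [ok, Bool.not_eq_true', List.contains_eq_mem, decide_eq_false_iff_not] at hp
    simp only [vars, List.mem_singleton]; rintro rfl; exact hp h
  | write a i e => simp [vars]
  | seq p q ihp ihq =>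
    simp only [ok, Bool.and_eq_true] at hp
    simp only [vars, List.mem_append, not_or]; exact ⟨ihp hp.1 h, ihq hp.2 h⟩
  | ite b p q ihp ihq =>
    simp only [ok, Bool.and_eq_true] at hp
    simp only [vars, List.mem_append, not_or]; exact ⟨ihp hp.1 h, ihq hp.2 h⟩
  | count x b p ih =>
    simp only [ok, Bool.and_eq_true, Bool.not_eq_true', List.contains_eq_mem,
      decide_eq_false_iff_not] at hp
    simp only [vars, List.mem_cons, not_or]
    refine ⟨?_, ih hp.2 (List.mem_cons_of_mem _ h)⟩
    rintro rfl; exact hp.1.2 h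

/-- The bridge from the function `run` to the step-counting semantics. The assumption `B ⊆ L` keeps
every loop bound constant during the whole execution, so the single number `N` bounds all the loops.
-/
theorem exec_run {B L : List ℕ} {p : ForProg} (hB : B ⊆ L) (hp : p.ok B L = true) {s : RamStore}
    {N : ℕ} (hN : ∀ b ∈ B, s.var b ≤ N) :
    ∃ t ≤ p.time N, RamExec p.compile s t (p.run s) := by
  induction p generalizing L s with
  | skip => exact ⟨1, le_rfl, .skip s⟩
  | assign x e => exact ⟨_, le_rfl, .assign s x e⟩
  | write a i e => exact ⟨_, le_rfl, .write s a i e⟩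
  | seq p q ihp ihq =>
    simp only [ok, Bool.and_eq_true] at hp
    obtain ⟨t₁, h₁, e₁⟩ := ihp hB hp.1 hN
    obtain ⟨t₂, h₂, e₂⟩ := ihq (s := p.run s) hB hp.2
      (fun b hb => by rw [run_var_of_ok hp.1 s (hB hb)]; exact hN b hb)
    exact ⟨_, Nat.add_le_add h₁ h₂, .seq e₁ e₂⟩
  | ite b p q ihp ihq =>
    simp only [ok, Bool.and_eq_true] at hp
    by_cases hb : b.eval s = 0
    · obtain ⟨t, h, e⟩ := ihq hB hp.2 hN
      refine ⟨b.cost + 1 + t, ?_, ?_⟩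
      · simp only [time]; omega
      · rw [run, if_pos hb]; exact RamExec.iteFalse hb e
    · obtain ⟨t, h, e⟩ := ihp hB hp.1 hN
      refine ⟨b.cost + 1 + t, ?_, ?_⟩
      · simp only [time]; omega
      · rw [run, if_neg hb]; exact RamExec.iteTrue hb e
  | count x b p ih =>
    have hok := hp
    simp only [ok, Bool.and_eq_true, Bool.not_eq_true', List.contains_eq_mem,
      decide_eq_true_eq, decide_eq_false_iff_not] at hp
    obtain ⟨⟨hbB, hxL⟩, hp⟩ := hp
    set st : ℕ → RamStore := fun i =>
      Nat.rec (s.setVar x 0) (fun i st => (p.run st).setVar x (i + 1)) i with hst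
    have hsucc : ∀ i, st (i + 1) = (p.run (st i)).setVar x (i + 1) := fun i => rfl
    have hx : ∀ i, (st i).var x = i := by
      intro i; cases i <;> simp [hst]
    have hL : ∀ i, ∀ y ∈ L, (st i).var y = s.var y := by
      intro i y hy
      have hyx : y ≠ x := by rintro rfl; exact hxL hy
      induction i with
      | zero => simp [hst, hyx]
      | succ i ihi =>
        rw [hsucc, RamStore.setVar_var, if_neg hyx,
          run_var_of_ok hp _ (List.mem_cons_of_mem _ hy), ihi]
    -- Induction on the number `r` of remaining rounds. A test costs 4, and the increment of the
    -- counter costs another 4; hence 8 per round, and 4 for the final test that fails.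
    have hloop : ∀ r i, i + r = s.var b → ∃ t ≤ 4 + r * (p.time N + 8),
        RamExec (.loop (.sub (.var b) (.var x))
          (.seq p.compile (.assign x (.add (.var x) (.const 1))))) (st i) t (st (s.var b)) := by
      intro r
      induction r with
      | zero =>
        intro i hi
        obtain rfl : i = s.var b := by simpa using hi
        refine ⟨4, by omega, ?_⟩
        apply RamExec.loopDone (b := .sub (.var b) (.var x))
        simp [RamExpr.eval, hx, hL _ b (hB hbB)]
      | succ r ihr =>
        intro i hi
        obtain ⟨t₁, h₁, e₁⟩ := ih (s := st i) (fun y hy => List.mem_cons_of_mem _ (hB hy)) hp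
          (fun y hy => by rw [hL i y (hB hy)]; exact hN y hy)
        obtain ⟨t₂, h₂, e₂⟩ := ihr (i + 1) (by omega)
        have e₃ : RamExec (.assign x (.add (.var x) (.const 1))) (p.run (st i)) 4 (st (i + 1)) := by
          have := RamExec.assign (p.run (st i)) x (.add (.var x) (.const 1))
          simpa [RamExpr.eval, run_var_of_ok hp (st i) (List.mem_cons_self), hx, hsucc,
            RamExpr.cost] using this
        refine ⟨_, ?_, RamExec.loopNext ?_ (.seq e₁ e₃) e₂⟩
        · simp only [RamExpr.cost, Nat.succ_mul]; omega
        · simp [RamExpr.eval, hx, hL _ b (hB hbB)]; omega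
    obtain ⟨t, ht, e⟩ := hloop (s.var b) 0 (by omega)
    refine ⟨2 + t, ?_, .seq (.assign s x (.const 0)) e⟩
    have := Nat.mul_le_mul_right (p.time N + 8) (hN b hbB)
    simp only [time]; omega

/-- A loop raises the degree by one. For sequences and branches the degrees are simply added, which
avoids maxima and is enough for a polynomial bound. -/
theorem exists_time_le (p : ForProg) : ∃ C d, ∀ N, p.time N ≤ C * (N + 1) ^ d := by
  have key : ∀ C d e N : ℕ, C * (N + 1) ^ d ≤ C * (N + 1) ^ (d + e) := fun C d e N =>
    Nat.mul_le_mul_left _ (Nat.pow_le_pow_right (by omega) (by omega))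
  have one : ∀ d N : ℕ, 1 ≤ (N + 1) ^ d := fun d N => Nat.one_le_pow _ _ (by omega)
  induction p with
  | skip => exact ⟨1, 0, by simp [time]⟩
  | assign x e => exact ⟨e.cost + 1, 0, by simp [time]⟩
  | write a i e => exact ⟨i.cost + e.cost + 1, 0, by simp [time]⟩
  | seq p q ihp ihq =>
    obtain ⟨C, d, h⟩ := ihp
    obtain ⟨C', d', h'⟩ := ihq
    refine ⟨C + C', d + d', fun N => ?_⟩
    have h1 := (h N).trans (key C d d' N)
    have h2 := (h' N).trans (key C' d' d N)
    rw [add_comm d' d] at h2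
    simp only [time, Nat.add_mul]; omega
  | ite b p q ihp ihq =>
    obtain ⟨C, d, h⟩ := ihp
    obtain ⟨C', d', h'⟩ := ihq
    refine ⟨b.cost + 1 + (C + C'), d + d', fun N => ?_⟩
    have h1 := (h N).trans (key C d d' N)
    have h2 := (h' N).trans (key C' d' d N)
    have h3 := Nat.mul_le_mul_left (b.cost + 1) (one (d + d') N)
    rw [add_comm d' d] at h2
    simp only [time, Nat.add_mul] at h3 ⊢; omega
  | count x b p ih =>
    obtain ⟨C, d, h⟩ := ih
    refine ⟨6 + (C + 8), d + 1, fun N => ?_⟩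
    have h3 := one (d + 1) N
    have h4 : N * (p.time N + 8) ≤ (C + 8) * (N + 1) ^ (d + 1) := by
      calc N * (p.time N + 8) ≤ (N + 1) * (C * (N + 1) ^ d + 8 * (N + 1) ^ d) :=
            Nat.mul_le_mul (by omega) (Nat.add_le_add (h N) (by have := one d N; omega))
        _ = _ := by ring
    simp only [time, Nat.add_mul 6]
    omega

/-- The running time is polynomial in the loop bounds. -/
theorem exists_exec_le {B : List ℕ} {p : ForProg} (hp : p.ok B B = true) :
    ∃ C d, ∀ (s : RamStore) (N : ℕ), (∀ b ∈ B, s.var b ≤ N) →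
      ∃ t ≤ C * (N + 1) ^ d, RamExec p.compile s t (p.run s) := by
  obtain ⟨C, d, h⟩ := p.exists_time_le
  refine ⟨C, d, fun s N hN => ?_⟩
  obtain ⟨t, ht, e⟩ := exec_run (List.Subset.refl B) hp hN
  exact ⟨t, ht.trans (h N), e⟩

/-- The invariant rule for counting loops. -/
theorem run_count {x b : ℕ} {p : ForProg} {s : RamStore} (Inv : ℕ → RamStore → Prop)
    (h0 : Inv 0 (s.setVar x 0))
    (hstep : ∀ i st, i < s.var b → st.var x = i →
      (∀ y, y ∉ (count x b p).vars → st.var y = s.var y) →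
      (∀ a, a ∉ (count x b p).arrs → st.arr a = s.arr a) →
      Inv i st → Inv (i + 1) ((p.run st).setVar x (i + 1))) :
    Inv (s.var b) ((count x b p).run s) := by
  rw [run]
  have : ∀ i, i ≤ s.var b → Inv i (Nat.rec (s.setVar x 0)
      (fun i st => (p.run st).setVar x (i + 1)) i) := by
    intro i
    induction i with
    | zero => intro _; exact h0
    | succ i ih =>
      intro hi
      set f : ℕ → RamStore := fun i => Nat.rec (s.setVar x 0)
        (fun i st => (p.run st).setVar x (i + 1)) i with hf
      have hsucc : ∀ i, f (i + 1) = (p.run (f i)).setVar x (i + 1) := fun i => rfl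
      refine hstep i (f i) (by omega) ?_ ?_ ?_ (ih (by omega))
      · cases i <;> simp [hf]
      · intro y hy
        simp only [vars, List.mem_cons, not_or] at hy
        clear ih hi
        induction i with
        | zero => simp [hf, hy.1]
        | succ i ih => rw [hsucc, RamStore.setVar_var, if_neg hy.1, run_var p _ hy.2, ih]
      · intro a ha
        simp only [arrs] at ha
        clear ih hi
        induction i with
        | zero => rfl
        | succ i ih => rw [hsucc, RamStore.setVar_arr, run_arr p _ ha, ih]
  exact this _ le_rfl

/-- A loop whose body writes the value `v i` into the cell `f i` of the array `a`. -/
theorem run_count_write {x b a : ℕ} {ie e : RamExpr} {s : RamStore} {f v : ℕ → ℕ}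
    (hf : ∀ i < s.var b, ∀ j < i, f j ≠ f i)
    (he : ∀ i st, i < s.var b → st.var x = i → (∀ y, y ≠ x → st.var y = s.var y) →
      (∀ c, c ≠ a → st.arr c = s.arr c) →
      (∀ j, (∀ i' < i, j ≠ f i') → st.arr a j = s.arr a j) →
      ie.eval st = f i ∧ e.eval st = v i) :
    (∀ i < s.var b, ((count x b (write a ie e)).run s).arr a (f i) = v i) ∧
    (∀ j, (∀ i < s.var b, j ≠ f i) →
      ((count x b (write a ie e)).run s).arr a j = s.arr a j) := by
  refine run_count (s := s) (x := x) (b := b) (p := write a ie e)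
    (fun i st => (∀ i' < i, st.arr a (f i') = v i') ∧
      ∀ j, (∀ i' < i, j ≠ f i') → st.arr a j = s.arr a j) ⟨by simp, by simp⟩ ?_
  rintro i st hi hx hvar harr ⟨h1, h2⟩
  obtain ⟨e1, e2⟩ := he i st hi hx (fun y hy => hvar y (by simpa [vars] using hy))
    (fun c hc => harr c (by simpa [arrs] using hc)) h2
  simp only [run, e1, e2, RamStore.setVar_arr, RamStore.setArr_arr, true_and]
  refine ⟨fun i' hi' => ?_, fun j hj => ?_⟩
  · rcases Nat.lt_succ_iff_lt_or_eq.mp hi' with h | rfl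
    · rw [if_neg (hf i hi i' h), h1 i' h]
    · rw [if_pos rfl]
  · rw [if_neg (hj i (by omega)), h2 j (fun i' h => hj i' (by omega))]

end ForProg

/-! ### Three-cycles and independent sets of points -/

namespace CoBase

open Equiv

variable {α : Type*} [DecidableEq α]

/-- No nontrivial element of `G` moves only points of `T`. -/
def Indep (G : Subgroup (Perm α)) (T : Finset α) : Prop :=
  ∀ g ∈ G, (∀ i, i ∉ T → g i = i) → g = 1

/-- The three-cycle `x ↦ y ↦ z ↦ x`. -/
def cyc (x y z : α) : Perm α := swap x y * swap y z

theorem cyc_conj (g : Perm α) (x y z : α) : g * cyc x y z * g⁻¹ = cyc (g x) (g y) (g z) := by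
  have h := fun a b : α => swap_apply_apply g a b
  rw [cyc, cyc, h, h]
  simp [mul_assoc]

theorem cyc_apply {x y z : α} (hxy : x ≠ y) (hyz : y ≠ z) (hxz : x ≠ z) :
    cyc x y z x = y ∧ cyc x y z y = z ∧ cyc x y z z = x ∧
      ∀ i, i ≠ x → i ≠ y → i ≠ z → cyc x y z i = i := by
  refine ⟨?_, ?_, ?_, fun i hx hy hz => ?_⟩
  · simp [cyc, swap_apply_of_ne_of_ne hxy hxz]
  · simp [cyc, swap_apply_of_ne_of_ne hxz.symm hyz.symm]
  · simp [cyc]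
  · simp [cyc, swap_apply_of_ne_of_ne hy hz, swap_apply_of_ne_of_ne hx hy]

theorem eq_cyc {x y z : α} (hxy : x ≠ y) (hyz : y ≠ z) (hxz : x ≠ z) {g : Perm α}
    (h1 : g x = y) (h2 : g y = z) (h3 : g z = x)
    (h4 : ∀ i, i ≠ x → i ≠ y → i ≠ z → g i = i) : g = cyc x y z := by
  obtain ⟨c1, c2, c3, c4⟩ := cyc_apply hxy hyz hxz
  ext i
  by_cases hx : i = x
  · rw [hx, h1, c1]
  by_cases hy : i = y
  · rw [hy, h2, c2]
  by_cases hz : i = z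
  · rw [hz, h3, c3]
  rw [h4 i hx hy hz, c4 i hx hy hz]

/-- The group contains a three-cycle on the distinct points `x`, `y`, `z`. -/
def HasCyc (G : Subgroup (Perm α)) (x y z : α) : Prop :=
  x ≠ y ∧ y ≠ z ∧ x ≠ z ∧ cyc x y z ∈ G

theorem HasCyc.rotate {G : Subgroup (Perm α)} {x y z : α} (h : HasCyc G x y z) :
    HasCyc G y z x := by
  obtain ⟨hxy, hyz, hxz, h⟩ := h
  obtain ⟨c1, c2, c3, c4⟩ := cyc_apply hxy hyz hxz
  refine ⟨hyz, hxz.symm, hxy.symm, ?_⟩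
  rwa [← eq_cyc (g := cyc x y z) hyz hxz.symm hxy.symm c2 c3 c1
    (fun i h1 h2 h3 => c4 i h3 h1 h2)]

theorem HasCyc.reverse {G : Subgroup (Perm α)} {x y z : α} (h : HasCyc G x y z) :
    HasCyc G x z y := by
  obtain ⟨hxy, hyz, hxz, h⟩ := h
  obtain ⟨c1, c2, c3, c4⟩ := cyc_apply hxy hyz hxz
  refine ⟨hxz, hyz.symm, hxy, ?_⟩
  rw [← eq_cyc (g := (cyc x y z)⁻¹) hxz hyz.symm hxy (by rw [Perm.inv_eq_iff_eq, c3])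
    (by rw [Perm.inv_eq_iff_eq, c2]) (by rw [Perm.inv_eq_iff_eq, c1])
    (fun i h1 h2 h3 => by rw [Perm.inv_eq_iff_eq, c4 i h1 h3 h2])]
  exact G.inv_mem h

theorem HasCyc.conj {G : Subgroup (Perm α)} {x y z : α} (h : HasCyc G x y z) {g : Perm α}
    (hg : g ∈ G) : HasCyc G (g x) (g y) (g z) := by
  refine ⟨g.injective.ne h.1, g.injective.ne h.2.1, g.injective.ne h.2.2.1, ?_⟩
  rw [← cyc_conj]
  exact G.mul_mem (G.mul_mem hg h.2.2.2) (G.inv_mem hg)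

/-- Conjugation by the cycle `x ↦ z ↦ w ↦ x` turns the cycle on `x, y, w` into one on `z, y, x`. -/
theorem HasCyc.share_two {G : Subgroup (Perm α)} {x y z w : α} (h : HasCyc G x y w)
    (h' : HasCyc G x z w) (hyz : y ≠ z) : HasCyc G x y z := by
  obtain ⟨c1, c2, c3, c4⟩ := cyc_apply h'.1 h'.2.1 h'.2.2.1
  have := h.conj h'.2.2.2
  rw [c1, c4 y h.1.symm hyz h.2.1, c3] at this
  exact this.reverse.rotate

/-- If `x` is the only common point, conjugating the cycle on `x, z, v` by the one on `x, y, w`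
gives a cycle on `y, z, v`. Conjugating the cycle on `x, z, v` by this one gives a cycle on `x, v,
y`, which shares two points with the cycle on `x, z, v`. -/
theorem HasCyc.share_one {G : Subgroup (Perm α)} {x y z w v : α} (h : HasCyc G x y w)
    (h' : HasCyc G x z v) (hyz : y ≠ z) : HasCyc G x y z := by
  by_cases hwz : w = z
  · rwa [hwz] at h
  by_cases hvy : v = y
  · rw [hvy] at h'; exact h'.reverse
  by_cases hvw : v = w
  · rw [hvw] at h'; exact h.share_two h' hyz
  obtain ⟨c1, c2, c3, c4⟩ := cyc_apply h.1 h.2.1 h.2.2.1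
  have h1 := h'.conj h.2.2.2
  rw [c1, c4 z h'.1.symm hyz.symm (Ne.symm hwz), c4 v h'.2.2.1.symm hvy hvw] at h1
  obtain ⟨d1, d2, d3, d4⟩ := cyc_apply h1.1 h1.2.1 h1.2.2.1
  have h2 := h'.conj h1.2.2.2
  rw [d2, d3, d4 x h.1 h'.1 h'.2.2.1] at h2
  exact h2.reverse.share_two h' hyz

/-- Two points are related when they are equal or on a common three-cycle of the group. -/
def CycRel (G : Subgroup (Perm α)) (x y : α) : Prop :=
  x = y ∨ ∃ z, HasCyc G x y z

theorem CycRel.symm {G : Subgroup (Perm α)} {x y : α} (h : CycRel G x y) : CycRel G y x := by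
  rcases h with rfl | ⟨z, h⟩
  · exact .inl rfl
  · exact .inr ⟨z, h.rotate.reverse⟩

/-- Any two points of a class can be completed to a three-cycle by any third point of the class, not
just by some special one. This freedom is what the exchange of excess points needs. -/
theorem CycRel.hasCyc {G : Subgroup (Perm α)} {x y z : α} (h : CycRel G x y) (h' : CycRel G x z)
    (hxy : x ≠ y) (hxz : x ≠ z) (hyz : y ≠ z) : HasCyc G x y z := by
  obtain ⟨w, h⟩ := h.resolve_left hxy
  obtain ⟨v, h'⟩ := h'.resolve_left hxz
  exact h.share_one h' hyz

theorem CycRel.trans {G : Subgroup (Perm α)} {x y z : α} (h : CycRel G x y) (h' : CycRel G y z) :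
    CycRel G x z := by
  by_cases hxy : x = y
  · rwa [hxy]
  by_cases hyz : y = z
  · rwa [← hyz]
  by_cases hxz : x = z
  · exact .inl hxz
  exact .inr ⟨y, (h.symm.hasCyc h' (Ne.symm hxy) hyz hxz).rotate⟩

/-- The elements that move only points of the image of `T` under `g` are the conjugates by `g` of
those that move only points of `T`. -/
theorem Indep.image {G : Subgroup (Perm α)} {T : Finset α} (h : Indep G T) {g : Perm α}
    (hg : g ∈ G) : Indep G (T.image g) := by
  intro f hf hfix
  have h1 : g⁻¹ * f * g = 1 := by
    refine h _ (G.mul_mem (G.mul_mem (G.inv_mem hg) hf) hg) fun i hi => ?_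
    rw [Perm.mul_apply, Perm.mul_apply, hfix (g i) (by simpa using hi)]; simp
  have h2 : f = g * (g⁻¹ * f * g) * g⁻¹ := by group
  rw [h2, h1]; group

theorem Indep.mono {β : Type*} {G : Subgroup (Perm β)} {S T : Finset β} (h : Indep G T) (hST : S ⊆ T) :
    Indep G S :=
  fun g hg hfix => h g hg fun i hi => hfix i fun hi' => hi (hST hi')

open Classical in
/-- The points that have at least `k + 1` smaller points in their class. -/
noncomputable def excess (G : Subgroup (Perm ℕ)) (n k : ℕ) : Finset ℕ :=
  (Finset.range n).filter fun x => k + 1 ≤ ((Finset.range x).filter fun y => CycRel G x y).card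

open Classical in
/-- Excess points can be removed from an independent set. -/
theorem exists_indep_sdiff_excess (G : Subgroup (Perm ℕ)) (n k : ℕ) (T : Finset ℕ)
    (hT : T ⊆ Finset.range n) (hk : T.card ≤ k) (hI : Indep G T) :
    ∃ T' ⊆ Finset.range n \ excess G n k, T'.card = T.card ∧ Indep G T' := by
  -- The induction is on the number of excess points in `T`: each round replaces one of them by a
  -- non-excess point.
  induction hr : (T ∩ excess G n k).card generalizing T with
  | zero =>
    refine ⟨T, fun x hx => Finset.mem_sdiff.mpr ⟨hT hx, fun h => ?_⟩, rfl, hI⟩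
    have := Finset.card_eq_zero.mp hr
    exact Finset.notMem_empty x (this ▸ Finset.mem_inter.mpr ⟨hx, h⟩)
  | succ r ih =>
    obtain ⟨x, hx⟩ : (T ∩ excess G n k).Nonempty := Finset.card_pos.mp (by omega)
    obtain ⟨hxT, hxR⟩ := Finset.mem_inter.mp hx
    obtain ⟨hxn, hxk⟩ := Finset.mem_filter.mp hxR
    rw [Finset.mem_range] at hxn
    -- the `k + 1` smallest points of the class are not excess points
    obtain ⟨A, hA, hAcard⟩ : ∃ A : Finset ℕ, (∀ y ∈ A, y < x ∧ CycRel G x y ∧ y ∉ excess G n k) ∧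
        k + 1 ≤ A.card := by
      refine ⟨((Finset.range x).filter fun y => CycRel G x y ∧ y ∉ excess G n k), ?_, ?_⟩
      · intro y hy; simpa using hy
      · clear hr ih hx hxT hxR
        induction x using Nat.strong_induction_on with
        | _ x ihx =>
          -- Pass to a smaller excess point of the class if there is one. At the least excess point
          -- of the class, all smaller points of the class are non-excess, and there are at least `k
          -- + 1` of them.
          by_cases hex : ∃ z < x, CycRel G x z ∧ z ∈ excess G n k
          · obtain ⟨z, hzx, hz, hzR⟩ := hex
            obtain ⟨hzn, hzk⟩ := Finset.mem_filter.mp hzR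
            refine (ihx z hzx (by simpa using hzn) hzk).trans (Finset.card_le_card ?_)
            intro y hy
            simp only [Finset.mem_filter, Finset.mem_range] at hy ⊢
            exact ⟨hy.1.trans hzx, hz.trans hy.2.1, hy.2.2⟩
          · push Not at hex
            refine hxk.trans (Finset.card_le_card fun y hy => ?_)
            simp only [Finset.mem_filter, Finset.mem_range] at hy ⊢
            exact ⟨hy.1, hy.2, hex y hy.1 hy.2⟩
    -- Since `x` is in `T` but not in `A`, at most `k - 1` points of `A` are in `T`. Two free points
    -- are needed: `y` replaces `x`, and `z` completes the three-cycle without disturbing the rest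
    -- of `T`.
    have hcard : 1 < (A \ T).card := by
      have h1 : (A ∩ T).card ≤ (T.erase x).card := Finset.card_le_card fun y hy => by
        obtain ⟨hyA, hyT⟩ := Finset.mem_inter.mp hy
        exact Finset.mem_erase.mpr ⟨(hA y hyA).1.ne, hyT⟩
      have h2 := Finset.card_sdiff_add_card_inter A T
      rw [Finset.card_erase_of_mem hxT] at h1
      have := Finset.card_pos.mpr ⟨x, hxT⟩
      omega
    obtain ⟨y, hy, z, hz, hyz⟩ := Finset.one_lt_card.mp hcard
    obtain ⟨hyA, hyT⟩ := Finset.mem_sdiff.mp hy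
    obtain ⟨hzA, hzT⟩ := Finset.mem_sdiff.mp hz
    have hc : HasCyc G x y z := (hA y hyA).2.1.hasCyc (hA z hzA).2.1 (hA y hyA).1.ne'
      (hA z hzA).1.ne' hyz
    obtain ⟨c1, c2, c3, c4⟩ := cyc_apply hc.1 hc.2.1 hc.2.2.1
    have himg : T.image (cyc x y z) = insert y (T.erase x) := by
      ext i
      simp only [Finset.mem_image, Finset.mem_insert, Finset.mem_erase]
      constructor
      · rintro ⟨j, hj, rfl⟩
        by_cases hjx : j = x
        · left; rw [hjx, c1]
        · have h1 := c4 j hjx (by rintro rfl; exact hyT hj) (by rintro rfl; exact hzT hj)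
          rw [h1]; exact .inr ⟨hjx, hj⟩
      · rintro (rfl | ⟨hix, hi⟩)
        · exact ⟨x, hxT, c1⟩
        · exact ⟨i, hi, c4 i hix (by rintro rfl; exact hyT hi) (by rintro rfl; exact hzT hi)⟩
    have hcardT : (T.image (cyc x y z)).card = T.card :=
      Finset.card_image_of_injective _ (cyc x y z).injective
    obtain ⟨T', h1, h2, h3⟩ := ih (T.image (cyc x y z)) (by
        rw [himg]
        intro i hi
        rcases Finset.mem_insert.mp hi with rfl | hi
        · exact Finset.mem_range.mpr ((hA i hyA).1.trans hxn)
        · exact hT (Finset.mem_of_mem_erase hi)) (by rw [hcardT]; exact hk) (hI.image hc.2.2.2) (by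
        have : T.image (cyc x y z) ∩ excess G n k = (T ∩ excess G n k).erase x := by
          rw [himg]
          ext i
          simp only [Finset.mem_inter, Finset.mem_insert, Finset.mem_erase]
          constructor
          · rintro ⟨rfl | h, h'⟩
            · exact absurd h' (hA i hyA).2.2
            · exact ⟨h.1, h.2, h'⟩
          · rintro ⟨h, h', h''⟩
            exact ⟨.inr ⟨h, h'⟩, h''⟩
        rw [this, Finset.card_erase_of_mem hx, hr]; rfl)
    exact ⟨T', h1, h2.trans hcardT, h3⟩

-- Among `k + 2` non-excess points of one class, the largest would have `k + 1` smaller points in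
-- its class and so be an excess point.
open Classical in
theorem card_class_sdiff_excess_le (G : Subgroup (Perm ℕ)) (n k x : ℕ) :
    ((Finset.range n \ excess G n k).filter fun y => CycRel G x y).card ≤ k + 1 := by
  by_contra! h
  set C := (Finset.range n \ excess G n k).filter fun y => CycRel G x y with hC
  have hne : C.Nonempty := Finset.card_pos.mp (by omega)
  have hM := C.max'_mem hne
  set M := C.max' hne
  obtain ⟨h1, h2⟩ := Finset.mem_filter.mp hM
  obtain ⟨h3, h4⟩ := Finset.mem_sdiff.mp h1
  refine h4 (Finset.mem_filter.mpr ⟨h3, ?_⟩)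
  have h5 : (C.erase M).card ≤ ((Finset.range M).filter fun y => CycRel G M y).card := by
    refine Finset.card_le_card fun y hy => ?_
    obtain ⟨hyM, hyC⟩ := Finset.mem_erase.mp hy
    refine Finset.mem_filter.mpr ⟨Finset.mem_range.mpr
      (lt_of_le_of_ne (C.le_max' y hyC) hyM), h2.symm.trans (Finset.mem_filter.mp hyC).2⟩
  rw [Finset.card_erase_of_mem hM] at h5
  omega

/-! ### Many pairwise unrelated points contain a large independent set -/

/-- Two elements that move one point outside of `I` each, in the same pattern, give a
three-cycle through these points. -/
theorem hasCyc_of_same_pattern {G : Subgroup (Perm α)} {I : Finset α} {x y : α} (hxI : x ∉ I)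
    (hyI : y ∉ I) (hxy : x ≠ y) {g h : Perm α} (hg : g ∈ G) (hh : h ∈ G)
    (hgfix : ∀ i, i ∉ insert x I → g i = i) (hhfix : ∀ i, i ∉ insert y I → h i = i)
    (hgx : g x ≠ x) (hhy : h y ≠ y)
    (hmem : ∀ i ∈ I, g i ∈ I ↔ h i ∈ I) (heq : ∀ i ∈ I, g i ∈ I → g i = h i) :
    ∃ z, HasCyc G x y z := by
  have stay : ∀ {a : α} {f : Perm α}, (∀ i, i ∉ insert a I → f i = i) → ∀ i ∈ insert a I,
      f i ∈ insert a I := by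
    intro a f hf i hi
    by_contra hc
    have h1 := f.injective (hf _ hc)
    rw [h1] at hc; exact hc hi
  have hgy : g y = y := hgfix y (by simp [hxy.symm, hyI])
  have hhx : h x = x := hhfix x (by simp [hxy, hxI])
  obtain ⟨p, hp⟩ := g.surjective x
  have hpx : p ≠ x := by rintro rfl; exact hgx hp
  have hpI : p ∈ I := by
    by_contra hc
    have h1 := hgfix p (by simp [hpx, hc])
    exact hpx (h1.symm.trans hp)
  -- The element `g` takes `p` out of `I`. By the equality of the patterns so does `h`, and `y` is
  -- the only point outside of `I` that `h` can reach from there.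
  have hhp : h p = y := by
    have h1 := stay hhfix p (Finset.mem_insert_of_mem hpI)
    have h2 : h p ∉ I := by rw [← hmem p hpI, hp]; exact hxI
    simpa [h2] using h1
  have hpy : p ≠ y := by rintro rfl; exact hyI hpI
  have hhyI : h y ∈ I := by
    simpa [hhy] using stay hhfix y (Finset.mem_insert_self _ _)
  obtain ⟨r, hr⟩ := g.surjective (h y)
  -- If the preimage `r` of `h y` under `g` were in `I`, the patterns would give `h r = h y`, hence
  -- `r = y`. So it is `x`, which means `g x = h y`.
  have hrx : r = x := by
    by_contra hrx
    have hrI : r ∈ I := by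
      by_contra hc
      have h1 := hgfix r (by simp [hrx, hc])
      rw [← h1, hr] at hc; exact hc hhyI
    have h1 := heq r hrI (by rw [hr]; exact hhyI)
    rw [hr] at h1
    have := h.injective h1
    rw [← this] at hrI; exact hyI hrI
  rw [hrx] at hr
  -- By the facts collected so far, `g` and `h` disagree only at `p`, `y` and `x`, and the quotient
  -- rotates these three points.
  have key : g⁻¹ * h = cyc p y x := by
    refine eq_cyc hpy hxy.symm hpx ?_ ?_ ?_ fun i h1 h2 h3 => ?_
    · rw [Perm.mul_apply, Perm.inv_eq_iff_eq, hhp, hgy]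
    · rw [Perm.mul_apply, Perm.inv_eq_iff_eq, hr]
    · rw [Perm.mul_apply, Perm.inv_eq_iff_eq, hhx, hp]
    · rw [Perm.mul_apply, Perm.inv_eq_iff_eq]
      by_cases hi : i ∈ I
      · refine (heq i hi ?_).symm
        have h4 := stay hgfix i (Finset.mem_insert_of_mem hi)
        refine (Finset.mem_insert.mp h4).resolve_left fun h5 => h1 (g.injective (h5.trans hp.symm))
      · rw [hhfix i (by simp [h2, hi]), hgfix i (by simp [h3, hi])]
  have : HasCyc G p y x := ⟨hpy, hxy.symm, hpx, key ▸ G.mul_mem (G.inv_mem hg) hh⟩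
  exact ⟨p, this.rotate.rotate.reverse⟩

open Classical in
/-- A set without two related points in which all independent sets have fewer than `k` points
is small. -/
theorem card_le_of_no_indep {G : Subgroup (Perm α)} {X : Finset α} {k : ℕ} (hk : 2 ≤ k)
    (hX : ∀ x ∈ X, ∀ y ∈ X, CycRel G x y → x = y)
    (hno : ∀ T ⊆ X, T.card = k → ¬ Indep G T) : X.card ≤ (k - 1) + k ^ (k - 1) := by
  obtain ⟨I, hI, hmax⟩ := Finset.exists_max_image (X.powerset.filter (Indep G)) Finset.card
    ⟨∅, by
      simp only [Finset.mem_filter, Finset.empty_mem_powerset, true_and]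
      intro g _ h; ext i; simp [h i]⟩
  simp only [Finset.mem_filter, Finset.mem_powerset] at hI hmax
  obtain ⟨hIX, hI⟩ := hI
  have hIk : I.card < k := by
    by_contra! hc
    obtain ⟨T, hT, hTk⟩ := Finset.exists_subset_card_eq hc
    exact hno T (hT.trans hIX) hTk (hI.mono hT)
  -- Maximality makes `insert x I` dependent. A nontrivial element that witnesses this must move
  -- `x`, as otherwise it would contradict the independence of `I`.
  have hg : ∀ x, x ∈ X \ I → ∃ g ∈ G, (∀ i, i ∉ insert x I → g i = i) ∧ g x ≠ x := by
    intro x hx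
    obtain ⟨hxX, hxI⟩ := Finset.mem_sdiff.mp hx
    have h1 : ¬ Indep G (insert x I) := by
      intro h
      have := hmax (insert x I) ⟨Finset.insert_subset hxX hIX, h⟩
      rw [Finset.card_insert_of_notMem hxI] at this
      omega
    simp only [Indep, not_forall] at h1
    obtain ⟨g, hgG, hfix, hg1⟩ := h1
    refine ⟨g, hgG, hfix, fun h => hg1 (hI g hgG fun i hi => ?_)⟩
    by_cases hix : i = x
    · rw [hix, h]
    · exact hfix i (by simp [hix, hi])
  choose! g hgG hgfix hgx using hg
  have hsd : (X \ I).card ≤ k ^ (k - 1) := by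
    by_contra! hc
    -- The pattern on `I`. The value `none` means that the image is `x`, the only point outside of
    -- `I` that is possible. With at most `k - 1` points in `I` there are at most `k ^ (k - 1)`
    -- patterns.
    let φ : α → (I → Option I) := fun x i => if h : g x i ∈ I then some ⟨g x i, h⟩ else none
    have hcard : (Finset.univ : Finset (I → Option I)).card ≤ k ^ (k - 1) := by
      rw [Finset.card_univ, Fintype.card_fun, Fintype.card_option, Fintype.card_coe]
      exact (Nat.pow_le_pow_left (by omega) _).trans (Nat.pow_le_pow_right (by omega) (by omega))
    obtain ⟨x, hx, y, hy, hxy, hφ⟩ := Finset.exists_ne_map_eq_of_card_lt_of_maps_to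
      (hcard.trans_lt hc) (f := φ) (fun _ _ => Finset.mem_coe.mpr (Finset.mem_univ _))
    obtain ⟨hxX, hxI⟩ := Finset.mem_sdiff.mp hx
    obtain ⟨hyX, hyI⟩ := Finset.mem_sdiff.mp hy
    have hφ' : ∀ i (hi : i ∈ I), φ x ⟨i, hi⟩ = φ y ⟨i, hi⟩ := fun i hi => by rw [hφ]
    refine hxy (hX x hxX y hyX (.inr (hasCyc_of_same_pattern hxI hyI hxy (hgG x hx) (hgG y hy)
      (hgfix x hx) (hgfix y hy) (hgx x hx) (hgx y hy) (fun i hi => ?_) fun i hi hgi => ?_)))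
    · have := hφ' i hi
      simp only [φ] at this
      split_ifs at this with h1 h2 <;> simp_all
    · have := hφ' i hi
      simp only [φ, dif_pos hgi] at this
      split_ifs at this with h1
      simpa using this
  have := Finset.card_sdiff_add_card_inter X I
  have h2 : (X ∩ I).card ≤ I.card := Finset.card_le_card Finset.inter_subset_right
  omega

/-- For `k` at least 2, the first factor is at most `k ^ k` and the second at most `k ^ 2`; the
product `k ^ (k + 2)` leaves room. -/
theorem arith_bound {k : ℕ} (hk : 2 ≤ k) :
    ((k - 1) + k ^ (k - 1)) * (k + 1) ≤ k ^ (2 * k + 1) := by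
  have h1 : k - 1 + k ^ (k - 1) ≤ k ^ k := by
    have h2 : k - 1 ≤ k ^ (k - 1) := (Nat.lt_pow_self (by omega)).le
    calc k - 1 + k ^ (k - 1) ≤ 2 * k ^ (k - 1) := by omega
      _ ≤ k * k ^ (k - 1) := Nat.mul_le_mul_right _ hk
      _ = k ^ k := by rw [← pow_succ', Nat.sub_add_cancel (by omega)]
  calc _ ≤ k ^ k * k ^ 2 := Nat.mul_le_mul h1 (by nlinarith)
    _ = k ^ (k + 2) := by rw [pow_add]
    _ ≤ _ := Nat.pow_le_pow_right (by omega) (by omega)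

open Classical in
/-- A large set with small classes contains an independent set of `k` points. -/
theorem exists_indep_of_card_lt {G : Subgroup (Perm α)} {Y : Finset α} {k : ℕ}
    (hcls : ∀ x ∈ Y, (Y.filter fun y => CycRel G x y).card ≤ k + 1)
    (hY : k ^ (2 * k + 1) < Y.card) : ∃ T ⊆ Y, T.card = k ∧ Indep G T := by
  rcases Nat.lt_or_ge k 2 with hk | hk
  · obtain ⟨T, hT, hTk⟩ : ∃ T ⊆ Y, T.card = k := Finset.exists_subset_card_eq (by
      interval_cases k <;> omega)
    refine ⟨T, hT, hTk, fun g _ hfix => ?_⟩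
    ext i
    by_cases hi : i ∈ T
    · by_cases hgi : g i ∈ T
      · exact Finset.card_le_one.mp (by omega) _ hgi _ hi
      · exact g.injective (hfix _ hgi)
    · simp [hfix i hi]
  · obtain ⟨X, hX, hmax⟩ := Finset.exists_max_image
      (Y.powerset.filter fun X => ∀ x ∈ X, ∀ y ∈ X, CycRel G x y → x = y) Finset.card
      ⟨∅, by simp⟩
    simp only [Finset.mem_filter, Finset.mem_powerset] at hX hmax
    by_contra! hno
    have h1 := card_le_of_no_indep hk hX.2 (fun T hT => hno T (hT.trans hX.1))
    -- By maximality `X` meets every class of `Y`, so the classes of its points cover `Y`.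
    have h2 : Y ⊆ X.biUnion fun x => Y.filter fun y => CycRel G x y := by
      intro y hy
      rw [Finset.mem_biUnion]
      by_contra! hc
      have hc' : ∀ x ∈ X, ¬ CycRel G x y := fun x hx h => hc x hx (by simp [hy, h])
      have hyX : y ∉ X := fun h => hc' y h (.inl rfl)
      have := hmax (insert y X) ⟨Finset.insert_subset hy hX.1, fun a ha b hb hab => by
        rcases Finset.mem_insert.mp ha with h₁ | ha' <;>
            rcases Finset.mem_insert.mp hb with h₂ | hb'
        · rw [h₁, h₂]
        · exact absurd (h₁ ▸ hab.symm) (hc' b hb')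
        · exact absurd (h₂ ▸ hab) (hc' a ha')
        · exact hX.2 a ha' b hb' hab⟩
      rw [Finset.card_insert_of_notMem hyX] at this
      omega
    have h3 := (Finset.card_le_card h2).trans
      (Finset.card_biUnion_le_card_mul X _ (k + 1) fun x hx => hcls x (hX.1 hx))
    have h4 := Nat.mul_le_mul_right (k + 1) h1
    have := arith_bound hk
    omega

end CoBase

/-! ### Stabilizer chains -/

namespace CoBase

open Equiv

/-- In a group of finitely supported permutations inverses are powers. Hence closure under products
will be enough to reach the whole group in `IsRepTable.complete`. -/
theorem isOfFinOrder_of_fixes {n : ℕ} {g : Perm ℕ} (hg : ∀ x, n ≤ x → g x = x) :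
    IsOfFinOrder g := by
  have h1 : ∀ x, x < n ↔ g x < n := by
    intro x
    constructor
    · intro hx
      by_contra! hc
      have := g.injective (hg _ hc)
      omega
    · intro hx
      by_contra! hc
      rw [hg x hc] at hx; omega
  rw [← Perm.ofSubtype_subtypePerm (p := fun x => x < n) (fun x => (h1 x).symm) (fun x hx => by
    by_contra! hc; exact hx (hg x hc))]
  exact MonoidHom.isOfFinOrder _ (isOfFinOrder_of_finite _)

/-- A partial table of coset representatives: the entry `i * n + j` is either the identity or
fixes all points below `i` and maps `i` to `j ≠ i`. -/
structure IsRepTable (G : Subgroup (Perm ℕ)) (n : ℕ) (T : ℕ → Perm ℕ) : Prop where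
  mem : ∀ p, T p ∈ G
  shape : ∀ i < n, ∀ j < n, T (i * n + j) = 1 ∨
    (i ≠ j ∧ (∀ x < i, T (i * n + j) x = x) ∧ T (i * n + j) i = j)
  outside : ∀ p, n * n ≤ p → T p = 1

/-- The table `T'` has all the representatives of `T`. -/
def TableExt (n : ℕ) (T T' : ℕ → Perm ℕ) : Prop :=
  ∀ i < n, ∀ j < n, T (i * n + j) i = j → T' (i * n + j) = T (i * n + j)

/-- The products of representatives, one for each row from row `i` on. -/
inductive Sifts (n : ℕ) (T : ℕ → Perm ℕ) : ℕ → Perm ℕ → Prop where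
  | one : Sifts n T n 1
  | mul {i j : ℕ} {g : Perm ℕ} : i < n → j < n → T (i * n + j) i = j → Sifts n T (i + 1) g →
      Sifts n T i (T (i * n + j) * g)

variable {G : Subgroup (Perm ℕ)} {n : ℕ} {T T' T'' : ℕ → Perm ℕ}

theorem TableExt.refl (n : ℕ) (T : ℕ → Perm ℕ) : TableExt n T T := fun _ _ _ _ _ => rfl

theorem TableExt.trans (h : TableExt n T T') (h' : TableExt n T' T'') : TableExt n T T'' := by
  intro i hi j hj hf
  have h1 := h i hi j hj hf
  rw [h' i hi j hj (by rw [h1, hf]), h1]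

theorem Sifts.mono {i : ℕ} {g : Perm ℕ} (h : Sifts n T i g) (hT : TableExt n T T') :
    Sifts n T' i g := by
  induction h with
  | one => exact .one
  | mul hi hj hf _ ih =>
    rw [← hT _ hi _ hj hf]
    exact .mul hi hj (by rw [hT _ hi _ hj hf, hf]) ih

namespace IsRepTable

theorem diag (h : IsRepTable G n T) {i : ℕ} (hi : i < n) : T (i * n + i) = 1 := by
  rcases h.shape i hi i hi with h | ⟨h, -⟩
  · exact h
  · exact absurd rfl h

theorem fixes (h : IsRepTable G n T) {i j : ℕ} (hi : i < n) (hj : j < n) {x : ℕ} (hx : x < i) :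
    T (i * n + j) x = x := by
  rcases h.shape i hi j hj with h | ⟨-, h, -⟩
  · simp [h]
  · exact h x hx

theorem eq_one_of_ne (h : IsRepTable G n T) {i j : ℕ} (hi : i < n) (hj : j < n)
    (hne : T (i * n + j) i ≠ j) : T (i * n + j) = 1 := by
  rcases h.shape i hi j hj with h | ⟨-, -, h⟩
  · exact h
  · exact absurd h hne

theorem sifts_fixes (h : IsRepTable G n T) {i : ℕ} {g : Perm ℕ} (hg : Sifts n T i g) :
    ∀ x < i, g x = x := by
  induction hg with
  | one => intro x _; rfl
  | mul hi hj _ _ ih =>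
    intro x hx
    rw [Perm.mul_apply, ih x (by omega), h.fixes hi hj hx]

theorem sifts_cases {i : ℕ} (hi : i < n) {g : Perm ℕ} (hg : Sifts n T i g) :
    ∃ j < n, T (i * n + j) i = j ∧ ∃ g', Sifts n T (i + 1) g' ∧ g = T (i * n + j) * g' := by
  cases hg with
  | one => omega
  | mul _ hj hf hg' => exact ⟨_, hj, hf, _, hg', rfl⟩

theorem sifts_apply (h : IsRepTable G n T) {i : ℕ} (hi : i < n) {g : Perm ℕ}
    (hg : Sifts n T i g) : g i < n ∧ T (i * n + g i) i = g i ∧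
      ∃ g', Sifts n T (i + 1) g' ∧ g = T (i * n + g i) * g' := by
  obtain ⟨j, hj, hf, g', hg', rfl⟩ := sifts_cases hi hg
  have h1 : (T (i * n + j) * g') i = j := by
    rw [Perm.mul_apply, h.sifts_fixes hg' i (by omega), hf]
  rw [h1]; exact ⟨hj, hf, g', hg', rfl⟩

/-- The factor of row `x` maps `x` to its image under what is left of the element. For a fixed point
this is the diagonal entry, which is the identity and can be dropped. -/
theorem sifts_of_fixes (h : IsRepTable G n T) {g : Perm ℕ} (hg : Sifts n T 0 g) {i : ℕ}
    (hi : i ≤ n) (hfix : ∀ x < i, g x = x) : Sifts n T i g := by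
  induction i with
  | zero => exact hg
  | succ i ih =>
    obtain ⟨-, -, g', hg', h2⟩ := h.sifts_apply (by omega)
      (ih (by omega) fun x hx => hfix x (by omega))
    rw [hfix i (by omega), h.diag (by omega), one_mul] at h2
    rwa [h2]

theorem sifts_one (h : IsRepTable G n T) {i : ℕ} (hi : i ≤ n) : Sifts n T i 1 := by
  induction hi using Nat.decreasingInduction with
  | self => exact .one
  | of_succ i hi ih =>
    have := Sifts.mul hi hi (by rw [h.diag hi]; rfl) ih
    rwa [h.diag hi, one_mul] at this

/-- Only rows from `i` on contribute. Together with completeness of the table this shows that the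
last rows generate a pointwise stabilizer. -/
theorem sifts_mem_closure {i : ℕ} {g : Perm ℕ} (hg : Sifts n T i g) :
    g ∈ Subgroup.closure {t | ∃ i' j, i ≤ i' ∧ i' < n ∧ j < n ∧ t = T (i' * n + j)} := by
  induction hg with
  | one => exact one_mem _
  | @mul i j g hi hj _ _ ih =>
    refine mul_mem (Subgroup.subset_closure ⟨i, j, le_rfl, hi, hj, rfl⟩)
      (Subgroup.closure_mono ?_ ih)
    rintro t ⟨i', j', h1, h2, h3, h4⟩
    exact ⟨i', j', by omega, h2, h3, h4⟩

/-- If the products of two representatives can be sifted, then the products of sifted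
elements can. -/
theorem sifts_mul (h : IsRepTable G n T)
    (hcl : ∀ i < n, ∀ j < n, ∀ i' < n, ∀ j' < n, Sifts n T 0 (T (i * n + j) * T (i' * n + j')))
    {i : ℕ} (hi : i ≤ n) : ∀ g g', Sifts n T i g → Sifts n T i g' → Sifts n T i (g * g') := by
  induction hi using Nat.decreasingInduction with
  | self =>
    intro g g' hg hg'
    cases hg with
    | one => rwa [one_mul]
    | mul hi => omega
  | of_succ i hi ih =>
    -- Both factors fix everything below `i`, so the sifted form of their product begins in row `i`.
    have two : ∀ i' j' j, i ≤ i' → i' < n → j' < n → j < n →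
        Sifts n T i (T (i' * n + j') * T (i * n + j)) := by
      intro i' j' j h1 h2 h3 h4
      refine h.sifts_of_fixes (hcl i' h2 j' h3 i hi j h4) hi.le fun x hx => ?_
      rw [Perm.mul_apply, h.fixes hi h4 hx, h.fixes h2 h3 (hx.trans_le h1)]
    -- A sifted element of later rows is moved past a representative of row `i` one factor at a
    -- time. Each exchange produces a new representative of row `i` and a remainder in the later
    -- rows, which the induction hypothesis `ih` absorbs.
    have swap : ∀ i' a, Sifts n T i' a → i + 1 ≤ i' → ∀ j < n, T (i * n + j) i = j →
        Sifts n T i (a * T (i * n + j)) := by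
      intro i' a ha
      induction ha with
      | one =>
        intro _ j hj hf
        have := Sifts.mul hi hj hf (h.sifts_one hi)
        rwa [mul_one] at this
      | @mul i' j' a hi' hj' _ _ iha =>
        intro hle j hj hf
        obtain ⟨j₁, hj₁, hf₁, a', ha', e⟩ := sifts_cases hi (iha (by omega) j hj hf)
        obtain ⟨j₂, hj₂, hf₂, a'', ha'', e'⟩ := sifts_cases hi
          (two i' j' j₁ (by omega) hi' hj' hj₁)
        rw [mul_assoc, e, ← mul_assoc, e', mul_assoc]
        exact .mul hi hj₂ hf₂ (ih _ _ ha'' ha')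
    intro g g' hg hg'
    obtain ⟨j, hj, hf, a, ha, rfl⟩ := sifts_cases hi hg
    obtain ⟨j', hj', hf', a', ha', rfl⟩ := sifts_cases hi hg'
    obtain ⟨j₁, hj₁, hf₁, b, hb, e⟩ := sifts_cases hi (swap _ a ha le_rfl j' hj' hf')
    obtain ⟨j₂, hj₂, hf₂, c, hc, e'⟩ := sifts_cases hi (two i j j₁ le_rfl hi hj hj₁)
    have : T (i * n + j) * a * (T (i * n + j') * a') = T (i * n + j₂) * (c * (b * a')) := by
      calc _ = T (i * n + j) * (a * T (i * n + j')) * a' := by group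
        _ = T (i * n + j) * T (i * n + j₁) * b * a' := by rw [e]; group
        _ = _ := by rw [e']; group
    rw [this]
    exact .mul hi hj₂ hf₂ (ih _ _ hc (ih _ _ hb ha'))

/-- If moreover the generators can be sifted, then every element of the group can. -/
theorem complete (h : IsRepTable G n T) (hG : ∀ g ∈ G, ∀ x, n ≤ x → g x = x)
    (hcl : ∀ i < n, ∀ j < n, ∀ i' < n, ∀ j' < n, Sifts n T 0 (T (i * n + j) * T (i' * n + j')))
    {S : Set (Perm ℕ)} (hS : G = Subgroup.closure S) (hgen : ∀ g ∈ S, Sifts n T 0 g)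
    {g : Perm ℕ} (hg : g ∈ G) : Sifts n T 0 g := by
  rw [hS] at hg
  induction hg using Subgroup.closure_induction with
  | mem x hx => exact hgen x hx
  | one => exact h.sifts_one (Nat.zero_le n)
  | mul x y _ _ hx hy => exact h.sifts_mul hcl (Nat.zero_le n) x y hx hy
  | inv x hx ih =>
    have hfin := isOfFinOrder_of_fixes (hG x (hS ▸ hx))
    have hpow : ∀ k, Sifts n T 0 (x ^ k) := by
      intro k
      induction k with
      | zero => exact h.sifts_one (Nat.zero_le n)
      | succ k ihk => rw [pow_succ]; exact h.sifts_mul hcl (Nat.zero_le n) _ _ ihk ih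
    have h1 : x⁻¹ = x ^ (orderOf x - 1) := by
      rw [inv_eq_iff_mul_eq_one, ← pow_succ', Nat.sub_add_cancel hfin.orderOf_pos,
        pow_orderOf_eq_one]
    rw [h1]; exact hpow _

theorem one (G : Subgroup (Perm ℕ)) (n : ℕ) : IsRepTable G n fun _ => 1 :=
  ⟨fun _ => one_mem _, fun _ _ _ _ => .inl rfl, fun _ _ => rfl⟩

theorem apply_lt (hG : ∀ g ∈ G, ∀ x, n ≤ x → g x = x) {g : Perm ℕ} (hg : g ∈ G) {x : ℕ}
    (hx : x < n) : g x < n := by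
  by_contra! hc
  have := g.injective (hG g hg _ hc)
  omega

open Classical in
/-- One step of sifting. -/
theorem sift_step (h : IsRepTable G n T) (hG : ∀ g ∈ G, ∀ x, n ≤ x → g x = x) {i : ℕ}
    (hi : i < n) {g : Perm ℕ} (hg : g ∈ G) (hfix : ∀ x < i, g x = x) (T' : ℕ → Perm ℕ)
    (hT' : T' = if T (i * n + g i) i = g i then T else Function.update T (i * n + g i) g) :
    IsRepTable G n T' ∧ TableExt n T T' ∧ (T' (i * n + g i))⁻¹ * g ∈ G ∧
    (∀ x < i + 1, ((T' (i * n + g i))⁻¹ * g) x = x) ∧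
    ∀ T'', TableExt n T' T'' → Sifts n T'' (i + 1) ((T' (i * n + g i))⁻¹ * g) →
      Sifts n T'' i g := by
  have hj : g i < n := apply_lt hG hg hi
  -- A missing representative is supplied by `g` itself. In either case the new table then has an
  -- entry that maps `i` to `g i`, and dividing by it leaves an element that also fixes `i`.
  have hval : IsRepTable G n T' ∧ TableExt n T T' ∧ T' (i * n + g i) i = g i := by
    by_cases hf : T (i * n + g i) i = g i
    · rw [if_pos hf] at hT'
      subst hT'
      exact ⟨h, .refl n T', hf⟩
    · rw [if_neg hf] at hT'
      subst hT'
      have hij : i ≠ g i := fun e => hf (by rw [← e, h.diag hi]; rfl)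
      have huniq : ∀ i' < n, ∀ j' < n, i' * n + j' = i * n + g i → i' = i ∧ j' = g i := by
        intro i' _ j' hj' e
        have h1 : i' = i := by
          have := congrArg (· / n) e
          simpa [Nat.mul_comm _ n, Nat.mul_add_div (by omega : n > 0), Nat.div_eq_of_lt hj',
            Nat.div_eq_of_lt hj] using this
        exact ⟨h1, by rw [h1] at e; omega⟩
      refine ⟨⟨fun p => ?_, fun i' hi' j' hj' => ?_, fun p hp => ?_⟩, fun i' hi' j' hj' hf' => ?_,
        by simp⟩
      · by_cases hp : p = i * n + g i
        · rw [hp, Function.update_self]; exact hg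
        · rw [Function.update_of_ne hp]; exact h.mem p
      · by_cases hp : i' * n + j' = i * n + g i
        · obtain ⟨rfl, rfl⟩ := huniq i' hi' j' hj' hp
          rw [Function.update_self]; exact .inr ⟨hij, hfix, rfl⟩
        · rw [Function.update_of_ne hp]; exact h.shape i' hi' j' hj'
      · rw [Function.update_of_ne, h.outside p hp]
        have : i * n + g i < n * n := by nlinarith
        omega
      · refine Function.update_of_ne (fun hp => ?_) _ _
        obtain ⟨rfl, rfl⟩ := huniq i' hi' j' hj' hp
        exact hf hf'
  obtain ⟨h1, h2, h3⟩ := hval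
  refine ⟨h1, h2, mul_mem (inv_mem (h1.mem _)) hg, fun x hx => ?_, fun T'' hT hs => ?_⟩
  · rw [Perm.mul_apply, Perm.inv_eq_iff_eq]
    rcases Nat.lt_succ_iff_lt_or_eq.mp hx with hx | rfl
    · rw [hfix x hx, h1.fixes hi hj hx]
    · rw [h3]
  · have h4 := hT i hi _ hj h3
    have := Sifts.mul hi hj (by rw [h4, h3]) hs
    rwa [h4, mul_inv_cancel_left] at this

end IsRepTable

/-! ### The number of representatives as a potential function -/

open Classical in
/-- The number of representatives in a table. -/
noncomputable def numReps (n : ℕ) (T : ℕ → Perm ℕ) : ℕ :=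
  ((Finset.range n ×ˢ Finset.range n).filter fun q => T (q.1 * n + q.2) q.1 = q.2).card

theorem numReps_le (n : ℕ) (T : ℕ → Perm ℕ) : numReps n T ≤ n * n := by
  refine (Finset.card_filter_le _ _).trans ?_
  rw [Finset.card_product, Finset.card_range]

theorem numReps_pos (h : IsRepTable G n T) (hn : 0 < n) : 0 < numReps n T :=
  Finset.card_pos.mpr ⟨(0, 0), by simpa [hn] using by have := h.diag hn; simp_all⟩

/-- Representatives are never overwritten and missing entries are the identity, so an extension
without new representatives is the same table. A table can therefore grow at most `n * n` times. -/
theorem eq_or_numReps_lt (h : IsRepTable G n T) (h' : IsRepTable G n T')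
    (hext : TableExt n T T') : T' = T ∨ numReps n T < numReps n T' := by
  classical
  rw [or_iff_not_imp_right]
  intro hlt
  have hsub : ((Finset.range n ×ˢ Finset.range n).filter fun q => T (q.1 * n + q.2) q.1 = q.2) ⊆
      (Finset.range n ×ˢ Finset.range n).filter fun q => T' (q.1 * n + q.2) q.1 = q.2 := by
    intro q hq
    simp only [Finset.mem_filter, Finset.mem_product, Finset.mem_range] at hq ⊢
    exact ⟨hq.1, by rw [hext _ hq.1.1 _ hq.1.2 hq.2, hq.2]⟩
  have heq := Finset.eq_of_subset_of_card_le hsub (not_lt.mp hlt)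
  funext p
  by_cases hp : n * n ≤ p
  · rw [h.outside p hp, h'.outside p hp]
  · have hn : 0 < n := by rcases Nat.eq_zero_or_pos n with rfl | h <;> omega
    have hi : p / n < n := Nat.div_lt_of_lt_mul (by omega)
    have hj : p % n < n := Nat.mod_lt p hn
    have hpe : p = p / n * n + p % n := by rw [Nat.mul_comm]; exact (Nat.div_add_mod p n).symm
    by_cases hf : T (p / n * n + p % n) (p / n) = p % n
    · rw [hpe]; exact hext _ hi _ hj hf
    · have hf' : ¬ T' (p / n * n + p % n) (p / n) = p % n := by
        intro hc
        have : (p / n, p % n) ∈ (Finset.range n ×ˢ Finset.range n).filter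
            fun q => T' (q.1 * n + q.2) q.1 = q.2 := by simp [hi, hj, hc]
        rw [← heq] at this
        exact hf (by simpa [hi, hj] using this)
      rw [hpe, h.eq_one_of_ne hi hj hf, h'.eq_one_of_ne hi hj hf']

end CoBase

/-! ### Sifting on the machine

The memory map: the variables `0` to `4` contain `n`, `m`, `k`, `n * n` and `n * n + m`.
Array `0` contains the generators, array `1` the multiples of `n`, array `2` marks points,
arrays `3` and `4` contain a permutation that moves the marked points to the end and its inverse,
array `5` the conjugate generators, array `6` the table of representatives, array `7` the
permutation that is sifted, and array `8` the inverse of a representative. -/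

namespace CoBase

open Equiv ForProg

/-- The expression is nonzero when `e` and `f` differ. -/
def neExpr (e f : RamExpr) : RamExpr := .add (.sub e f) (.sub f e)

theorem eval_neExpr (s : RamStore) (e f : RamExpr) :
    (neExpr e f).eval s = 0 ↔ e.eval s = f.eval s := by
  simp only [neExpr, RamExpr.eval]; omega

theorem run_seq (p q : ForProg) (s : RamStore) : (ForProg.seq p q).run s = q.run (p.run s) := rfl

theorem run_assign (x : ℕ) (e : RamExpr) (s : RamStore) :
    (ForProg.assign x e).run s = s.setVar x (e.eval s) := rfl

theorem run_write (a : ℕ) (i e : RamExpr) (s : RamStore) :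
    (ForProg.write a i e).run s = s.setArr a (i.eval s) (e.eval s) := rfl

theorem run_skip (s : RamStore) : ForProg.skip.run s = s := rfl

theorem run_ite (b : RamExpr) (p q : ForProg) (s : RamStore) :
    (ForProg.ite b p q).run s = if b.eval s = 0 then q.run s else p.run s := rfl

/-- One row of the table is used to sift. -/
def siftRow : ForProg :=
  .seq (.assign 12 (.cell 7 (.var 11)))
  (.seq (.assign 13 (.cell 1 (.add (.cell 1 (.var 11)) (.var 12))))
  (.seq (.ite (neExpr (.cell 6 (.add (.var 13) (.var 11))) (.var 12))
    (.count 14 0 (.write 6 (.add (.var 13) (.var 14)) (.cell 7 (.var 14)))) .skip)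
  (.seq (.count 14 0 (.write 8 (.cell 6 (.add (.var 13) (.var 14))) (.var 14)))
    (.count 14 0 (.write 7 (.var 14) (.cell 8 (.cell 7 (.var 14))))))))

/-- The permutation in array `7` is sifted. -/
def sift : ForProg := .count 11 0 siftRow

/-- The table `T` is stored in array `6`. -/
def HoldsTable (s : RamStore) (n : ℕ) (T : ℕ → Perm ℕ) : Prop :=
  ∀ p < n * n, ∀ x < n, s.arr 6 (p * n + x) = T p x

/-- The variables `0` and `3` and the array `1` are initialized. -/
structure Ready (s : RamStore) (n : ℕ) : Prop where
  var0 : s.var 0 = n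
  var3 : s.var 3 = n * n
  mul : ∀ i ≤ s.var 4, s.arr 1 i = i * n
  le : n * n ≤ s.var 4
  le' : s.var 1 ≤ s.var 4

theorem Ready.of_eq {s s' : RamStore} {n : ℕ} (h : Ready s n) (h0 : s'.var 0 = s.var 0)
    (hv : s'.var 1 = s.var 1) (h3 : s'.var 3 = s.var 3) (h4 : s'.var 4 = s.var 4) (h1 : s'.arr 1 = s.arr 1) :
    Ready s' n :=
  ⟨h0.trans h.var0, h3.trans h.var3, by rw [h4, h1]; exact h.mul, by rw [h4]; exact h.le,
    by rw [hv, h4]; exact h.le'⟩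

theorem Ready.frame {s : RamStore} {n : ℕ} (h : Ready s n) (p : ForProg) (h0 : 0 ∉ p.vars)
    (hv : 1 ∉ p.vars) (h3 : 3 ∉ p.vars) (h4 : 4 ∉ p.vars) (h1 : 1 ∉ p.arrs) : Ready (p.run s) n :=
  h.of_eq (run_var p s h0) (run_var p s hv) (run_var p s h3) (run_var p s h4) (run_arr p s h1)

theorem index_lt {n i j : ℕ} (hi : i < n) (hj : j < n) : i * n + j < n * n := by nlinarith

/-- The machine has no multiplication. The offset of a table entry is found by two lookups in the
array of multiples, which is long enough for the inner index as well. -/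
theorem Ready.mul_mul {s : RamStore} {n : ℕ} (h : Ready s n) {i j : ℕ} (hi : i < n) (hj : j < n) :
    s.arr 1 (s.arr 1 i + j) = (i * n + j) * n := by
  have h1 := index_lt hi hj
  have h2 := h.le
  have h3 : i ≤ i * n := Nat.le_mul_of_pos_right _ (by omega)
  rw [h.mul i (by omega), h.mul _ (by omega)]

theorem mul_add_inj {n p q x y : ℕ} (hx : x < n) (hy : y < n) (h : p * n + x = q * n + y) :
    p = q ∧ x = y := by
  have h1 : p = q := by
    have := congrArg (· / n) h
    simpa [Nat.mul_comm _ n, Nat.mul_add_div (by omega : n > 0), Nat.div_eq_of_lt hx,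
      Nat.div_eq_of_lt hy] using this
  subst h1
  exact ⟨rfl, by omega⟩

-- The machine counterpart of `IsRepTable.sift_step`: a missing representative is stored, inverted
-- by scattering into array `8`, and cancelled from the permutation in array `7`.
open Classical in
theorem run_siftRow {G : Subgroup (Perm ℕ)} {s : RamStore} {n i : ℕ} {T : ℕ → Perm ℕ} {h : Perm ℕ} (hs : Ready s n)
    (hi : i < n) (hx : s.var 11 = i) (hT : HoldsTable s n T)
    (hh : ∀ x < n, s.arr 7 x = h x) (hG : ∀ g ∈ G, ∀ x, n ≤ x → g x = x)
    (hTG : ∀ p, T p ∈ G) (hhG : h ∈ G) :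
    ∃ T' : ℕ → Perm ℕ,
      (T' = if T (i * n + h i) i = h i then T else Function.update T (i * n + h i) h) ∧
      HoldsTable (siftRow.run s) n T' ∧
      ∀ x < n, (siftRow.run s).arr 7 x = ((T' (i * n + h i))⁻¹ * h) x := by
  refine ⟨_, rfl, ?_⟩
  set p := i * n + h i with hp
  set T' := if T p i = h i then T else Function.update T p h with hT'
  have hj : h i < n := IsRepTable.apply_lt hG hhG hi
  have hpn : p < n * n := index_lt hi hj
  have hT'G : T' p ∈ G := by
    rw [hT']; split_ifs
    · exact hTG p
    · rw [Function.update_self]; exact hhG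
  have e12 : s.arr 7 i = h i := hh i hi
  have e13 : s.arr 1 (s.arr 1 i + h i) = p * n := hs.mul_mul hi hj
  rw [siftRow, run_seq, run_seq, run_seq, run_seq, run_assign, run_assign]
  set s2 := (s.setVar 12 (RamExpr.eval s (.cell 7 (.var 11)))).setVar 13
    (RamExpr.eval (s.setVar 12 (RamExpr.eval s (.cell 7 (.var 11))))
      (.cell 1 (.add (.cell 1 (.var 11)) (.var 12)))) with hs2
  have a2 : s2.arr = s.arr := rfl
  have v12 : s2.var 12 = h i := by simp [hs2, RamExpr.eval, hx, e12]
  have v13 : s2.var 13 = p * n := by simp [hs2, RamExpr.eval, hx, e12, e13]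
  have v11 : s2.var 11 = i := by simp [hs2, hx]
  have v0 : s2.var 0 = n := by simp [hs2, hs.var0]
  -- the table is extended
  set s3 := (ForProg.ite (neExpr (.cell 6 (.add (.var 13) (.var 11))) (.var 12))
    (.count 14 0 (.write 6 (.add (.var 13) (.var 14)) (.cell 7 (.var 14)))) .skip).run s2 with hs3
  have w13 : s3.var 13 = p * n := by rw [hs3, run_var _ _ (by decide), v13]
  have w0 : s3.var 0 = n := by rw [hs3, run_var _ _ (by decide), v0]
  have a7 : s3.arr 7 = s.arr 7 := by rw [hs3, run_arr _ _ (by decide), a2]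
  have hT3 : HoldsTable s3 n T' := by
    have hcond : (neExpr (.cell 6 (.add (.var 13) (.var 11))) (.var 12)).eval s2 = 0 ↔
        T p i = h i := by
      rw [eval_neExpr]; simp [RamExpr.eval, v11, v12, v13, a2, hT p hpn i hi]
    rw [hs3, run_ite, hT']
    by_cases hc : T p i = h i
    · rw [if_pos (hcond.mpr hc), if_pos hc, run_skip]
      intro q hq x hx; rw [a2]; exact hT q hq x hx
    · rw [if_neg (mt hcond.mp hc), if_neg hc]
      obtain ⟨h1, h2⟩ := run_count_write (x := 14) (b := 0) (a := 6)
        (ie := .add (.var 13) (.var 14)) (e := .cell 7 (.var 14)) (s := s2)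
        (f := fun x => p * n + x) (v := fun x => h x) (fun i _ j hj => by omega)
        (fun x st hx e1 e2 e3 e4 => by
          simp only [RamExpr.eval, e1, e2 13 (by decide), v13, e3 7 (by decide), a2, true_and]
          exact hh x (v0 ▸ hx))
      intro q hq x hx
      by_cases hqp : q = p
      · rw [hqp, Function.update_self]
        exact h1 x (v0.symm ▸ hx)
      · rw [Function.update_of_ne hqp, h2, a2]
        · exact hT q hq x hx
        · intro y hy e
          exact hqp (mul_add_inj hx (v0 ▸ hy) e).1
  -- the representative is inverted
  set s4 := (ForProg.count 14 0 (.write 8 (.cell 6 (.add (.var 13) (.var 14)))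
    (.var 14))).run s3 with hs4
  have u0 : s4.var 0 = n := by rw [hs4, run_var _ _ (by decide), w0]
  have b7 : s4.arr 7 = s.arr 7 := by rw [hs4, run_arr _ _ (by decide), a7]
  have b6 : s4.arr 6 = s3.arr 6 := by rw [hs4, run_arr _ _ (by decide)]
  have h8 : ∀ x < n, s4.arr 8 (T' p x) = x := by
    intro x hx
    refine (run_count_write (x := 14) (b := 0) (a := 8)
      (ie := .cell 6 (.add (.var 13) (.var 14))) (e := .var 14) (s := s3)
      (f := fun x => T' p x) (v := fun x => x)
      (fun i _ j hj e => absurd ((T' p).injective e) (by omega))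
      (fun x st hx e1 e2 e3 e4 => by
        simp only [RamExpr.eval, e1, e2 13 (by decide), w13, e3 6 (by decide), and_true]
        exact hT3 p hpn x (w0 ▸ hx))).1 x (w0.symm ▸ hx)
  -- and multiplied
  set s5 := (ForProg.count 14 0 (.write 7 (.var 14) (.cell 8 (.cell 7 (.var 14))))).run s4 with hs5
  refine ⟨fun q hq x hx => ?_, fun x hx => ?_⟩
  · rw [hs5, run_arr _ _ (by decide), b6]; exact hT3 q hq x hx
  · refine ((run_count_write (x := 14) (b := 0) (a := 7)
      (ie := .var 14) (e := .cell 8 (.cell 7 (.var 14))) (s := s4)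
      (f := fun x => x) (v := fun x => ((T' p)⁻¹ * h) x)
      (fun i _ j hj => by omega)
      (fun y st hy e1 e2 e3 e4 => ?_)).1 x (u0.symm ▸ hx))
    have hyn : y < n := u0 ▸ hy
    simp only [RamExpr.eval, e1, e3 8 (by decide), true_and]
    -- The multiplication is done in place: cell `y` is read before it is overwritten, so it still
    -- has its old value.
    rw [e4 y (fun i' hi' => by omega), b7, hh y hyn]
    obtain ⟨z, hz⟩ := (T' p).surjective (h y)
    have hzn : z < n := by
      rw [← Perm.inv_eq_iff_eq.mpr hz.symm]
      exact IsRepTable.apply_lt hG (inv_mem hT'G) (IsRepTable.apply_lt hG hhG hyn)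
    rw [Perm.mul_apply, ← hz, Perm.inv_eq_iff_eq.mpr rfl, h8 z hzn]


/-- The invariant: the remainder in array `7` fixes all points below the current row, and in every
extension of the table a sifted form of the remainder yields one of `h`. After the last row the
remainder is the identity. -/
theorem run_sift {G : Subgroup (Perm ℕ)} {s : RamStore} {n : ℕ} {T : ℕ → Perm ℕ} {h : Perm ℕ}
    (hs : Ready s n) (hG : ∀ g ∈ G, ∀ x, n ≤ x → g x = x) (hR : IsRepTable G n T)
    (hT : HoldsTable s n T) (hh : ∀ x < n, s.arr 7 x = h x) (hhG : h ∈ G) :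
    ∃ T', IsRepTable G n T' ∧ TableExt n T T' ∧ HoldsTable (sift.run s) n T' ∧
      Sifts n T' 0 h := by
  have := run_count (x := 11) (b := 0) (p := siftRow) (s := s) (fun i st => ∃ T' h',
    IsRepTable G n T' ∧ TableExt n T T' ∧ HoldsTable st n T' ∧ (∀ x < n, st.arr 7 x = h' x) ∧
    h' ∈ G ∧ (∀ x < i, h' x = x) ∧ ∀ T'', TableExt n T' T'' → Sifts n T'' i h' → Sifts n T'' 0 h)
    ?_ ?_
  · obtain ⟨T', h', h1, h2, h3, -, h5, h6, h7⟩ := this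
    rw [hs.var0] at h6 h7
    refine ⟨T', h1, h2, h3, h7 T' (.refl n T') ?_⟩
    have : h' = 1 := by
      ext x
      rcases Nat.lt_or_ge x n with hx | hx
      · exact h6 x hx
      · exact hG h' h5 x hx
    rw [this]; exact .one
  · exact ⟨T, h, hR, .refl n T, hT, hh, hhG, by simp, fun _ _ h => h⟩
  · rintro i st hi hx e1 e2 ⟨T', h', h1, h2, h3, h4, h5, h6, h7⟩
    rw [hs.var0] at hi
    have hst : Ready st n := hs.of_eq (e1 0 (by decide)) (e1 1 (by decide)) (e1 3 (by decide))
      (e1 4 (by decide)) (e2 1 (by decide))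
    obtain ⟨T'', e, a1, a2⟩ := run_siftRow hst hi hx h3 h4 hG h1.mem h5
    obtain ⟨b1, b2, b3, b4, b5⟩ := h1.sift_step hG hi h5 h6 T'' (by rw [e])
    exact ⟨T'', _, b1, h2.trans b2, a1, a2, b3, b4,
      fun T₃ ht hs₃ => h7 T₃ (b2.trans ht) (b5 T₃ ht hs₃)⟩

/-! ### Closing the table under products -/

/-- The generators are sifted. -/
def siftGens : ForProg :=
  .count 15 1 (.seq (.count 14 0 (.write 7 (.var 14) (.cell 5 (.add (.cell 1 (.var 15)) (.var 14)))))
    sift)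

theorem run_siftGens {G : Subgroup (Perm ℕ)} {s : RamStore} {n : ℕ} {T : ℕ → Perm ℕ}
    {c : ℕ → Perm ℕ} (hs : Ready s n) (hG : ∀ g ∈ G, ∀ x, n ≤ x → g x = x)
    (hR : IsRepTable G n T) (hT : HoldsTable s n T)
    (hc : ∀ g < s.var 1, ∀ x < n, s.arr 5 (g * n + x) = c g x) (hcG : ∀ g < s.var 1, c g ∈ G) :
    ∃ T', IsRepTable G n T' ∧ HoldsTable (siftGens.run s) n T' ∧
      ∀ g < s.var 1, Sifts n T' 0 (c g) := by
  refine run_count (x := 15) (b := 1) (s := s) (fun i st => ∃ T', IsRepTable G n T' ∧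
    HoldsTable st n T' ∧ ∀ g < i, Sifts n T' 0 (c g)) ⟨T, hR, hT, by simp⟩ ?_
  rintro i st hi hx e1 e2 ⟨T', h1, h2, h3⟩
  have hst : Ready st n := hs.of_eq (e1 0 (by decide)) (e1 1 (by decide)) (e1 3 (by decide))
      (e1 4 (by decide)) (e2 1 (by decide))
  rw [run_seq]
  set s1 := (ForProg.count 14 0 (.write 7 (.var 14)
    (.cell 5 (.add (.cell 1 (.var 15)) (.var 14))))).run st with hs1
  have hs1R : Ready s1 n := hst.frame _ (by decide) (by decide) (by decide) (by decide) (by decide)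
  have hT1 : HoldsTable s1 n T' := by
    intro p hp x hx; rw [hs1, run_arr _ _ (by decide)]; exact h2 p hp x hx
  have h7 : ∀ x < n, s1.arr 7 x = c i x := fun x hx' =>
    (run_count_write (x := 14) (b := 0) (a := 7) (ie := .var 14)
      (e := .cell 5 (.add (.cell 1 (.var 15)) (.var 14))) (s := st)
      (f := fun x => x) (v := fun x => c i x) (fun i _ j hj => by omega)
      (fun y st' hy f1 f2 f3 f4 => by
        simp only [RamExpr.eval, f1, f2 15 (by decide), hx, f3 5 (by decide), f3 1 (by decide),
          true_and]
        rw [hst.mul i (by have := hs.le'; rw [e1 4 (by decide)]; omega), e2 5 (by decide)]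
        exact hc i hi y (hst.var0 ▸ hy))).1 x (hst.var0.symm ▸ hx')
  obtain ⟨T'', a1, a2, a3, a4⟩ := run_sift hs1R hG h1 hT1 h7 (hcG i hi)
  refine ⟨T'', a1, a3, fun g hg => ?_⟩
  rcases Nat.lt_succ_iff_lt_or_eq.mp hg with hg | rfl
  · exact (h3 g hg).mono a2
  · exact a4

/-- The products of a representative with all representatives are sifted. -/
def siftProductsWith : ForProg :=
  .count 18 3 (.seq (.count 14 0 (.write 7 (.var 14)
    (.cell 6 (.add (.cell 1 (.var 17)) (.cell 6 (.add (.cell 1 (.var 18)) (.var 14))))))) sift)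

/-- All products of two representatives are sifted. -/
def siftProducts : ForProg := .count 17 3 siftProductsWith

/-- A chain of extensions that returns to its start is constant. -/
theorem eq_of_ext_eq {G : Subgroup (Perm ℕ)} {n : ℕ} {T T' T'' : ℕ → Perm ℕ}
    (h : IsRepTable G n T) (h' : IsRepTable G n T') (h'' : IsRepTable G n T'')
    (e : TableExt n T T') (e' : TableExt n T' T'') (he : T'' = T) : T' = T := by
  rcases eq_or_numReps_lt h h' e with h1 | h1
  · exact h1
  rcases eq_or_numReps_lt h' h'' e' with h2 | h2
  · exact h2.symm.trans he
  · rw [he] at h2; omega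

/-- The table may grow during the pass, so the products are formed from changing entries. Only a
pass that leaves the table as it was certifies the products of `T`; hence the condition in the last
clause. -/
theorem run_siftProductsWith {G : Subgroup (Perm ℕ)} {s : RamStore} {n p : ℕ} {T : ℕ → Perm ℕ}
    (hs : Ready s n) (hG : ∀ g ∈ G, ∀ x, n ≤ x → g x = x) (hR : IsRepTable G n T)
    (hT : HoldsTable s n T) (hp : p < n * n) (hvar : s.var 17 = p) :
    ∃ T', IsRepTable G n T' ∧ TableExt n T T' ∧ HoldsTable (siftProductsWith.run s) n T' ∧
      (T' = T → ∀ q < n * n, Sifts n T 0 (T p * T q)) := by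
  rw [← hs.var3]
  refine run_count (x := 18) (b := 3) (s := s) (fun i st => ∃ T', IsRepTable G n T' ∧
    TableExt n T T' ∧ HoldsTable st n T' ∧ (T' = T → ∀ q < i, Sifts n T 0 (T p * T q)))
    ⟨T, hR, .refl n T, hT, by simp⟩ ?_
  rintro i st hi hx e1 e2 ⟨T', h1, h2, h3, h4⟩
  rw [hs.var3] at hi
  have hst : Ready st n := hs.of_eq (e1 0 (by decide)) (e1 1 (by decide)) (e1 3 (by decide))
      (e1 4 (by decide)) (e2 1 (by decide))
  have e17 : st.var 17 = p := by rw [e1 17 (by decide), hvar]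
  rw [run_seq]
  set s1 := (ForProg.count 14 0 (.write 7 (.var 14)
    (.cell 6 (.add (.cell 1 (.var 17)) (.cell 6 (.add (.cell 1 (.var 18)) (.var 14))))))).run st
    with hs1
  have hs1R : Ready s1 n := hst.frame _ (by decide) (by decide) (by decide) (by decide) (by decide)
  have hT1 : HoldsTable s1 n T' := by
    intro p hp x hx; rw [hs1, run_arr _ _ (by decide)]; exact h3 p hp x hx
  have h7 : ∀ x < n, s1.arr 7 x = (T' p * T' i) x := fun x hx' =>
    (run_count_write (x := 14) (b := 0) (a := 7) (ie := .var 14)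
      (e := .cell 6 (.add (.cell 1 (.var 17)) (.cell 6 (.add (.cell 1 (.var 18)) (.var 14)))))
      (s := st) (f := fun x => x) (v := fun x => (T' p * T' i) x) (fun i _ j hj => by omega)
      (fun y st' hy f1 f2 f3 f4 => by
        have hyn : y < n := hst.var0 ▸ hy
        simp only [RamExpr.eval, f1, f2 17 (by decide), f2 18 (by decide), hx, e17,
          f3 6 (by decide), f3 1 (by decide), true_and]
        rw [hst.mul i (by have := hst.le; omega), hst.mul p (by have := hst.le; omega),
          h3 i hi y hyn, h3 p hp _ (IsRepTable.apply_lt hG (h1.mem i) hyn)]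
        rfl)).1 x (hst.var0.symm ▸ hx')
  obtain ⟨T'', a1, a2, a3, a4⟩ := run_sift hs1R hG h1 hT1 h7 (mul_mem (h1.mem p) (h1.mem i))
  refine ⟨T'', a1, h2.trans a2, a3, fun he q hq => ?_⟩
  have he' := eq_of_ext_eq hR h1 a1 h2 a2 he
  rcases Nat.lt_succ_iff_lt_or_eq.mp hq with hq | rfl
  · exact h4 he' q hq
  · rwa [he, he'] at a4

theorem run_siftProducts {G : Subgroup (Perm ℕ)} {s : RamStore} {n : ℕ} {T : ℕ → Perm ℕ}
    (hs : Ready s n) (hG : ∀ g ∈ G, ∀ x, n ≤ x → g x = x) (hR : IsRepTable G n T)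
    (hT : HoldsTable s n T) :
    ∃ T', IsRepTable G n T' ∧ TableExt n T T' ∧ HoldsTable (siftProducts.run s) n T' ∧
      (T' = T → ∀ p < n * n, ∀ q < n * n, Sifts n T 0 (T p * T q)) := by
  have := run_count (x := 17) (b := 3) (p := siftProductsWith) (s := s)
    (fun i st => ∃ T', IsRepTable G n T' ∧
    TableExt n T T' ∧ HoldsTable st n T' ∧
    (T' = T → ∀ p < i, ∀ q < n * n, Sifts n T 0 (T p * T q)))
    ⟨T, hR, .refl n T, hT, by simp⟩ ?_
  · rwa [hs.var3] at this
  rintro i st hi hx e1 e2 ⟨T', h1, h2, h3, h4⟩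
  rw [hs.var3] at hi
  have hst : Ready st n := hs.of_eq (e1 0 (by decide)) (e1 1 (by decide)) (e1 3 (by decide))
      (e1 4 (by decide)) (e2 1 (by decide))
  obtain ⟨T'', a1, a2, a3, a4⟩ := run_siftProductsWith hst hG h1 h3 hi hx
  refine ⟨T'', a1, h2.trans a2, a3, fun he p hp q hq => ?_⟩
  have he' := eq_of_ext_eq hR h1 a1 h2 a2 he
  rcases Nat.lt_succ_iff_lt_or_eq.mp hp with hp | rfl
  · exact h4 he' p hp q hq
  · have := a4 (he.trans he'.symm) q hq
    rwa [he'] at this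

/-- The computation of the table of representatives. -/
def chain : ForProg :=
  .seq (.count 17 3 (.count 14 0 (.write 6 (.add (.cell 1 (.var 17)) (.var 14)) (.var 14))))
    (.seq siftGens (.count 16 3 siftProducts))

theorem run_initTable {s : RamStore} {n : ℕ} (hs : Ready s n) :
    HoldsTable ((ForProg.count 17 3 (.count 14 0 (.write 6 (.add (.cell 1 (.var 17)) (.var 14))
      (.var 14)))).run s) n fun _ => 1 := by
  have := run_count (x := 17) (b := 3) (s := s) (p := .count 14 0 (.write 6
    (.add (.cell 1 (.var 17)) (.var 14)) (.var 14)))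
    (fun i st => ∀ p < i, ∀ x < n, st.arr 6 (p * n + x) = x) (by simp) ?_
  · rw [hs.var3] at this; exact this
  intro i st hi hx e1 e2 h
  rw [hs.var3] at hi
  have hst : Ready st n := hs.of_eq (e1 0 (by decide)) (e1 1 (by decide)) (e1 3 (by decide))
      (e1 4 (by decide)) (e2 1 (by decide))
  obtain ⟨h1, h2⟩ := run_count_write (x := 14) (b := 0) (a := 6)
    (ie := .add (.cell 1 (.var 17)) (.var 14)) (e := .var 14) (s := st)
    (f := fun x => i * n + x) (v := fun x => x) (fun i _ j hj => by omega)
    (fun x st' _ f1 f2 f3 f4 => by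
      simp only [RamExpr.eval, f1, f2 17 (by decide), hx, f3 1 (by decide), and_true]
      rw [hst.mul i (by have := hst.le; omega)])
  intro p hp x hxn
  rcases Nat.lt_succ_iff_lt_or_eq.mp hp with hp | rfl
  · rw [RamStore.setVar_arr, h2, h p hp x hxn]
    intro y hy e
    exact hp.ne (mul_add_inj hxn (hst.var0 ▸ hy) e).1
  · exact h1 x (hst.var0.symm ▸ hxn)

/-- Each round of products adds a representative or certifies that the table is closed. For positive
`n` there is a representative at the start and there are never more than `n * n`, so one of the `n *
n` rounds certifies it, and later extensions do no harm. -/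
theorem run_chain {G : Subgroup (Perm ℕ)} {s : RamStore} {n : ℕ} {c : ℕ → Perm ℕ}
    (hs : Ready s n) (hG : ∀ g ∈ G, ∀ x, n ≤ x → g x = x)
    (hc : ∀ g < s.var 1, ∀ x < n, s.arr 5 (g * n + x) = c g x)
    (hGc : G = Subgroup.closure (c '' {g | g < s.var 1})) :
    ∃ T, IsRepTable G n T ∧ HoldsTable (chain.run s) n T ∧ ∀ g ∈ G, Sifts n T 0 g := by
  have hcG : ∀ g < s.var 1, c g ∈ G := fun g hg => by
    rw [hGc]; exact Subgroup.subset_closure ⟨g, hg, rfl⟩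
  rw [chain, run_seq, run_seq]
  set s1 := (ForProg.count 17 3 (.count 14 0 (.write 6 (.add (.cell 1 (.var 17)) (.var 14))
    (.var 14)))).run s with hs1
  have hs1R : Ready s1 n := hs.frame _ (by decide) (by decide) (by decide) (by decide) (by decide)
  have hv1 : s1.var 1 = s.var 1 := run_var _ _ (by decide)
  obtain ⟨T₀, a1, a2, a3⟩ := run_siftGens (c := c) hs1R hG (IsRepTable.one G n)
    (run_initTable hs) (by
      intro g hg x hx
      rw [hs1, run_arr _ _ (by decide)]; exact hc g (hv1 ▸ hg) x hx) (by rwa [hv1])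
  rw [hv1] at a3
  set s2 := siftGens.run s1 with hs2
  have hs2R : Ready s2 n := hs1R.frame _ (by decide) (by decide) (by decide) (by decide)
    (by decide)
  have := run_count (x := 16) (b := 3) (p := siftProducts) (s := s2)
    (fun i st => ∃ T, IsRepTable G n T ∧ HoldsTable st n T ∧ (∀ g < s.var 1, Sifts n T 0 (c g)) ∧
      ((∀ g ∈ G, Sifts n T 0 g) ∨ i + 1 ≤ numReps n T ∨ n = 0)) ?_ ?_
  · rw [hs2R.var3] at this
    obtain ⟨T, h1, h2, h3, h4⟩ := this
    refine ⟨T, h1, h2, ?_⟩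
    rcases h4 with h4 | h4 | rfl
    · exact h4
    · have := numReps_le n T; omega
    · intro g hg
      obtain rfl : g = 1 := by ext x; exact hG g hg x (Nat.zero_le x)
      exact .one
  · refine ⟨T₀, a1, a2, a3, ?_⟩
    rcases Nat.eq_zero_or_pos n with hn | hn
    · exact .inr (.inr hn)
    · exact .inr (.inl (numReps_pos a1 hn))
  · rintro i st hi hx e1 e2 ⟨T, h1, h2, h3, h4⟩
    have hst : Ready st n := hs2R.of_eq (e1 0 (by decide)) (e1 1 (by decide)) (e1 3 (by decide))
      (e1 4 (by decide)) (e2 1 (by decide))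
    obtain ⟨T', b1, b2, b3, b4⟩ := run_siftProducts hst hG h1 h2
    refine ⟨T', b1, b3, fun g hg => (h3 g hg).mono b2, ?_⟩
    rcases h4 with h4 | h4 | h4
    · exact .inl fun g hg => (h4 g hg).mono b2
    · rcases eq_or_numReps_lt h1 b1 b2 with he | hlt
      · refine .inl fun g hg => ?_
        subst he
        refine b1.complete hG (fun i hi j hj i' hi' j' hj' =>
          b4 rfl _ (index_lt hi hj) _ (index_lt hi' hj')) hGc ?_ hg
        rintro _ ⟨g, hg, rfl⟩
        exact h3 g hg
      · exact .inr (.inl (by omega))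
    · exact .inr (.inr h4)

end CoBase

/-! ### Moving the marked points to the end -/

namespace CoBase

open Equiv ForProg

/-- The group in the numbering of the points that is given by `b`. -/
def relabel (b : Perm ℕ) (G : Subgroup (Perm ℕ)) : Subgroup (Perm ℕ) :=
  G.map (MulAut.conj b⁻¹).toMonoidHom

theorem mem_relabel {b : Perm ℕ} {G : Subgroup (Perm ℕ)} {g : Perm ℕ} :
    g ∈ relabel b G ↔ b * g * b⁻¹ ∈ G := by
  simp only [relabel, Subgroup.mem_map, MulEquiv.toMonoidHom_eq_coe, MonoidHom.coe_coe,
    MulAut.conj_apply, inv_inv]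
  constructor
  · rintro ⟨h, hh, rfl⟩
    have : b * (b⁻¹ * h * b) * b⁻¹ = h := by group
    rwa [this]
  · intro h
    exact ⟨_, h, by group⟩

theorem relabel_fixes {b : Perm ℕ} {G : Subgroup (Perm ℕ)} {n : ℕ}
    (hG : ∀ g ∈ G, ∀ x, n ≤ x → g x = x) (hb : ∀ x, n ≤ x → b x = x) :
    ∀ g ∈ relabel b G, ∀ x, n ≤ x → g x = x := by
  intro g hg x hx
  have h1 := hG _ (mem_relabel.mp hg) x hx
  have h2 : b⁻¹ x = x := by rw [Perm.inv_eq_iff_eq, hb x hx]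
  rw [Perm.mul_apply, Perm.mul_apply, h2] at h1
  rw [← Perm.inv_eq_iff_eq.mpr h1.symm, h2]

/-- The permutation in array `3` moves the marked points to the end; variable `5` counts the
others. -/
def partition : ForProg :=
  .seq (.count 14 0 (.write 3 (.var 14) (.var 14)))
  (.seq (.assign 5 (.const 0))
  (.count 14 0 (.ite (.cell 2 (.cell 3 (.var 14))) .skip
    (.seq (.assign 12 (.cell 3 (.var 5)))
    (.seq (.write 3 (.var 5) (.cell 3 (.var 14)))
    (.seq (.write 3 (.var 14) (.var 12))
      (.assign 5 (.add (.var 5) (.const 1)))))))))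

/-- The variable `5` and the array `3` describe a numbering of the points in which the marked
points come last. -/
structure IsPartition (s : RamStore) (n : ℕ) (b : Perm ℕ) : Prop where
  fixes : ∀ x, n ≤ x → b x = x
  arr : ∀ x < n, s.arr 3 x = b x
  le : s.var 5 ≤ n
  unmarked : ∀ x < s.var 5, s.arr 2 (b x) = 0
  marked : ∀ x < n, s.var 5 ≤ x → s.arr 2 (b x) ≠ 0

/-- The partition step of quicksort: variable `5` is the boundary behind the unmarked points found
so far, and each new unmarked point is swapped to it, which multiplies `b` by a transposition. -/
theorem run_partition {s : RamStore} {n : ℕ} (hn : s.var 0 = n) :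
    ∃ b : Perm ℕ, IsPartition (partition.run s) n b := by
  rw [partition, run_seq, run_seq, run_assign]
  set s1 := (ForProg.count 14 0 (.write 3 (.var 14) (.var 14))).run s with hs1
  have h3 : ∀ x < n, s1.arr 3 x = x := fun x hx =>
    (run_count_write (x := 14) (b := 0) (a := 3) (ie := .var 14) (e := .var 14) (s := s)
      (f := fun x => x) (v := fun x => x) (fun i _ j hj => by omega)
      (fun x st' _ f1 f2 f3 f4 => ⟨f1, f1⟩)).1 x (hn.symm ▸ hx)
  have hv0 : s1.var 0 = n := by rw [hs1, run_var _ _ (by decide), hn]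
  have ha2 : s1.arr 2 = s.arr 2 := run_arr _ _ (by decide)
  set s2 := s1.setVar 5 (RamExpr.eval s1 (.const 0)) with hs2
  have hw0 : s2.var 0 = n := by simp [hs2, hv0]
  have := run_count (x := 14) (b := 0) (s := s2) (p := .ite (.cell 2 (.cell 3 (.var 14))) .skip
    (.seq (.assign 12 (.cell 3 (.var 5)))
    (.seq (.write 3 (.var 5) (.cell 3 (.var 14)))
    (.seq (.write 3 (.var 14) (.var 12))
      (.assign 5 (.add (.var 5) (.const 1)))))))
    (fun i st => ∃ b : Perm ℕ, (∀ x, i ≤ x → st.var 5 ≤ x → b x = x) ∧ (∀ x, n ≤ x → b x = x) ∧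
      (∀ x < n, st.arr 3 x = b x) ∧ st.var 5 ≤ i ∧
      (∀ x < st.var 5, s.arr 2 (b x) = 0) ∧ ∀ x < i, st.var 5 ≤ x → s.arr 2 (b x) ≠ 0) ?_ ?_
  · obtain ⟨b, h1, h2, h3, h4, h5, h6⟩ := this
    rw [hw0] at h1 h4 h6
    have hA : ∀ q : ForProg, 2 ∉ q.arrs → (q.run s2).arr 2 = s.arr 2 := fun q hq => by
      rw [run_arr q s2 hq]; exact ha2
    refine ⟨b, h2, h3, h4, ?_, ?_⟩
    · rw [hA _ (by decide)]; exact h5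
    · rw [hA _ (by decide)]; exact h6
  · exact ⟨1, fun _ _ _ => rfl, fun _ _ => rfl, h3, by simp [hs2, RamExpr.eval],
      by simp [hs2, RamExpr.eval], by simp⟩
  · rintro i st hi hx e1 e2 ⟨b, h1, h2, h3, h4, h5, h6⟩
    rw [hw0] at hi
    have ha : st.arr 2 = s.arr 2 := (e2 2 (by decide)).trans ha2
    rw [run_ite]
    have hev : RamExpr.eval st (.cell 2 (.cell 3 (.var 14))) = s.arr 2 (b i) := by
      simp [RamExpr.eval, hx, ha, h3 i hi]
    rw [hev]
    have hbi : b i = i := h1 i le_rfl h4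
    split_ifs with hc
    · set c := st.var 5 with hcdef
      refine ⟨b * swap c i, ?_⟩
      have hbm : ∀ x, (b * swap c i) x = if x = c then b i else if x = i then b c else b x := by
        intro x
        rw [Perm.mul_apply, swap_apply_def]
        split_ifs <;> rfl
      simp only [run_seq, run_assign, run_write, RamExpr.eval, RamStore.setVar_var,
        RamStore.setArr_var, RamStore.setVar_arr, RamStore.setArr_arr, hx, hbm]
      norm_num
      rw [← hcdef]
      refine ⟨?_, ?_, ?_, ?_, ?_, ?_⟩
      · intro x hx1 hx2
        rw [if_neg (by omega), if_neg (by omega)]; exact h1 x (by omega) (by omega)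
      · intro x hx1
        rw [if_neg (by omega), if_neg (by omega)]; exact h2 x hx1
      · intro x hx1
        by_cases e : x = i
        · subst e
          simp only [if_true]
          split_ifs with e'
          · rw [← e', h3 x hi]
          · exact h3 c (by omega)
        · rw [if_neg e, if_neg e]
          split_ifs with e'
          · exact h3 i hi
          · exact h3 x hx1
      · exact h4
      · intro x hx1
        split_ifs with e1 e2
        · exact hc
        · omega
        · exact h5 x (by omega)
      · intro x hx1 hx2
        rw [if_neg (by omega)]
        split_ifs with e2
        · exact h6 c (by omega) le_rfl
        · exact h6 x (by omega) (by omega)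
    · refine ⟨b, ?_⟩
      rw [run_skip]
      simp only [RamStore.setVar_var, RamStore.setVar_arr]
      norm_num
      refine ⟨fun x hx1 hx2 => h1 x (by omega) hx2, h2, h3, by omega, h5, fun x hx1 hx2 => ?_⟩
      rcases Nat.lt_or_eq_of_le hx1 with h | rfl
      · exact h6 x h hx2
      · exact hc

/-- The inverse of the numbering, and the generators in the new numbering. -/
def conjugate : ForProg :=
  .seq (.count 14 0 (.write 4 (.cell 3 (.var 14)) (.var 14)))
    (.count 15 1 (.count 14 0 (.write 5 (.add (.cell 1 (.var 15)) (.var 14))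
      (.cell 4 (.cell 0 (.add (.cell 1 (.var 15)) (.cell 3 (.var 14))))))))

/-- The table of representatives for the numbering in which the marked points come last. -/
def markedChain : ForProg := .seq partition (.seq conjugate chain)

/-- The generators `a 0, a 1, …` are stored in array `0`. -/
def HoldsGens (s : RamStore) (n : ℕ) (a : ℕ → Perm ℕ) : Prop :=
  ∀ g < s.var 1, ∀ x < n, s.arr 0 (g * n + x) = a g x

theorem run_conjugate {s : RamStore} {n : ℕ} {a : ℕ → Perm ℕ} {b : Perm ℕ} (hs : Ready s n)
    (ha : HoldsGens s n a) (han : ∀ g < s.var 1, ∀ x < n, a g x < n)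
    (hb : ∀ x, n ≤ x → b x = x) (h3 : ∀ x < n, s.arr 3 x = b x) :
    ∀ g < s.var 1, ∀ x < n, (conjugate.run s).arr 5 (g * n + x) = (b⁻¹ * a g * b) x := by
  have hbn : ∀ x < n, b x < n := by
    intro x hx
    by_contra! hc
    have := b.injective (hb _ hc); omega
  rw [conjugate, run_seq]
  set s1 := (ForProg.count 14 0 (.write 4 (.cell 3 (.var 14)) (.var 14))).run s with hs1
  have h4 : ∀ x < n, s1.arr 4 (b x) = x := fun x hx =>
    (run_count_write (x := 14) (b := 0) (a := 4) (ie := .cell 3 (.var 14)) (e := .var 14) (s := s)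
      (f := fun x => b x) (v := fun x => x)
      (fun i _ j hj e => absurd (b.injective e) (by omega))
      (fun x st' hx' f1 f2 f3 f4 => by
        simp only [RamExpr.eval, f1, f3 3 (by decide), and_true]
        exact h3 x (hs.var0 ▸ hx'))).1 x (hs.var0.symm ▸ hx)
  have hs1R : Ready s1 n := hs.frame _ (by decide) (by decide) (by decide) (by decide) (by decide)
  have hv1 : s1.var 1 = s.var 1 := run_var _ _ (by decide)
  rw [← hv1]
  refine run_count (x := 15) (b := 1) (s := s1) (fun i st => ∀ g < i, ∀ x < n,
    st.arr 5 (g * n + x) = (b⁻¹ * a g * b) x) (by simp) ?_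
  intro i st hi hx e1 e2 h
  have hst : Ready st n := hs1R.of_eq (e1 0 (by decide)) (e1 1 (by decide)) (e1 3 (by decide))
      (e1 4 (by decide)) (e2 1 (by decide))
  have hle := hst.le'
  rw [e1 1 (by decide)] at hle
  obtain ⟨h1, h2⟩ := run_count_write (x := 14) (b := 0) (a := 5)
    (ie := .add (.cell 1 (.var 15)) (.var 14))
    (e := .cell 4 (.cell 0 (.add (.cell 1 (.var 15)) (.cell 3 (.var 14))))) (s := st)
    (f := fun x => i * n + x) (v := fun x => (b⁻¹ * a i * b) x) (fun i _ j hj => by omega)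
    (fun x st' hx' f1 f2 f3 f4 => by
      have hxn : x < n := hst.var0 ▸ hx'
      simp only [RamExpr.eval, f1, f2 15 (by decide), hx, f3 1 (by decide), f3 4 (by decide),
        f3 0 (by decide), f3 3 (by decide), hst.mul i (by omega), true_and, e2 4 (by decide),
        e2 0 (by decide), e2 3 (by decide)]
      rw [show s1.arr 3 = s.arr 3 from run_arr _ _ (by decide),
        show s1.arr 0 = s.arr 0 from run_arr _ _ (by decide), h3 x hxn,
        ha i (hv1 ▸ hi) _ (hbn x hxn)]
      obtain ⟨z, hz⟩ := b.surjective (a i (b x))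
      have hzn : z < n := by
        by_contra! hc
        have h5 := han i (hv1 ▸ hi) _ (hbn x hxn)
        rw [← hz, hb z hc] at h5; omega
      rw [Perm.mul_apply, Perm.mul_apply, ← hz, h4 z hzn]; simp)
  intro g hg x hxn
  rcases Nat.lt_succ_iff_lt_or_eq.mp hg with hg | rfl
  · rw [RamStore.setVar_arr, h2, h g hg x hxn]
    intro y hy e
    exact hg.ne (mul_add_inj hxn (hst.var0 ▸ hy) e).1
  · exact h1 x (hst.var0.symm ▸ hxn)

/-- The result of `markedChain`. -/
structure IsChain (s : RamStore) (n : ℕ) (G : Subgroup (Perm ℕ)) (b : Perm ℕ)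
    (T : ℕ → Perm ℕ) : Prop extends IsPartition s n b where
  fixes_top : ∀ g ∈ relabel b G, ∀ x, n ≤ x → g x = x
  table : IsRepTable (relabel b G) n T
  holds : HoldsTable s n T
  complete : ∀ g ∈ relabel b G, Sifts n T 0 g

theorem run_markedChain {G : Subgroup (Perm ℕ)} {s : RamStore} {n : ℕ} {a : ℕ → Perm ℕ}
    (hs : Ready s n) (hG : ∀ g ∈ G, ∀ x, n ≤ x → g x = x) (ha : HoldsGens s n a)
    (hGa : G = Subgroup.closure (a '' {g | g < s.var 1})) :
    ∃ b T, IsChain (markedChain.run s) n G b T := by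
  have haG : ∀ g < s.var 1, a g ∈ G := fun g hg => by
    rw [hGa]; exact Subgroup.subset_closure ⟨g, hg, rfl⟩
  rw [markedChain, run_seq, run_seq]
  obtain ⟨b, hb⟩ := run_partition hs.var0
  set s1 := partition.run s with hs1
  have hs1R : Ready s1 n := hs.frame _ (by decide) (by decide) (by decide) (by decide) (by decide)
  have hv1 : s1.var 1 = s.var 1 := run_var _ _ (by decide)
  have h5 := run_conjugate (a := a) hs1R
    (fun g hg x hx => by
      rw [show s1.arr 0 = s.arr 0 from run_arr _ _ (by decide)]; exact ha g (hv1 ▸ hg) x hx)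
    (fun g hg x hx => IsRepTable.apply_lt hG (haG g (hv1 ▸ hg)) hx) hb.fixes hb.arr
  set s2 := conjugate.run s1 with hs2
  have hs2R : Ready s2 n := hs1R.frame _ (by decide) (by decide) (by decide) (by decide)
    (by decide)
  have hv2 : s2.var 1 = s.var 1 := (run_var _ _ (by decide)).trans hv1
  obtain ⟨T, h1, h2, h3⟩ := run_chain (G := relabel b G) hs2R (relabel_fixes hG hb.fixes)
    (c := fun g => b⁻¹ * a g * b) (fun g hg x hx => h5 g (by rwa [hv1, ← hv2]) x hx) (by
      rw [relabel, hGa, MonoidHom.map_closure, ← Set.image_comp, hv2]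
      congr 1)
  have e3 : (chain.run s2).arr 3 = s1.arr 3 :=
    (run_arr _ _ (by decide)).trans (run_arr _ _ (by decide))
  have e2 : (chain.run s2).arr 2 = s1.arr 2 :=
    (run_arr _ _ (by decide)).trans (run_arr _ _ (by decide))
  have e5 : (chain.run s2).var 5 = s1.var 5 :=
    (run_var _ _ (by decide)).trans (run_var _ _ (by decide))
  exact ⟨b, T, ⟨hb.fixes, by rw [e3]; exact hb.arr, by rw [e5]; exact hb.le,
    by rw [e5, e2]; exact hb.unmarked, by rw [e5, e2]; exact hb.marked⟩,
    relabel_fixes hG hb.fixes, h1, h2, h3⟩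

variable {G : Subgroup (Perm ℕ)} {s : RamStore} {n : ℕ} {b : Perm ℕ} {T : ℕ → Perm ℕ}

namespace IsChain

theorem apply_lt (h : IsChain s n G b T) {x : ℕ} (hx : x < n) : b x < n := by
  by_contra! hc
  have := b.injective (h.fixes _ hc); omega

theorem exists_eq (h : IsChain s n G b T) {y : ℕ} (hy : y < n) : ∃ x < n, b x = y := by
  obtain ⟨x, rfl⟩ := b.surjective y
  refine ⟨x, ?_, rfl⟩
  by_contra! hc
  rw [h.fixes x hc] at hy; omega

/-- The set of marked points. -/
theorem image_Ico (h : IsChain s n G b T) :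
    (Finset.Ico (s.var 5) n).image b = (Finset.range n).filter fun x => s.arr 2 x ≠ 0 := by
  ext y
  simp only [Finset.mem_image, Finset.mem_Ico, Finset.mem_filter, Finset.mem_range]
  constructor
  · rintro ⟨x, ⟨h1, h2⟩, rfl⟩
    exact ⟨h.apply_lt h2, h.marked x h2 h1⟩
  · rintro ⟨h1, h2⟩
    obtain ⟨x, hx, rfl⟩ := h.exists_eq h1
    refine ⟨x, ⟨?_, hx⟩, rfl⟩
    by_contra! hc
    exact h2 (h.unmarked x hc)

theorem card_marked (h : IsChain s n G b T) :
    ((Finset.range n).filter fun x => s.arr 2 x ≠ 0).card = n - s.var 5 := by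
  rw [← h.image_Ico, Finset.card_image_of_injective _ b.injective, Nat.card_Ico]

/-- Renaming the points does not affect independence. -/
theorem indep_image_iff (b : Perm ℕ) (G : Subgroup (Perm ℕ)) (S : Finset ℕ) :
    Indep G (S.image b) ↔ Indep (relabel b G) S := by
  constructor
  · intro h g hg hfix
    have h1 := h _ (mem_relabel.mp hg) fun i hi => by
      obtain ⟨j, rfl⟩ := b.surjective i
      rw [Perm.mul_apply, Perm.mul_apply, show b⁻¹ (b j) = j by simp,
        hfix j fun hj => hi (Finset.mem_image_of_mem b hj)]
    have h2 : g = b⁻¹ * (b * g * b⁻¹) * b := by group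
    rw [h2, h1]; group
  · intro h g hg hfix
    have h1 := h (b⁻¹ * g * b) (mem_relabel.mpr (by
      have : b * (b⁻¹ * g * b) * b⁻¹ = g := by group
      rwa [this])) fun i hi => by
        rw [Perm.mul_apply, Perm.mul_apply, Perm.inv_eq_iff_eq]
        exact hfix _ fun hc => hi (by simpa using hc)
    have h2 : g = b * (b⁻¹ * g * b) * b⁻¹ := by group
    rw [h2, h1]; group

/-- The marked set is independent if and only if the last rows of the table are trivial. -/
theorem indep_iff (h : IsChain s n G b T) :
    Indep G ((Finset.range n).filter fun x => s.arr 2 x ≠ 0) ↔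
      ∀ i, s.var 5 ≤ i → i < n → ∀ j < n, T (i * n + j) i = i := by
  rw [← h.image_Ico, indep_image_iff]
  constructor
  · intro hI i h1 h2 j hj
    rw [hI _ (h.table.mem _) fun x hx => ?_]
    · rfl
    · rcases Nat.lt_or_ge x n with hxn | hxn
      · exact h.table.fixes h2 hj (by simp at hx; omega)
      · exact h.fixes_top _ (h.table.mem _) x hxn
  · intro htriv g hg hfix
    -- Points are treated in increasing order. Once all points below `x` are known to be fixed, the
    -- sifted form of `g` begins in row `x` with an entry that maps `x` to `g x`, and for a marked
    -- point this entry fixes `x`.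
    have key : ∀ i, ∀ x < i, g x = x := by
      intro i
      induction i with
      | zero => simp
      | succ i ih =>
        intro x hx
        rcases Nat.lt_succ_iff_lt_or_eq.mp hx with hx | rfl
        · exact ih x hx
        by_cases hxm : x ∈ Finset.Ico (s.var 5) n
        · obtain ⟨h1, h2⟩ := Finset.mem_Ico.mp hxm
          obtain ⟨h3, h4, -⟩ := h.table.sifts_apply h2
            (h.table.sifts_of_fixes (h.complete g hg) h2.le ih)
          rw [← h4, htriv x h1 h2 _ h3]
        · exact hfix x hxm
    ext x; exact key (x + 1) x (by omega)

/-- The test for a three-cycle on three marked points. -/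
theorem hasCyc_iff (h : IsChain s n G b T) (hn : s.var 5 + 3 = n) {d : ℕ} (hd : s.var 5 = d) :
    HasCyc (relabel b G) d (d + 1) (d + 2) ↔
      T (d * n + (d + 1)) d = d + 1 ∧ T (d * n + (d + 2)) d = d + 2 := by
  rw [hd] at hn
  constructor
  · intro hc
    -- A cycle that maps `d` to `y` fixes all points below `d`, so its sifted form begins in row `d`
    -- with a representative for `y`.
    have key : ∀ y z, y < n → d < y → d < z → HasCyc (relabel b G) d y z →
        T (d * n + y) d = y := by
      intro y z hy hdy hdz hc
      obtain ⟨c1, c2, c3, c4⟩ := cyc_apply hc.1 hc.2.1 hc.2.2.1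
      obtain ⟨-, h2, -⟩ := h.table.sifts_apply (by omega : d < n) (h.table.sifts_of_fixes
        (h.complete _ hc.2.2.2) (by omega) fun x hx => c4 x (by omega) (by omega) (by omega))
      rwa [c1] at h2
    exact ⟨key _ _ (by omega) (by omega) (by omega) hc,
      key _ _ (by omega) (by omega) (by omega) hc.reverse⟩
  · rintro ⟨h1, h2⟩
    -- A transitive group on three points contains a three-cycle: either `t` is one, or the inverse
    -- of `u` is the same cycle, or both are transpositions and their product is the cycle.
    set t := T (d * n + (d + 1)) with ht
    set u := T (d * n + (d + 2)) with hu
    have htG : t ∈ relabel b G := h.table.mem _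
    have huG : u ∈ relabel b G := h.table.mem _
    have htf : ∀ x, x < d ∨ n ≤ x → t x = x := by
      rintro x (hx | hx)
      · exact h.table.fixes (by omega) (by omega) hx
      · exact h.fixes_top _ htG x hx
    have huf : ∀ x, x < d ∨ n ≤ x → u x = x := by
      rintro x (hx | hx)
      · exact h.table.fixes (by omega) (by omega) hx
      · exact h.fixes_top _ huG x hx
    have three : ∀ f : Perm ℕ, (∀ x, x < d ∨ n ≤ x → f x = x) → ∀ x, d ≤ x → x < n →
        f x = d ∨ f x = d + 1 ∨ f x = d + 2 := by
      intro f hf x hx1 hx2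
      by_contra! hc
      have := f.injective (hf (f x) (by omega))
      omega
    have inj : ∀ (f : Perm ℕ) x y, x ≠ y → f x ≠ f y := fun f x y hxy => f.injective.ne hxy
    have mk : ∀ f ∈ relabel b G, (∀ x, x < d ∨ n ≤ x → f x = x) → f d = d + 1 →
        f (d + 1) = d + 2 → HasCyc (relabel b G) d (d + 1) (d + 2) := by
      intro f hf hff e1 e2
      have e3 : f (d + 2) = d := by
        have i1 := inj f (d + 2) d (by omega)
        have i2 := inj f (d + 2) (d + 1) (by omega)
        rcases three f hff (d + 2) (by omega) (by omega) with e | e | e <;> omega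
      refine ⟨by omega, by omega, by omega, ?_⟩
      rwa [← eq_cyc (by omega) (by omega) (by omega) e1 e2 e3
        fun i _ _ _ => hff i (by omega)]
    have t1 := three t htf (d + 1) (by omega) (by omega)
    have t2 := three t htf (d + 2) (by omega) (by omega)
    have u1 := three u huf (d + 1) (by omega) (by omega)
    have u2 := three u huf (d + 2) (by omega) (by omega)
    have it1 := inj t d (d + 1) (by omega)
    have it2 := inj t d (d + 2) (by omega)
    have it3 := inj t (d + 1) (d + 2) (by omega)
    have iu1 := inj u d (d + 1) (by omega)
    have iu2 := inj u d (d + 2) (by omega)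
    have iu3 := inj u (d + 1) (d + 2) (by omega)
    by_cases et : t (d + 1) = d + 2
    · exact mk t htG htf h1 et
    by_cases eu : u (d + 1) = d
    · have eu2 : u (d + 2) = d + 1 := by omega
      refine mk u⁻¹ (inv_mem huG) (fun x hx => ?_) ?_ ?_
      · rw [Perm.inv_eq_iff_eq, huf x hx]
      · rw [Perm.inv_eq_iff_eq, eu]
      · rw [Perm.inv_eq_iff_eq, eu2]
    · have et1 : t (d + 1) = d := by omega
      have et2 : t (d + 2) = d + 2 := by omega
      have eu1 : u (d + 1) = d + 1 := by omega
      refine mk (u * t) (mul_mem huG htG) (fun x hx => ?_) ?_ ?_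
      · rw [Perm.mul_apply, htf x hx, huf x hx]
      · rw [Perm.mul_apply, h1, eu1]
      · rw [Perm.mul_apply, et1, h2]

end IsChain

end CoBase

/-! ### Instances as groups of permutations of the natural numbers -/

namespace CoBase

open Equiv ForProg

/-- The numbers `d, d + 1, …, d + n - 1`. -/
def shiftEmb (d n : ℕ) : Fin n ↪ ℕ := ⟨fun x => d + x, fun x y h => Fin.ext (by simpa using h)⟩

/-- Permutations of `n` points as permutations of `d, d + 1, …, d + n - 1`. -/
noncomputable def shiftHom (d n : ℕ) : Perm (Fin n) →* Perm ℕ := Perm.viaEmbeddingHom (shiftEmb d n)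

theorem shiftHom_apply (d : ℕ) {n : ℕ} (g : Perm (Fin n)) (x : Fin n) :
    shiftHom d n g (d + x) = d + g x :=
  Perm.viaEmbedding_apply g (shiftEmb d n) x

theorem shiftHom_apply_of_not_mem (d : ℕ) {n : ℕ} (g : Perm (Fin n)) {y : ℕ}
    (hy : y < d ∨ d + n ≤ y) : shiftHom d n g y = y := by
  refine Perm.viaEmbedding_apply_of_notMem g (shiftEmb d n) y ?_
  rintro ⟨x, hx⟩
  have h1 : d + (x : ℕ) = y := hx
  have := x.isLt
  omega

theorem shiftHom_injective (d n : ℕ) : Function.Injective (shiftHom d n) :=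
  Perm.viaEmbeddingHom_injective (shiftEmb d n)

theorem exists_shiftHom_eq {d n : ℕ} {g : Perm ℕ} (hg : ∀ y, y < d ∨ d + n ≤ y → g y = y) :
    ∃ g' : Perm (Fin n), shiftHom d n g' = g := by
  have hmaps : ∀ g : Perm ℕ, (∀ y, y < d ∨ d + n ≤ y → g y = y) → ∀ x : Fin n,
      d ≤ g (d + x) ∧ g (d + x) < d + n := by
    intro g hg x
    have := x.isLt
    by_contra hc
    have h1 := g.injective (hg (g (d + x)) (by omega))
    omega
  have hg' : ∀ y, y < d ∨ d + n ≤ y → g⁻¹ y = y := fun y hy => by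
    rw [Perm.inv_eq_iff_eq, hg y hy]
  let f : Perm (Fin n) :=
    { toFun := fun x => ⟨g (d + x) - d, by have := hmaps g hg x; omega⟩
      invFun := fun x => ⟨g⁻¹ (d + x) - d, by have := hmaps g⁻¹ hg' x; omega⟩
      left_inv := fun x => Fin.ext (by
        have := (hmaps g hg x).1
        simp only
        rw [Nat.add_sub_cancel' this]; simp)
      right_inv := fun x => Fin.ext (by
        have := (hmaps g⁻¹ hg' x).1
        simp only
        rw [Nat.add_sub_cancel' this]; simp) }
  refine ⟨f, ?_⟩
  ext y
  by_cases hy : y < d ∨ d + n ≤ y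
  · rw [shiftHom_apply_of_not_mem d f hy, hg y hy]
  · push Not at hy
    obtain ⟨x, rfl⟩ : ∃ x : Fin n, y = d + x := ⟨⟨y - d, by omega⟩, by simp; omega⟩
    rw [shiftHom_apply]
    have := (hmaps g hg x).1
    simp only [f, coe_fn_mk]; omega

/-- The question in terms of the moved points. -/
theorem isYes_iff (J : CoBaseInstance) (d : ℕ) :
    J.IsYes ↔ ∃ S ⊆ Finset.Ico d (d + J.n), S.card = J.k ∧
      Indep (J.group.map (shiftHom d J.n)) S := by
  constructor
  · rintro ⟨B, hB, hbase⟩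
    refine ⟨Bᶜ.map (shiftEmb d J.n), ?_, ?_, ?_⟩
    · intro y hy
      obtain ⟨x, -, rfl⟩ := Finset.mem_map.mp hy
      exact Finset.mem_Ico.mpr ⟨Nat.le_add_right _ _, Nat.add_lt_add_left x.isLt d⟩
    · rw [Finset.card_map, Finset.card_compl, Fintype.card_fin]; omega
    · rintro _ ⟨g, hg, rfl⟩ hfix
      rw [hbase g hg fun x hx => ?_, map_one]
      have h1 := hfix (d + x) (by
        intro hc
        obtain ⟨x', hx', e⟩ := Finset.mem_map.mp hc
        obtain rfl : x' = x := (shiftEmb d J.n).injective e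
        exact Finset.mem_compl.mp hx' hx)
      rw [shiftHom_apply] at h1
      exact Fin.ext (by omega)
  · rintro ⟨S, hS, hk, hI⟩
    have hmap : (Finset.univ.filter fun x : Fin J.n => d + (x : ℕ) ∈ S).map (shiftEmb d J.n) =
        S := by
      ext y
      simp only [Finset.mem_map, Finset.mem_filter, Finset.mem_univ, true_and]
      constructor
      · rintro ⟨x, hx, rfl⟩; exact hx
      · intro hy
        have := Finset.mem_Ico.mp (hS hy)
        have h1 : d + (y - d) = y := by omega
        exact ⟨⟨y - d, by omega⟩, by simpa [h1] using hy, h1⟩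
    have hcard := congrArg Finset.card hmap
    rw [Finset.card_map, hk] at hcard
    refine ⟨(Finset.univ.filter fun x : Fin J.n => d + (x : ℕ) ∈ S)ᶜ, ?_, ?_⟩
    · rw [Finset.card_compl, Fintype.card_fin, hcard]
      have := Finset.card_filter_le Finset.univ (fun x : Fin J.n => d + (x : ℕ) ∈ S)
      rw [hcard, Finset.card_univ, Fintype.card_fin] at this
      omega
    · intro g hg hfix
      apply shiftHom_injective d J.n
      rw [map_one]
      refine hI _ ⟨g, hg, rfl⟩ fun y hy => ?_
      by_cases hyd : y < d ∨ d + J.n ≤ y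
      · exact shiftHom_apply_of_not_mem d g hyd
      · push Not at hyd
        obtain ⟨x, rfl⟩ : ∃ x : Fin J.n, y = d + x := ⟨⟨y - d, by omega⟩, by simp; omega⟩
        rw [shiftHom_apply, hfix x (by simpa using hy)]

/-- The group of an instance as a group of permutations of the natural numbers. -/
noncomputable def natGroup (I : CoBaseInstance) : Subgroup (Perm ℕ) :=
  I.group.map (shiftHom 0 I.n)

/-- The generators of an instance as permutations of the natural numbers. -/
noncomputable def natGens (I : CoBaseInstance) (g : ℕ) : Perm ℕ :=
  if h : g < I.m then shiftHom 0 I.n (I.gens ⟨g, h⟩) else 1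

theorem natGroup_fixes (I : CoBaseInstance) : ∀ g ∈ natGroup I, ∀ x, I.n ≤ x → g x = x := by
  rintro _ ⟨g, -, rfl⟩ x hx
  exact shiftHom_apply_of_not_mem 0 g (by omega)

theorem natGroup_eq (I : CoBaseInstance) :
    natGroup I = Subgroup.closure (natGens I '' {g | g < I.m}) := by
  rw [natGroup, CoBaseInstance.group, MonoidHom.map_closure]
  congr 1
  ext t
  simp only [Set.mem_image, Set.mem_range, exists_exists_eq_and, Set.mem_ofPred_eq]
  constructor
  · rintro ⟨g, rfl⟩
    exact ⟨g, g.isLt, by simp [natGens]⟩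
  · rintro ⟨g, hg, rfl⟩
    exact ⟨⟨g, hg⟩, by simp [natGens, hg]⟩

theorem holdsGens_of_isStoredIn {I : CoBaseInstance} {s : RamStore} (h : I.IsStoredIn s) :
    HoldsGens s I.n (natGens I) := by
  intro g hg x hx
  rw [h.2.1] at hg
  have h1 := shiftHom_apply 0 (I.gens ⟨g, hg⟩) ⟨x, hx⟩
  rw [zero_add, zero_add] at h1
  rw [natGens, dif_pos hg, h1]
  exact h.2.2.2 ⟨g, hg⟩ ⟨x, hx⟩

/-! ### Preparation of the memory -/

/-- The variables `3` and `4` are set to `n * n` and `n * n + m`. -/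
def prepare : ForProg :=
  .seq (.assign 3 (.const 0)) (.seq (.count 14 0 (.assign 3 (.add (.var 3) (.var 0))))
    (.assign 4 (.add (.var 3) (.var 1))))

theorem run_prepare (s : RamStore) :
    (prepare.run s).var 3 = s.var 0 * s.var 0 ∧
    (prepare.run s).var 4 = s.var 0 * s.var 0 + s.var 1 := by
  have h1 : ∀ s' : RamStore, s'.var 3 = 0 →
      ((ForProg.count 14 0 (.assign 3 (.add (.var 3) (.var 0)))).run s').var 3 =
        s'.var 0 * s'.var 0 := by
    intro s' h0
    refine run_count (x := 14) (b := 0) (s := s') (fun i st => st.var 3 = i * s'.var 0)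
      (by simp [h0]) ?_
    intro i st hi hx e1 e2 h
    rw [run_assign]
    simp [RamExpr.eval, h, e1 0 (by decide)]
    ring
  have h2 := h1 (s.setVar 3 0) (by simp)
  simp only [RamStore.setVar_var] at h2
  have h3 := run_var (ForProg.count 14 0 (.assign 3 (.add (.var 3) (.var 0)))) (s.setVar 3 0)
    (y := 1) (by decide)
  rw [prepare, run_seq, run_seq, run_assign, run_assign]
  simp only [RamExpr.eval, RamStore.setVar_var]
  simp at h2 h3
  simp [h2, h3]

/-- Array `1` is filled with the multiples of `n`. -/
def multiples : ForProg :=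
  .seq (.write 1 (.const 0) (.const 0))
    (.count 14 4 (.write 1 (.add (.var 14) (.const 1)) (.add (.cell 1 (.var 14)) (.var 0))))

theorem run_multiples {s : RamStore} {n : ℕ} (h0 : s.var 0 = n) (h3 : s.var 3 = n * n)
    (h4 : s.var 4 = n * n + s.var 1) : Ready (multiples.run s) n := by
  have hv : ∀ y, y ∉ multiples.vars → (multiples.run s).var y = s.var y := fun y hy =>
    run_var _ _ hy
  refine ⟨by rw [hv 0 (by decide), h0], by rw [hv 3 (by decide), h3], ?_,
    by rw [hv 4 (by decide), h4]; omega, by rw [hv 4 (by decide), hv 1 (by decide), h4]; omega⟩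
  rw [hv 4 (by decide)]
  rw [multiples, run_seq, run_write]
  refine run_count (x := 14) (b := 4) (s := s.setArr 1 _ _) (fun i st => ∀ j ≤ i, st.arr 1 j = j * n)
    ?_ ?_
  · intro j hj
    obtain rfl : j = 0 := by omega
    simp [RamExpr.eval]
  · intro i st hi hx e1 e2 h j hj
    have e0 : st.var 0 = n := by rw [e1 0 (by decide)]; exact h0
    rw [run_write]
    simp only [RamExpr.eval, hx, RamStore.setVar_arr, RamStore.setArr_arr, true_and, e0, h i le_rfl]
    split_ifs with hc
    · rw [hc]; ring
    · exact h j (by omega)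

end CoBase

/-! ### The classes of points and the excess points -/

namespace CoBase

open Equiv ForProg

theorem hasCyc_relabel {b : Perm ℕ} {G : Subgroup (Perm ℕ)} {x y z : ℕ} :
    HasCyc (relabel b G) x y z ↔ HasCyc G (b x) (b y) (b z) := by
  simp only [HasCyc, mem_relabel, cyc_conj, b.injective.ne_iff]

/-- All orderings of three points arise from one of them by `HasCyc.rotate` and `HasCyc.reverse`. -/
theorem hasCyc_of_three {G : Subgroup (Perm ℕ)} {d i j k : ℕ} (hi : d ≤ i ∧ i < d + 3)
    (hj : d ≤ j ∧ j < d + 3) (hk : d ≤ k ∧ k < d + 3) (hij : i ≠ j) (hik : i ≠ k) (hjk : j ≠ k) :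
    HasCyc G i j k ↔ HasCyc G d (d + 1) (d + 2) := by
  obtain ⟨i, rfl⟩ := Nat.exists_eq_add_of_le hi.1
  obtain ⟨j, rfl⟩ := Nat.exists_eq_add_of_le hj.1
  obtain ⟨k, rfl⟩ := Nat.exists_eq_add_of_le hk.1
  have h1 : i < 3 := by omega
  have h2 : j < 3 := by omega
  have h3 : k < 3 := by omega
  interval_cases i <;> interval_cases j <;> interval_cases k <;> first
    | omega
    | exact Iff.rfl
    | exact ⟨fun h => h.rotate, fun h => h.rotate.rotate⟩
    | exact ⟨fun h => h.rotate.rotate, fun h => h.rotate⟩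
    | exact ⟨fun h => h.reverse, fun h => h.reverse⟩
    | exact ⟨fun h => h.reverse.rotate, fun h => h.reverse.rotate⟩
    | exact ⟨fun h => h.reverse.rotate.rotate, fun h => h.reverse.rotate.rotate⟩

/-- The three points need not be distinct. If two coincide, fewer than three points are marked, and
the first condition on the right fails just as the three-cycle does. -/
theorem IsChain.hasCyc_marked_iff {G : Subgroup (Perm ℕ)} {s : RamStore} {n : ℕ} {b : Perm ℕ}
    {T : ℕ → Perm ℕ} (h : IsChain s n G b T) {x y z : ℕ}
    (hm : (Finset.range n).filter (fun w => s.arr 2 w ≠ 0) = {x, y, z}) :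
    HasCyc G x y z ↔ s.var 5 + 3 = n ∧ T (s.var 5 * n + (s.var 5 + 1)) (s.var 5) = s.var 5 + 1 ∧
      T (s.var 5 * n + (s.var 5 + 2)) (s.var 5) = s.var 5 + 2 := by
  have hcard := h.card_marked
  have hle := h.le
  rw [hm] at hcard
  by_cases hn : s.var 5 + 3 = n
  · have h3 : ({x, y, z} : Finset ℕ).card = 3 := by omega
    have hxy : x ≠ y := by
      rintro rfl; have := Finset.card_le_two (a := x) (b := z); simp at h3; omega
    have hyz : y ≠ z := by
      rintro rfl; have := Finset.card_le_two (a := x) (b := y); simp at h3; omega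
    have hxz : x ≠ z := by
      rintro rfl; have := Finset.card_le_two (a := y) (b := x)
      rw [Finset.insert_eq_of_mem (by simp)] at h3; omega
    have hpre : ∀ w ∈ ({x, y, z} : Finset ℕ), ∃ i, (s.var 5 ≤ i ∧ i < s.var 5 + 3) ∧ b i = w := by
      intro w hw
      rw [← hm, ← h.image_Ico] at hw
      obtain ⟨i, hi, rfl⟩ := Finset.mem_image.mp hw
      exact ⟨i, by rw [hn]; exact Finset.mem_Ico.mp hi, rfl⟩
    obtain ⟨i, hi, rfl⟩ := hpre x (by simp)
    obtain ⟨j, hj, rfl⟩ := hpre y (by simp)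
    obtain ⟨k, hk, rfl⟩ := hpre z (by simp)
    rw [← hasCyc_relabel, hasCyc_of_three hi hj hk (fun e => hxy (by rw [e]))
      (fun e => hxz (by rw [e])) (fun e => hyz (by rw [e])), h.hasCyc_iff hn rfl]
    simp [hn]
  · refine ⟨fun hc => absurd ?_ hn, fun hc => absurd hc.1 hn⟩
    rw [Finset.card_eq_three.mpr ⟨x, y, z, hc.1, hc.2.2.1, hc.2.1, rfl⟩] at hcard
    omega

/-- The expression vanishes when the last three points are on a three-cycle. -/
def cycExpr : RamExpr :=
  .add (neExpr (.add (.var 5) (.const 3)) (.var 0))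
    (.add (neExpr (.cell 6 (.add (.cell 1 (.add (.cell 1 (.var 5)) (.add (.var 5) (.const 1))))
      (.var 5))) (.add (.var 5) (.const 1)))
    (neExpr (.cell 6 (.add (.cell 1 (.add (.cell 1 (.var 5)) (.add (.var 5) (.const 2))))
      (.var 5))) (.add (.var 5) (.const 2))))

theorem eval_add_eq_zero (s : RamStore) (e f : RamExpr) :
    (RamExpr.add e f).eval s = 0 ↔ e.eval s = 0 ∧ f.eval s = 0 := by
  simp [RamExpr.eval]

theorem IsChain.eval_cycExpr {G : Subgroup (Perm ℕ)} {s : RamStore} {n : ℕ} {b : Perm ℕ}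
    {T : ℕ → Perm ℕ} (hs : Ready s n) (h : IsChain s n G b T) {x y z : ℕ}
    (hm : (Finset.range n).filter (fun w => s.arr 2 w ≠ 0) = {x, y, z}) :
    cycExpr.eval s = 0 ↔ HasCyc G x y z := by
  rw [h.hasCyc_marked_iff hm, cycExpr, eval_add_eq_zero, eval_add_eq_zero, eval_neExpr,
    eval_neExpr, eval_neExpr]
  simp only [RamExpr.eval, hs.var0]
  refine and_congr_right fun hn => ?_
  rw [hs.mul_mul (by omega) (by omega), hs.mul_mul (by omega) (by omega),
    h.holds _ (index_lt (by omega) (by omega)) _ (by omega),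
    h.holds _ (index_lt (by omega) (by omega)) _ (by omega)]

/-- The points in the variables `20`, `21`, `22` are tested for a three-cycle. -/
def cycTest : ForProg :=
  .seq (.count 14 0 (.write 2 (.var 14) (.const 0)))
  (.seq (.write 2 (.var 20) (.const 1))
  (.seq (.write 2 (.var 21) (.const 1))
  (.seq (.write 2 (.var 22) (.const 1))
  (.seq markedChain
    (.ite cycExpr .skip (.write 9 (.add (.cell 1 (.var 20)) (.var 21)) (.const 1)))))))

/-- The memory contains the generators of `G` and is prepared. -/
structure HasGroup (s : RamStore) (n : ℕ) (a : ℕ → Perm ℕ) (G : Subgroup (Perm ℕ)) : Prop where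
  ready : Ready s n
  fixes : ∀ g ∈ G, ∀ x, n ≤ x → g x = x
  gens : HoldsGens s n a
  eq : G = Subgroup.closure (a '' {g | g < s.var 1})

section

variable {s : RamStore} {n : ℕ} {a : ℕ → Perm ℕ} {G : Subgroup (Perm ℕ)}

theorem HasGroup.of_eq {s' : RamStore} (h : HasGroup s n a G) (h0 : s'.var 0 = s.var 0)
    (hv : s'.var 1 = s.var 1) (h3 : s'.var 3 = s.var 3) (h4 : s'.var 4 = s.var 4)
    (h1 : s'.arr 1 = s.arr 1) (ha : s'.arr 0 = s.arr 0) : HasGroup s' n a G := by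
  refine ⟨h.ready.of_eq h0 hv h3 h4 h1, h.fixes, ?_, by rw [hv]; exact h.eq⟩
  intro g hg x hx
  rw [ha]; exact h.gens g (hv ▸ hg) x hx

theorem HasGroup.frame (h : HasGroup s n a G) (p : ForProg)
    (hp : (∀ y ∈ [0, 1, 3, 4], y ∉ p.vars) ∧ 0 ∉ p.arrs ∧ 1 ∉ p.arrs) :
    HasGroup (p.run s) n a G :=
  h.of_eq (run_var _ _ (hp.1 0 (by simp))) (run_var _ _ (hp.1 1 (by simp)))
    (run_var _ _ (hp.1 3 (by simp))) (run_var _ _ (hp.1 4 (by simp)))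
    (run_arr _ _ hp.2.2) (run_arr _ _ hp.2.1)

theorem HasGroup.run_markedChain (h : HasGroup s n a G) :
    ∃ b T, IsChain (markedChain.run s) n G b T :=
  CoBase.run_markedChain h.ready h.fixes h.gens h.eq

theorem run_clearMarks (hn : s.var 0 = n) :
    ∀ w < n, ((ForProg.count 14 0 (.write 2 (.var 14) (.const 0))).run s).arr 2 w = 0 :=
  fun w hw => (run_count_write (x := 14) (b := 0) (a := 2) (ie := .var 14) (e := .const 0) (s := s)
      (f := fun x => x) (v := fun _ => 0) (fun i _ j hj => by omega)
      (fun x st' _ f1 f2 f3 f4 => ⟨f1, rfl⟩)).1 w (hn.symm ▸ hw)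

open Classical in
theorem run_cycTest (h : HasGroup s n a G) {x y z : ℕ} (hx : s.var 20 = x) (hy : s.var 21 = y)
    (hz : s.var 22 = z) (hxn : x < n) (hyn : y < n) (hzn : z < n) (p : ℕ) :
    (cycTest.run s).arr 9 p = if p = x * n + y ∧ HasCyc G x y z then 1 else s.arr 9 p := by
  rw [cycTest, run_seq, run_seq, run_seq, run_seq, run_seq]
  set s1 := (ForProg.count 14 0 (.write 2 (.var 14) (.const 0))).run s with hs1
  have h2 := run_clearMarks h.ready.var0
  rw [← hs1] at h2
  have v20 : s1.var 20 = x := (run_var _ _ (by decide)).trans hx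
  have v21 : s1.var 21 = y := (run_var _ _ (by decide)).trans hy
  have v22 : s1.var 22 = z := (run_var _ _ (by decide)).trans hz
  have g1 : HasGroup s1 n a G := h.frame _ (by decide)
  set s4 := (ForProg.write 2 (.var 22) (.const 1)).run ((ForProg.write 2 (.var 21) (.const 1)).run
    ((ForProg.write 2 (.var 20) (.const 1)).run s1)) with hs4
  have g4 : HasGroup s4 n a G := g1.of_eq rfl rfl rfl rfl (by
      funext i; simp [hs4, run_write]) (by funext i; simp [hs4, run_write])
  have m4 : ∀ w < n, s4.arr 2 w ≠ 0 ↔ w = x ∨ w = y ∨ w = z := by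
    intro w hw
    simp only [hs4, run_write, RamExpr.eval, RamStore.setArr_arr, RamStore.setArr_var, true_and,
      v20, v21, v22, h2 w hw]
    split_ifs <;> simp_all
  obtain ⟨b, T, hc⟩ := g4.run_markedChain
  set s5 := markedChain.run s4 with hs5
  have g5 : HasGroup s5 n a G := g4.frame _ (by decide)
  have hm : (Finset.range n).filter (fun w => s5.arr 2 w ≠ 0) = {x, y, z} := by
    ext w
    rw [show s5.arr 2 = s4.arr 2 from run_arr _ _ (by decide)]
    simp only [Finset.mem_filter, Finset.mem_range, Finset.mem_insert, Finset.mem_singleton]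
    constructor
    · rintro ⟨h1, h2⟩; exact (m4 w h1).mp h2
    · intro h1
      have hw : w < n := by rcases h1 with rfl | rfl | rfl <;> assumption
      exact ⟨hw, (m4 w hw).mpr h1⟩
  have e := IsChain.eval_cycExpr g5.ready hc hm
  have e9 : s5.arr 9 = s.arr 9 := by
    rw [hs5, run_arr _ _ (by decide)]
    funext i; simp only [hs4, run_write, RamStore.setArr_arr]
    rw [if_neg (by omega), if_neg (by omega), if_neg (by omega), hs1, run_arr _ _ (by decide)]
  have v20' : s5.var 20 = x := (run_var _ _ (by decide)).trans v20
  have v21' : s5.var 21 = y := (run_var _ _ (by decide)).trans v21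
  rw [run_ite]
  by_cases hcyc : HasCyc G x y z
  · have hx1 : s5.arr 1 x = x * n := by
      have := g5.ready.le
      have := Nat.le_mul_of_pos_right n (show 0 < n by omega)
      exact g5.ready.mul x (by omega)
    rw [if_pos (e.mpr hcyc), run_write]
    simp [RamExpr.eval, v20', v21', hx1, e9, hcyc]
  · rw [if_neg (mt e.mp hcyc), run_skip, if_neg (fun h => hcyc h.2), e9]

/-- The table of the pairs of points on a common three-cycle. -/
def relTable : ForProg :=
  .seq (.count 17 3 (.write 9 (.var 17) (.const 0)))
    (.count 20 0 (.count 21 0 (.count 22 0 cycTest)))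

/-- The array `9` contains the characteristic function of `D`. -/
def HoldsRel (s : RamStore) (n : ℕ) (D : ℕ → ℕ → Prop) : Prop :=
  ∀ x < n, ∀ y < n, (D x y → s.arr 9 (x * n + y) = 1) ∧ (¬ D x y → s.arr 9 (x * n + y) = 0)

theorem HoldsRel.congr {D D' : ℕ → ℕ → Prop} (h : HoldsRel s n D)
    (hD : ∀ x < n, ∀ y < n, D x y ↔ D' x y) : HoldsRel s n D' := fun x hx y hy => by
  rw [← hD x hx y hy]; exact h x hx y hy

theorem run_relTable (h : HasGroup s n a G) :
    HoldsRel (relTable.run s) n fun x y => ∃ z < n, HasCyc G x y z := by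
  rw [relTable, run_seq]
  set s1 := (ForProg.count 17 3 (.write 9 (.var 17) (.const 0))).run s with hs1
  have g1 : HasGroup s1 n a G := h.frame _ (by decide)
  have h1 : HoldsRel s1 n fun _ _ => False := fun x hx y hy => ⟨False.elim, fun _ =>
    (run_count_write (x := 17) (b := 3) (a := 9) (ie := .var 17) (e := .const 0) (s := s)
      (f := fun x => x) (v := fun _ => 0) (fun i _ j hj => by omega)
      (fun x st' _ f1 f2 f3 f4 => ⟨f1, rfl⟩)).1 _ (by rw [h.ready.var3]; exact index_lt hx hy)⟩
  have hn := g1.ready.var0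
  -- The invariants of the outer two loops describe the pairs that are finished, in lexicographic
  -- order; that of the innermost loop adds, for the current pair, the third points tried so far.
  have loop1 := run_count (x := 20) (b := 0) (p := .count 21 0 (.count 22 0 cycTest)) (s := s1)
    (fun i st => HoldsRel st n fun x y => x < i ∧ ∃ z < n, HasCyc G x y z) ?_ ?_
  · exact loop1.congr fun x hx y hy => by rw [hn]; simp [hx]
  · exact HoldsRel.congr (s := s1) h1 fun x _ y _ => by simp
  intro x st hx hvx e1 e2 hst
  have gst : HasGroup st n a G := g1.of_eq (e1 0 (by decide)) (e1 1 (by decide))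
    (e1 3 (by decide)) (e1 4 (by decide)) (e2 1 (by decide)) (e2 0 (by decide))
  have loop2 := run_count (x := 21) (b := 0) (p := .count 22 0 cycTest) (s := st)
    (fun i st => HoldsRel st n fun x' y => (x' < x ∨ x' = x ∧ y < i) ∧ ∃ z < n, HasCyc G x' y z)
    ?_ ?_
  · refine HoldsRel.congr (s := (ForProg.count 21 0 (.count 22 0 cycTest)).run st) loop2
      fun x' hx' y hy => ?_
    rw [gst.ready.var0]
    refine and_congr_left' ?_
    omega
  · exact HoldsRel.congr (s := st) hst fun x' _ y _ => by simp
  intro y st2 hy hvy e1' e2' hst2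
  have gst2 : HasGroup st2 n a G := gst.of_eq (e1' 0 (by decide)) (e1' 1 (by decide))
    (e1' 3 (by decide)) (e1' 4 (by decide)) (e2' 1 (by decide)) (e2' 0 (by decide))
  have hv20 : st2.var 20 = x := (e1' 20 (by decide)).trans hvx
  have loop3 := run_count (x := 22) (b := 0) (p := cycTest) (s := st2)
    (fun i st => HoldsRel st n fun x' y' => ((x' < x ∨ x' = x ∧ y' < y) ∧
      ∃ z < n, HasCyc G x' y' z) ∨ x' = x ∧ y' = y ∧ ∃ z < i, HasCyc G x' y' z) ?_ ?_
  · refine HoldsRel.congr (s := (ForProg.count 22 0 cycTest).run st2) loop3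
      fun x' hx' y' hy' => ?_
    rw [gst2.ready.var0]
    constructor
    · rintro (⟨h1, h2⟩ | ⟨rfl, rfl, h2⟩)
      · exact ⟨by omega, h2⟩
      · exact ⟨by omega, h2⟩
    · rintro ⟨h1, h2⟩
      by_cases hc : x' = x ∧ y' = y
      · exact .inr ⟨hc.1, hc.2, h2⟩
      · exact .inl ⟨by omega, h2⟩
  · exact HoldsRel.congr (s := st2) hst2 fun x' _ y _ => by simp
  intro z st3 hz hvz e1'' e2'' hst3
  have gst3 : HasGroup st3 n a G := gst2.of_eq (e1'' 0 (by decide)) (e1'' 1 (by decide))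
    (e1'' 3 (by decide)) (e1'' 4 (by decide)) (e2'' 1 (by decide)) (e2'' 0 (by decide))
  rw [hn] at hx
  rw [gst.ready.var0] at hy
  rw [gst2.ready.var0] at hz
  intro x' hx' y' hy'
  rw [RamStore.setVar_arr, run_cycTest gst3 ((e1'' 20 (by decide)).trans hv20)
    ((e1'' 21 (by decide)).trans hvy) hvz hx hy hz]
  obtain ⟨h2, h3⟩ := hst3 x' hx' y' hy'
  constructor
  · rintro (h4 | ⟨rfl, rfl, w, hw, h4⟩)
    · rw [h2 (.inl h4)]; simp
    · rcases Nat.lt_succ_iff_lt_or_eq.mp hw with hw | rfl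
      · rw [h2 (.inr ⟨rfl, rfl, w, hw, h4⟩)]; simp
      · rw [if_pos ⟨rfl, h4⟩]
  · intro h4
    rw [if_neg, h3]
    · exact fun h5 => h4 (h5.imp_right fun ⟨a1, a2, w, hw, a3⟩ => ⟨a1, a2, w, by omega, a3⟩)
    · rintro ⟨h5, h6⟩
      obtain ⟨rfl, rfl⟩ := mul_add_inj hy' hy h5
      exact h4 (.inr ⟨rfl, rfl, z, by omega, h6⟩)

/-! ### Marking the points that are kept -/

/-- All points but the excess points are marked. -/
def markLoop : ForProg :=
  .count 20 0 (.seq (.assign 23 (.const 0))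
    (.seq (.count 21 0 (.ite (.sub (.var 20) (.var 21))
        (.assign 23 (.add (.var 23) (.cell 9 (.add (.cell 1 (.var 20)) (.var 21))))) .skip))
      (.write 2 (.var 20) (.sub (.add (.var 2) (.const 1)) (.var 23)))))

-- The mark is the truncated difference of `k + 1` and the number of smaller points in the class,
-- which vanishes exactly for the excess points.
open Classical in
theorem run_markLoop (h : HasGroup s n a G)
    (hrel : HoldsRel s n fun x y => ∃ z < n, HasCyc G x y z) :
    ∀ x < n, (markLoop.run s).arr 2 x ≠ 0 ↔ x ∉ excess G n (s.var 2) := by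
  have hmain := run_count (x := 20) (b := 0) (p := .seq (.assign 23 (.const 0))
    (.seq (.count 21 0 (.ite (.sub (.var 20) (.var 21))
        (.assign 23 (.add (.var 23) (.cell 9 (.add (.cell 1 (.var 20)) (.var 21))))) .skip))
      (.write 2 (.var 20) (.sub (.add (.var 2) (.const 1)) (.var 23))))) (s := s)
    (fun i st => ∀ x < i, st.arr 2 x ≠ 0 ↔ (s.var 2 + 1) -
      ((Finset.range x).filter fun y => CycRel G x y).card ≠ 0) (by simp) ?_
  · intro x hx
    rw [h.ready.var0] at hmain
    refine (hmain x hx).trans ?_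
    simp only [excess, Finset.mem_filter, Finset.mem_range]
    omega
  intro x st hx hvx e1 e2 hst
  rw [h.ready.var0] at hx
  have gst : HasGroup st n a G := h.of_eq (e1 0 (by decide)) (e1 1 (by decide))
    (e1 3 (by decide)) (e1 4 (by decide)) (e2 1 (by decide)) (e2 0 (by decide))
  rw [run_seq, run_seq, run_assign]
  set s1 := st.setVar 23 (RamExpr.eval st (.const 0)) with hs1
  have hv0 : s1.var 0 = n := by simp [hs1, gst.ready.var0]
  have hv20 : s1.var 20 = x := by simp [hs1, hvx]
  have h9 : s1.arr 9 = s.arr 9 := e2 9 (by decide)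
  have hx1 : s1.arr 1 x = x * n := by
    have := gst.ready.le
    have := Nat.le_mul_of_pos_right n (show 0 < n by omega)
    exact gst.ready.mul x (by omega)
  have hcount := run_count (x := 21) (b := 0) (p := .ite (.sub (.var 20) (.var 21))
        (.assign 23 (.add (.var 23) (.cell 9 (.add (.cell 1 (.var 20)) (.var 21))))) .skip) (s := s1)
    (fun i st => st.var 23 = ((Finset.range i).filter fun y => y < x ∧ CycRel G x y).card)
    (by simp [hs1, RamExpr.eval]) ?_
  · rw [hv0] at hcount
    set s2 := (ForProg.count 21 0 (.ite (.sub (.var 20) (.var 21))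
        (.assign 23 (.add (.var 23) (.cell 9 (.add (.cell 1 (.var 20)) (.var 21)))))
        .skip)).run s1 with hs2
    have w20 : s2.var 20 = x := (run_var _ _ (by decide)).trans hv20
    have w2 : s2.var 2 = s.var 2 := by
      rw [hs2, run_var _ _ (by decide), hs1]; simp [e1 2 (by decide)]
    have a2 : s2.arr 2 = st.arr 2 := run_arr _ _ (by decide)
    intro x' hx'
    rw [run_write]
    simp only [RamExpr.eval, RamStore.setVar_arr, RamStore.setArr_arr, true_and, w20, w2, hcount, a2]
    have hset : ((Finset.range n).filter fun y => y < x ∧ CycRel G x y) =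
        (Finset.range x).filter fun y => CycRel G x y := by
      ext y; simp only [Finset.mem_filter, Finset.mem_range]; constructor
      · rintro ⟨-, h⟩; exact h
      · rintro h; exact ⟨by omega, h⟩
    split_ifs with hc
    · rw [hc, hset]
    · exact hst x' (by omega)
  · intro y st2 hy hvy f1 f2 hi
    rw [hv0] at hy
    have w20 : st2.var 20 = x := (f1 20 (by decide)).trans hv20
    rw [run_ite, Finset.range_add_one, Finset.filter_insert]
    simp only [RamExpr.eval, w20, hvy]
    by_cases hyx : y < x
    · rw [if_neg (by omega), run_assign]
      simp only [RamExpr.eval, hi, w20, hvy, RamStore.setVar_var, f2 1 (by decide), hx1,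
        f2 9 (by decide), h9]
      rw [if_neg (show ¬ (23 : ℕ) = 21 by decide), if_pos trivial]
      obtain ⟨r1, r2⟩ := hrel x hx y hy
      by_cases hr : CycRel G x y
      · obtain ⟨z, hz⟩ := hr.resolve_left hyx.ne'
        -- The group fixes all numbers from `n` on, so restricting the third point to the domain
        -- loses nothing.
        have hzn : z < n := by
          by_contra! hc
          have h4 := h.fixes _ hz.2.2.2 z hc
          rw [(cyc_apply hz.1 hz.2.1 hz.2.2.1).2.2.1] at h4
          exact hz.2.2.1 h4
        rw [if_pos ⟨hyx, hr⟩, Finset.card_insert_of_notMem (by simp), r1 ⟨z, hzn, hz⟩]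
      · rw [if_neg (fun h => hr h.2), r2 (fun ⟨z, _, hz⟩ => hr (.inr ⟨z, hz⟩))]
        simp
    · rw [if_pos (by omega), if_neg (fun h => hyx h.1), run_skip]
      simpa using hi

/-- The table of representatives for the numbering in which the excess points come first. -/
def reduce : ForProg :=
  .seq multiples (.seq relTable (.seq markLoop (.seq markedChain
    (.assign 6 (.sub (.var 0) (.var 5))))))

end

end CoBase

/-! ### The kernel -/

namespace CoBase

open Equiv ForProg

variable {s : RamStore} {n : ℕ} {a : ℕ → Perm ℕ} {G : Subgroup (Perm ℕ)}

theorem IsChain.of_eq {s' : RamStore} {b : Perm ℕ} {T : ℕ → Perm ℕ} (h : IsChain s n G b T)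
    (h5 : s'.var 5 = s.var 5) (h2 : s'.arr 2 = s.arr 2) (h3 : s'.arr 3 = s.arr 3)
    (h6 : s'.arr 6 = s.arr 6) : IsChain s' n G b T :=
  ⟨⟨h.fixes, by rw [h3]; exact h.arr, by rw [h5]; exact h.le, by rw [h5, h2]; exact h.unmarked,
    by rw [h5, h2]; exact h.marked⟩, h.fixes_top, h.table,
    fun p hp x hx => by rw [h6]; exact h.holds p hp x hx, h.complete⟩

theorem hasGroup_multiples {I : CoBaseInstance} (hI : I.IsStoredIn s)
    (h3 : s.var 3 = I.n * I.n) (h4 : s.var 4 = I.n * I.n + I.m) :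
    HasGroup (multiples.run s) I.n (natGens I) (natGroup I) := by
  have hR := run_multiples hI.1 h3 (by rw [h4, hI.2.1])
  have hv1 : (multiples.run s).var 1 = s.var 1 := run_var _ _ (by decide)
  refine ⟨hR, natGroup_fixes I, ?_, by rw [hv1, hI.2.1]; exact natGroup_eq I⟩
  intro g hg x hx
  rw [run_arr _ _ (by decide)]
  exact holdsGens_of_isStoredIn hI g (hv1 ▸ hg) x hx

theorem run_reduce {I : CoBaseInstance} (hI : I.IsStoredIn s)
    (h3 : s.var 3 = I.n * I.n) (h4 : s.var 4 = I.n * I.n + I.m) :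
    ∃ b T, IsChain (reduce.run s) I.n (natGroup I) b T ∧ Ready (reduce.run s) I.n ∧
      (reduce.run s).var 6 = I.n - (reduce.run s).var 5 ∧
      (Finset.range I.n).filter (fun x => (reduce.run s).arr 2 x ≠ 0) =
        Finset.range I.n \ excess (natGroup I) I.n I.k := by
  have g1 := hasGroup_multiples hI h3 h4
  rw [reduce, run_seq, run_seq, run_seq, run_seq]
  set s1 := multiples.run s with hs1
  have hrel := run_relTable g1
  have g2 : HasGroup (relTable.run s1) I.n (natGens I) (natGroup I) := g1.frame _ (by decide)
  set s2 := relTable.run s1 with hs2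
  have hmark := run_markLoop g2 hrel
  have hk : s2.var 2 = I.k :=
    ((run_var _ _ (by decide)).trans (run_var _ _ (by decide))).trans hI.2.2.1
  rw [hk] at hmark
  have g3 : HasGroup (markLoop.run s2) I.n (natGens I) (natGroup I) := g2.frame _ (by decide)
  set s3 := markLoop.run s2 with hs3
  obtain ⟨b, T, hc⟩ := g3.run_markedChain
  have g4 : HasGroup (markedChain.run s3) I.n (natGens I) (natGroup I) := g3.frame _ (by decide)
  set s4 := markedChain.run s3 with hs4
  rw [run_assign]
  refine ⟨b, T, hc.of_eq (by simp) rfl rfl rfl, g4.ready.of_eq (by simp) (by simp) (by simp)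
    (by simp) rfl, by simp [RamExpr.eval, g4.ready.var0], ?_⟩
  ext x
  rw [RamStore.setVar_arr, show s4.arr 2 = s3.arr 2 from run_arr _ _ (by decide)]
  simp only [Finset.mem_filter, Finset.mem_sdiff, Finset.mem_range]
  exact and_congr_right fun hx => hmark x hx

/-- The group on the last points, in the numbering of the table. -/
theorem exists_instance {I : CoBaseInstance} {b : Perm ℕ} {T : ℕ → Perm ℕ}
    (h : IsChain s I.n (natGroup I) b T)
    (hm : (Finset.range I.n).filter (fun x => s.arr 2 x ≠ 0) =
        Finset.range I.n \ excess (natGroup I) I.n I.k) {l : ℕ} (hl : l = I.n - s.var 5) :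
    ∃ J : CoBaseInstance, J.n = l ∧ J.m = l * l ∧ J.k = I.k ∧
      (∀ (i : Fin J.m) (j : Fin J.n), ((J.gens i j : Fin J.n) : ℕ) =
        T ((s.var 5 + i / l) * I.n + (s.var 5 + i % l)) (s.var 5 + j) - s.var 5) ∧
      (J.IsYes ↔ I.IsYes) := by
  set d := s.var 5 with hd
  have hle : d ≤ I.n := h.le
  have hdl : d + l = I.n := by omega
  have hrow : ∀ g < l * l, g / l < l ∧ g % l < l := by
    intro g hg
    have hl0 : 0 < l := by rcases Nat.eq_zero_or_pos l with rfl | h <;> omega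
    exact ⟨Nat.div_lt_of_lt_mul hg, Nat.mod_lt _ hl0⟩
  have hex : ∀ g : Fin (l * l), ∃ t : Perm (Fin l),
      shiftHom d l t = T ((d + g / l) * I.n + (d + g % l)) := by
    intro g
    obtain ⟨h1, h2⟩ := hrow g g.isLt
    refine exists_shiftHom_eq ?_
    rintro y (hy | hy)
    · exact h.table.fixes (by omega) (by omega) (hy.trans_le (Nat.le_add_right _ _))
    · exact h.fixes_top _ (h.table.mem _) y (by omega)
  choose gens hgens using hex
  refine ⟨⟨l, l * l, gens, I.k⟩, rfl, rfl, rfl, fun i j => ?_, ?_⟩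
  · have := shiftHom_apply d (gens i) j
    rw [hgens] at this
    simp only
    rw [this]; omega
  -- the group of the new instance is a stabilizer
  have hgrp : ∀ g, g ∈ (CoBaseInstance.group ⟨l, l * l, gens, I.k⟩).map (shiftHom d l) ↔
      g ∈ relabel b (natGroup I) ∧ ∀ x < d, g x = x := by
    intro g
    constructor
    · rintro ⟨t, ht, rfl⟩
      refine ⟨?_, fun x hx => shiftHom_apply_of_not_mem d t (.inl hx)⟩
      have : CoBaseInstance.group ⟨l, l * l, gens, I.k⟩ ≤
          (relabel b (natGroup I)).comap (shiftHom d l) := by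
        rw [CoBaseInstance.group, Subgroup.closure_le]
        rintro _ ⟨i, rfl⟩
        rw [SetLike.mem_coe, Subgroup.mem_comap]
        show shiftHom d l (gens i) ∈ relabel b (natGroup I)
        rw [hgens]; exact h.table.mem _
      exact this ht
    · rintro ⟨hg, hfix⟩
      -- An element that fixes everything below `d` is a product of entries of the rows from `d` on.
      have h1 := IsRepTable.sifts_mem_closure (h.table.sifts_of_fixes (h.complete g hg) hle hfix)
      rw [CoBaseInstance.group, MonoidHom.map_closure]
      refine (Subgroup.closure_le _).mpr ?_ h1
      rintro _ ⟨i, j, hi, hin, hj, rfl⟩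
      -- Entries in the columns below `d` are not copied. They are trivial here, because an entry of
      -- row `i` fixes `j` and so cannot map `i` to `j`.
      by_cases hjd : j < d
      · rw [h.table.eq_one_of_ne hin hj fun hc => ?_]
        · exact one_mem _
        · have h2 := h.table.fixes hin hj (hjd.trans_le hi)
          have := (T (i * I.n + j)).injective (hc.trans h2.symm)
          omega
      · obtain ⟨i, rfl⟩ := Nat.exists_eq_add_of_le hi
        obtain ⟨j, rfl⟩ := Nat.exists_eq_add_of_le (not_lt.mp hjd)
        have hlt : i * l + j < l * l := index_lt (by omega) (by omega)
        refine Subgroup.subset_closure ⟨gens ⟨i * l + j, hlt⟩, ⟨_, rfl⟩, ?_⟩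
        rw [hgens]
        have e1 : (i * l + j) / l = i := by
          rw [Nat.mul_comm, Nat.mul_add_div (by omega), Nat.div_eq_of_lt (by omega), add_zero]
        have e2 : (i * l + j) % l = j := by
          rw [Nat.mul_comm, Nat.mul_add_mod, Nat.mod_eq_of_lt (by omega)]
        simp only [e1, e2]
  have himg : (Finset.Ico d I.n).image b = Finset.range I.n \ excess (natGroup I) I.n I.k := by
    rw [← hm]; exact h.image_Ico
  -- An element that moves only points of `S` fixes all positions below `d` and so lies in the
  -- stabilizer. Passing to the stabilizer does not change which of these sets are independent.
  have hind : ∀ S ⊆ Finset.Ico d I.n,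
      (Indep ((CoBaseInstance.group ⟨l, l * l, gens, I.k⟩).map (shiftHom d l)) S ↔
        Indep (natGroup I) (S.image b)) := by
    intro S hS
    rw [IsChain.indep_image_iff]
    refine ⟨fun hI g hg hfix => hI g ((hgrp g).mpr ⟨hg, fun x hx => hfix x fun hc => ?_⟩) hfix,
      fun hI g hg hfix => hI g ((hgrp g).mp hg).1 hfix⟩
    have := Finset.mem_Ico.mp (hS hc); omega
  -- The offset `d` places the new instance on the positions of the marked points; the original
  -- instance has offset zero.
  rw [isYes_iff _ d, isYes_iff I 0]
  simp only [hdl, zero_add]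
  constructor
  · rintro ⟨S, hS, hk, hI⟩
    refine ⟨S.image b, fun y hy => ?_, by rw [Finset.card_image_of_injective _ b.injective, hk],
      (hind S hS).mp hI⟩
    have := Finset.image_subset_image hS hy
    rw [himg] at this
    simpa using (Finset.mem_sdiff.mp this).1
  · rintro ⟨S, hS, hk, hI⟩
    obtain ⟨S', h1, h2, h3⟩ := exists_indep_sdiff_excess (natGroup I) I.n I.k S
      (by rwa [Finset.range_eq_Ico]) hk.le hI
    rw [← himg] at h1
    obtain ⟨S₀, h4, rfl⟩ := Finset.subset_image_iff.mp h1
    rw [Finset.card_image_of_injective _ b.injective] at h2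
    have h4' : S₀ ⊆ Finset.Ico d I.n := by exact_mod_cast h4
    exact ⟨S₀, h4', h2.trans hk, (hind S₀ h4').mpr h3⟩

/-- Instances with too many points after the reduction have the answer yes. -/
theorem isYes_of_lt {I : CoBaseInstance} {b : Perm ℕ} {T : ℕ → Perm ℕ}
    (h : IsChain s I.n (natGroup I) b T)
    (hm : (Finset.range I.n).filter (fun x => s.arr 2 x ≠ 0) =
        Finset.range I.n \ excess (natGroup I) I.n I.k)
    (hlt : I.k ^ (2 * I.k + 1) < I.n - s.var 5) : I.IsYes := by
  have hcard := h.card_marked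
  rw [hm] at hcard
  obtain ⟨S, h1, h2, h3⟩ := exists_indep_of_card_lt (G := natGroup I) (k := I.k)
    (fun x _ => card_class_sdiff_excess_le (natGroup I) I.n I.k x) (by rw [hcard]; exact hlt)
  rw [isYes_iff I 0]
  refine ⟨S, fun x hx => ?_, h2, h3⟩
  have := (Finset.mem_sdiff.mp (h1 hx)).1
  simpa using this

/-! ### Writing the kernel -/

/-- The variable `7` is multiplied with the variable `b`, as often as variable `2` says. -/
def mulPow (b : ℕ) : ForProg :=
  .count 24 2 (.seq (.assign 8 (.const 0))
    (.seq (.count 25 b (.assign 8 (.add (.var 8) (.var 7)))) (.assign 7 (.var 8))))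

/-- The inner loop adds the current product, and its number of rounds is the value of the factor
`b`. With `b = 2` even the threshold `k ^ (2 * k + 1)` thus takes only quadratically many additions
in `k`. -/
theorem run_mulPow (s : RamStore) {b : ℕ} (hb : b ∉ (mulPow b).vars) :
    ((mulPow b).run s).var 7 = s.var 7 * s.var b ^ s.var 2 := by
  refine run_count (x := 24) (b := 2) (s := s) (fun i st => st.var 7 = s.var 7 * s.var b ^ i)
    (by simp) ?_
  intro i st hi hx e1 e2 h
  have hb' : st.var b = s.var b := e1 b hb
  simp only [mulPow, vars, List.mem_cons, List.mem_append, List.not_mem_nil, or_false,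
    not_or] at hb
  rw [run_seq, run_seq, run_assign, run_assign]
  have := run_count (x := 25) (b := b) (s := st.setVar 8 (RamExpr.eval st (.const 0)))
    (p := .assign 8 (.add (.var 8) (.var 7)))
    (fun j st' => st'.var 8 = j * st.var 7) (by simp [RamExpr.eval]) ?_
  · simp only [RamStore.setVar_var, RamExpr.eval] at this ⊢
    rw [if_neg hb.2.1] at this
    rw [if_neg (by decide), if_true, this, h, hb', pow_succ]; ring
  · intro j st' hj hx' f1 f2 hh
    have f7 := f1 7 (by simp [vars])
    simp only [RamStore.setVar_var] at f7
    rw [if_neg (by decide)] at f7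
    simp only [run_assign, RamStore.setVar_var, RamExpr.eval, hh, f7]
    rw [if_neg (by decide), if_true]; ring

/-- The last rows of the table are copied to array `0`. -/
def outGens : ForProg :=
  .seq (.assign 9 (.const 0)) (.count 20 6 (.count 21 6 (.seq
    (.count 14 6 (.write 0 (.add (.var 9) (.var 14)) (.sub (.cell 6 (.add (.cell 1 (.add
      (.cell 1 (.add (.var 5) (.var 20))) (.add (.var 5) (.var 21)))) (.add (.var 5) (.var 14))))
      (.var 5))))
    (.assign 9 (.add (.var 9) (.var 6))))))

/-- The entries of the last square block of the table become the generators, row by row. Variable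
`9` is the running offset of the next generator, so no division is needed. -/
theorem run_outGens {T : ℕ → Perm ℕ} (hs : Ready s n) (hT : HoldsTable s n T) {d l : ℕ}
    (hd : s.var 5 = d) (hl : s.var 6 = l) (hdl : d + l = n) :
    ∀ g < l * l, ∀ x < l, (outGens.run s).arr 0 (g * l + x) =
      T ((d + g / l) * n + (d + g % l)) (d + x) - d := by
  rw [outGens, run_seq, run_assign]
  set s1 := s.setVar 9 (RamExpr.eval s (.const 0)) with hs1
  let Inv : ℕ → RamStore → Prop := fun c st => st.var 9 = c * l ∧ ∀ g < c, ∀ x < l,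
    st.arr 0 (g * l + x) = T ((d + g / l) * n + (d + g % l)) (d + x) - d
  have h6 : s1.var 6 = l := by simp [hs1, hl]
  have loop1 := run_count (x := 20) (b := 6) (s := s1) (p := .count 21 6 (.seq
    (.count 14 6 (.write 0 (.add (.var 9) (.var 14)) (.sub (.cell 6 (.add (.cell 1 (.add
      (.cell 1 (.add (.var 5) (.var 20))) (.add (.var 5) (.var 21)))) (.add (.var 5) (.var 14))))
      (.var 5))))
    (.assign 9 (.add (.var 9) (.var 6))))) (fun i st => Inv (i * l) st) ?_ ?_
  · rw [h6] at loop1; exact loop1.2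
  · exact ⟨by simp [hs1, RamExpr.eval], by simp⟩
  intro i st hi hx e1 e2 hst
  have st6 : st.var 6 = l := (e1 6 (by decide)).trans h6
  have loop2 := run_count (x := 21) (b := 6) (s := st) (p := .seq
    (.count 14 6 (.write 0 (.add (.var 9) (.var 14)) (.sub (.cell 6 (.add (.cell 1 (.add
      (.cell 1 (.add (.var 5) (.var 20))) (.add (.var 5) (.var 21)))) (.add (.var 5) (.var 14))))
      (.var 5))))
    (.assign 9 (.add (.var 9) (.var 6)))) (fun j st => Inv (i * l + j) st) ?_ ?_
  · rw [st6, ← Nat.succ_mul] at loop2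
    refine ⟨?_, loop2.2⟩
    rw [RamStore.setVar_var, if_neg (by decide)]
    exact loop2.1
  · refine ⟨?_, hst.2⟩
    rw [RamStore.setVar_var, if_neg (by decide)]
    exact hst.1
  intro j st2 hj hx' f1 f2 hst2
  rw [h6] at hi
  rw [st6] at hj
  have st26 : st2.var 6 = l := (f1 6 (by decide)).trans st6
  have st25 : st2.var 5 = d := by
    rw [f1 5 (by decide), e1 5 (by decide), hs1]; simp [hd]
  have st220 : st2.var 20 = i := (f1 20 (by decide)).trans hx
  have a1 : st2.arr 1 = s.arr 1 := (f2 1 (by decide)).trans (e2 1 (by decide))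
  have a6 : st2.arr 6 = s.arr 6 := (f2 6 (by decide)).trans (e2 6 (by decide))
  have ediv : (i * l + j) / l = i := by
    rw [Nat.mul_comm, Nat.mul_add_div (by omega), Nat.div_eq_of_lt (by omega), add_zero]
  have emod : (i * l + j) % l = j := by
    rw [Nat.mul_comm, Nat.mul_add_mod, Nat.mod_eq_of_lt (by omega)]
  obtain ⟨w1, w2⟩ := run_count_write (x := 14) (b := 6) (a := 0) (ie := .add (.var 9) (.var 14))
    (e := .sub (.cell 6 (.add (.cell 1 (.add
      (.cell 1 (.add (.var 5) (.var 20))) (.add (.var 5) (.var 21)))) (.add (.var 5) (.var 14))))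
      (.var 5)) (s := st2) (f := fun x => (i * l + j) * l + x)
    (v := fun x => T ((d + i) * n + (d + j)) (d + x) - d) (fun i _ j hj => by omega)
    (fun x st' hxl g1 g2 g3 g4 => by
      rw [st26] at hxl
      simp only [RamExpr.eval, g1, g2 9 (by decide), g2 5 (by decide), g2 20 (by decide),
        g2 21 (by decide), g3 6 (by decide), g3 1 (by decide), hst2.1, st25, st220, hx', a1, a6,
        true_and]
      rw [hs.mul_mul (by omega) (by omega), hT _ (index_lt (by omega) (by omega)) _ (by omega)])
  rw [run_seq, run_assign]
  refine ⟨?_, ?_⟩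
  · rw [RamStore.setVar_var, if_neg (by decide), RamStore.setVar_var, if_pos rfl]
    simp only [RamExpr.eval]
    rw [run_var _ _ (by decide), run_var _ _ (by decide), hst2.1, st26]; ring
  · intro g hg x hxl
    rw [RamStore.setVar_arr, RamStore.setVar_arr]
    rcases (by omega : g < i * l + j ∨ g = i * l + j) with hg | rfl
    · rw [w2, hst2.2 g hg x hxl]
      intro y hy e
      exact hg.ne (mul_add_inj hxl (st26 ▸ hy) e).1
    · rw [w1 x (st26.symm ▸ hxl), ediv, emod]

/-- The reduced instance is written, or a trivial one if the reduced instance is large. -/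
def output : ForProg :=
  .seq (.assign 7 (.var 2)) (.seq (mulPow 2) (.seq (mulPow 2) (.ite (.sub (.var 6) (.var 7))
    (.seq (.assign 26 (.var 2)) (.assign 10 (.const 0)))
    (.seq outGens (.seq (.assign 10 (.const 0))
      (.seq (.count 20 6 (.assign 10 (.add (.var 10) (.var 6)))) (.assign 26 (.var 6))))))))

/-- The size of the new instance is written. -/
def outSize : ForProg := .seq (.assign 0 (.var 26)) (.assign 1 (.var 10))

theorem run_output {I : CoBaseInstance} {b : Perm ℕ} {T : ℕ → Perm ℕ}
    (h : IsChain s I.n (natGroup I) b T) (hs : Ready s I.n) (hk : s.var 2 = I.k)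
    (h6 : s.var 6 = I.n - s.var 5)
    (hm : (Finset.range I.n).filter (fun x => s.arr 2 x ≠ 0) =
        Finset.range I.n \ excess (natGroup I) I.n I.k) :
    ∃ J : CoBaseInstance, J.IsStoredIn (outSize.run (output.run s)) ∧ (J.IsYes ↔ I.IsYes) ∧
      J.k = I.k ∧ J.n ≤ I.k ^ (2 * I.k + 1) ∧ J.m ≤ J.n ^ 2 := by
  rw [output, run_seq, run_seq, run_seq]
  set s1 := (ForProg.assign 7 (.var 2)).run s with hs1
  set s2 := (mulPow 2).run s1 with hs2
  set s3 := (mulPow 2).run s2 with hs3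
  have k1 : s1.var 2 = I.k := by simp [hs1, run_assign, hk]
  have k2 : s2.var 2 = I.k := (run_var _ _ (by decide)).trans k1
  have k3 : s3.var 2 = I.k := (run_var _ _ (by decide)).trans k2
  have p1 : s1.var 7 = I.k := by simp [hs1, run_assign, RamExpr.eval, hk]
  -- The starting value `k` is multiplied twice by `k ^ k`.
  have p3 : s3.var 7 = I.k ^ (2 * I.k + 1) := by
    rw [hs3, run_mulPow _ (by decide), hs2, run_mulPow _ (by decide), ← hs2, k2, k1, p1]; ring
  have hsame : ∀ y, y ∉ [7, 8, 24, 25] → s3.var y = s.var y := by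
    intro y hy
    have hm : y ∉ (mulPow 2).vars := by
      simp [mulPow, vars] at hy ⊢; omega
    rw [hs3, run_var _ _ hm, hs2, run_var _ _ hm, hs1]
    simp at hy
    simp [run_assign]; omega
  have harr : ∀ c, s3.arr c = s.arr c := fun c =>
    (run_arr _ _ (by simp [mulPow, arrs])).trans (run_arr _ _ (by simp [mulPow, arrs]))
  have v6 : s3.var 6 = I.n - s.var 5 := (hsame 6 (by decide)).trans h6
  have hle := h.le
  rw [run_ite]
  by_cases hlt : I.k ^ (2 * I.k + 1) < I.n - s.var 5
  · have hyes := isYes_of_lt h hm hlt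
    have hc : RamExpr.eval s3 (.sub (.var 6) (.var 7)) ≠ 0 := by
      simp only [RamExpr.eval, v6, p3]; omega
    rw [if_neg hc]
    -- A fixed yes-instance with the same parameter: `k` points and no generators, where the empty
    -- set is a base.
    refine ⟨⟨I.k, 0, fun i => i.elim0, I.k⟩, ⟨?_, ?_, ?_, fun i => i.elim0⟩, ?_, rfl,
      ?_, Nat.zero_le _⟩
    · simp [outSize, run_seq, run_assign, RamExpr.eval, k3]
    · simp [outSize, run_seq, run_assign, RamExpr.eval]
    · simp [outSize, run_seq, run_assign, RamExpr.eval, k3]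
    · refine iff_of_true ⟨∅, by simp, fun g hg _ => ?_⟩ hyes
      simpa [CoBaseInstance.group, Set.range_eq_empty] using hg
    · exact Nat.le_self_pow (by omega) _
  · have hc : RamExpr.eval s3 (.sub (.var 6) (.var 7)) = 0 := by
      simp only [RamExpr.eval, v6, p3]; omega
    rw [if_pos hc]
    obtain ⟨J, j1, j2, j3, j4, j5⟩ := exists_instance h hm (l := I.n - s.var 5) rfl
    set l := I.n - s.var 5 with hl
    have hs3R : Ready s3 I.n := hs.of_eq (hsame 0 (by decide)) (hsame 1 (by decide))
      (hsame 3 (by decide)) (hsame 4 (by decide)) (harr 1)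
    have hgens := run_outGens (T := T) hs3R (fun p hp x hx => by
      rw [harr 6]; exact h.holds p hp x hx) (hsame 5 (by decide)) v6 (by omega)
    rw [run_seq, run_seq, run_seq]
    set s4 := outGens.run s3 with hs4
    have k4 : s4.var 2 = I.k := (run_var _ _ (by decide)).trans k3
    have v46 : s4.var 6 = l := (run_var _ _ (by decide)).trans v6
    set s5 := (ForProg.assign 10 (.const 0)).run s4 with hs5
    have v56 : s5.var 6 = l := by simp [hs5, run_assign, v46]
    have hm6 := run_count (x := 20) (b := 6) (s := s5)
      (p := .assign 10 (.add (.var 10) (.var 6))) (fun i st => st.var 10 = i * l)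
      (by simp [hs5, run_assign, RamExpr.eval]) (by
        intro i st hi hx e1 e2 hh
        rw [run_assign]
        simp [RamExpr.eval, hh, e1 6 (by decide), v56]; ring)
    rw [v56] at hm6
    set s6 := (ForProg.count 20 6 (.assign 10 (.add (.var 10) (.var 6)))).run s5 with hs6
    have k6 : s6.var 2 = I.k := by
      rw [hs6, run_var _ _ (by decide), hs5]; simp [run_assign, k4]
    have v66 : s6.var 6 = l := (run_var _ _ (by decide)).trans v56
    have a6 : s6.arr 0 = s4.arr 0 := run_arr _ _ (by decide)
    refine ⟨J, ⟨?_, ?_, ?_, ?_⟩, j5, j3, by rw [j1]; omega, by rw [j1, j2, sq]⟩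
    · simp [outSize, run_seq, run_assign, RamExpr.eval, v66, j1]
    · simp [outSize, run_seq, run_assign, RamExpr.eval, hm6, j2]
    · simp [outSize, run_seq, run_assign, k6, j3]
    · intro i j
      rw [j4 i j]
      have hi : (i : ℕ) < l * l := j2 ▸ i.isLt
      have hj : (j : ℕ) < l := j1 ▸ j.isLt
      have e : (i : ℕ) * J.n = i * l := by rw [j1]
      show s6.arr 0 _ = _
      rw [a6, e, hgens i hi j hj]

end CoBase

/-! ### Exhaustive search -/

namespace CoBase

open Equiv ForProg

variable {s : RamStore} {n : ℕ} {a : ℕ → Perm ℕ} {G : Subgroup (Perm ℕ)}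

/-- The set of the last `k` digits of `c` in base `n`. -/
def digitSet (n k c : ℕ) : Finset ℕ := (Finset.range k).image fun i => c / n ^ i % n

/-- A listing of `S` is read as the digits of a number in base `n`; a new element becomes the lowest
digit. -/
theorem exists_digitSet_eq {n : ℕ} (S : Finset ℕ) (hS : S ⊆ Finset.range n) :
    ∃ c < n ^ S.card, digitSet n S.card c = S := by
  induction S using Finset.induction_on with
  | empty => exact ⟨0, by simp, by simp [digitSet]⟩
  | insert a S ha ih =>
    obtain ⟨c, hc, e⟩ := ih ((Finset.subset_insert a S).trans hS)
    have han : a < n := Finset.mem_range.mp (hS (Finset.mem_insert_self a S))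
    rw [Finset.card_insert_of_notMem ha]
    have e1 : (a + n * c) / n = c := by
      rw [Nat.add_mul_div_left _ _ (by omega), Nat.div_eq_of_lt han, zero_add]
    refine ⟨a + n * c, ?_, ?_⟩
    · rw [pow_succ']
      calc a + n * c < n + n * c := by omega
        _ = n * (c + 1) := by ring
        _ ≤ n * n ^ S.card := Nat.mul_le_mul_left _ hc
    · nth_rw 2 [← e]
      ext w
      simp only [digitSet, Finset.mem_image, Finset.mem_range, Finset.mem_insert]
      constructor
      · rintro ⟨i, hi, rfl⟩
        cases i with
        | zero => left; simp [Nat.mod_eq_of_lt han]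
        | succ i => exact .inr ⟨i, by omega, by rw [pow_succ', ← Nat.div_div_eq_div_mul, e1]⟩
      · rintro (rfl | ⟨i, hi, rfl⟩)
        · exact ⟨0, by omega, by simp [Nat.mod_eq_of_lt han]⟩
        · exact ⟨i + 1, by omega, by rw [pow_succ', ← Nat.div_div_eq_div_mul, e1]⟩

/-- The variable `29` is divided by `n`; the quotient is in variable `31`. -/
def divide : ForProg :=
  .seq (.assign 31 (.const 0)) (.count 32 7 (.ite (.sub (.add (.var 29) (.const 1)) (.var 0))
    (.seq (.assign 29 (.sub (.var 29) (.var 0))) (.assign 31 (.add (.var 31) (.const 1)))) .skip))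

theorem run_divide {c : ℕ} (hn : s.var 0 = n) (hn0 : 0 < n) (hc : s.var 29 = c)
    (hlt : c < s.var 7) :
    (divide.run s).var 29 = c % n ∧ (divide.run s).var 31 = c / n := by
  rw [divide, run_seq, run_assign]
  set s1 := s.setVar 31 (RamExpr.eval s (.const 0)) with hs1
  have h7 : s1.var 7 = s.var 7 := by simp [hs1]
  have h0 : s1.var 0 = n := by simp [hs1, hn]
  have := run_count (x := 32) (b := 7) (s := s1)
    (p := .ite (.sub (.add (.var 29) (.const 1)) (.var 0))
    (.seq (.assign 29 (.sub (.var 29) (.var 0))) (.assign 31 (.add (.var 31) (.const 1)))) .skip)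
    -- Either the remainder is already below `n`, or every round so far has subtracted `n`. The
    -- second case is impossible at the end, since the number of rounds exceeds `c`.
    (fun i st => st.var 29 + n * st.var 31 = c ∧ (st.var 29 < n ∨ st.var 31 = i)) ?_ ?_
  · obtain ⟨h1, h2⟩ := this
    set s2 := (ForProg.count 32 7 (.ite (.sub (.add (.var 29) (.const 1)) (.var 0))
      (.seq (.assign 29 (.sub (.var 29) (.var 0))) (.assign 31 (.add (.var 31) (.const 1))))
      .skip)).run s1
    have h3 : s2.var 29 < n := by
      refine h2.resolve_right fun h => ?_
      have := Nat.le_mul_of_pos_left (s2.var 31) hn0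
      omega
    rw [← h1, Nat.add_mul_mod_self_left, Nat.mod_eq_of_lt h3, Nat.add_mul_div_left _ _ hn0,
      Nat.div_eq_of_lt h3, zero_add]
    exact ⟨rfl, rfl⟩
  · simp [hs1, RamExpr.eval, hc]
  · rintro i st hi hx e1 e2 ⟨h1, h2⟩
    have st0 : st.var 0 = n := (e1 0 (by decide)).trans h0
    rw [run_ite]
    by_cases hge : st.var 29 < n
    · rw [if_pos (by simp only [RamExpr.eval, st0]; omega), run_skip]
      simp only [RamStore.setVar_var]
      exact ⟨h1, .inl hge⟩
    · rw [if_neg (by simp only [RamExpr.eval, st0]; omega), run_seq, run_assign, run_assign]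
      simp [RamExpr.eval, st0]
      have := h2.resolve_left hge
      rw [Nat.mul_add]
      omega

/-- The digits of the variable `28` are marked. -/
def markDigits : ForProg :=
  .seq (.count 14 0 (.write 2 (.var 14) (.const 0)))
  (.seq (.assign 29 (.var 28))
    (.count 30 2 (.seq divide (.seq (.write 2 (.var 29) (.const 1)) (.assign 29 (.var 31))))))

theorem run_markDigits {c : ℕ} (hn : s.var 0 = n) (hn0 : 0 < n) (hc : s.var 28 = c)
    (hlt : c < s.var 7) :
    (Finset.range n).filter (fun w => (markDigits.run s).arr 2 w ≠ 0) =
      digitSet n (s.var 2) c := by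
  rw [markDigits, run_seq, run_seq, run_assign]
  set s1 := (ForProg.count 14 0 (.write 2 (.var 14) (.const 0))).run s with hs1
  have h2 := run_clearMarks hn
  rw [← hs1] at h2
  have hv : ∀ y, y ≠ 14 → s1.var y = s.var y := fun y hy =>
    run_var _ _ (by simpa [vars] using hy)
  set s2 := s1.setVar 29 (RamExpr.eval s1 (.var 28)) with hs2
  have w2 : s2.var 2 = s.var 2 := by simp [hs2, hv]
  have := run_count (x := 30) (b := 2) (s := s2)
    (p := .seq divide (.seq (.write 2 (.var 29) (.const 1)) (.assign 29 (.var 31))))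
    (fun i st => st.var 29 = c / n ^ i ∧
      ∀ w < n, st.arr 2 w ≠ 0 ↔ ∃ i' < i, c / n ^ i' % n = w) ?_ ?_
  · rw [w2] at this
    ext w
    simp only [digitSet, Finset.mem_filter, Finset.mem_range, Finset.mem_image]
    constructor
    · rintro ⟨hw, h⟩; exact (this.2 w hw).mp h
    · rintro ⟨i, hi, rfl⟩
      exact ⟨Nat.mod_lt _ hn0, (this.2 _ (Nat.mod_lt _ hn0)).mpr ⟨i, hi, rfl⟩⟩
  · refine ⟨by simp [hs2, RamExpr.eval, hv, hc], fun w hw => ?_⟩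
    simp [hs2, h2 w hw]
  · rintro i st hi hx e1 e2 ⟨h3, h4⟩
    have st0 : st.var 0 = n := by rw [e1 0 (by decide), hs2]; simp [hv, hn]
    have st7 : st.var 7 = s.var 7 := by rw [e1 7 (by decide), hs2]; simp [hv]
    have hle := Nat.div_le_self c (n ^ i)
    obtain ⟨d1, d2⟩ := run_divide st0 hn0 h3 (by omega)
    rw [run_seq, run_seq, run_write, run_assign]
    refine ⟨?_, fun w hw => ?_⟩
    · simp [RamExpr.eval, d2, Nat.div_div_eq_div_mul, pow_succ]
    · simp only [RamExpr.eval, RamStore.setVar_arr, RamStore.setArr_arr, true_and, d1]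
      rw [run_arr _ _ (by decide)]
      split_ifs with hw'
      · simp only [ne_eq, one_ne_zero, not_false_eq_true, true_iff]
        exact ⟨i, by omega, hw'.symm⟩
      · rw [h4 w hw]
        constructor
        · rintro ⟨i', h5, h6⟩; exact ⟨i', by omega, h6⟩
        · rintro ⟨i', h5, h6⟩
          rcases Nat.lt_succ_iff_lt_or_eq.mp h5 with h5 | rfl
          · exact ⟨i', h5, h6⟩
          · exact absurd h6.symm hw'

/-- The variable `33` becomes zero if there are `k` marked points, and the last rows of the table
are trivial. -/
def checkRows : ForProg :=
  .seq (.assign 33 (neExpr (.add (.var 5) (.var 2)) (.var 0)))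
    (.count 20 0 (.ite (.sub (.add (.var 20) (.const 1)) (.var 5))
      (.count 21 0 (.assign 33 (.add (.var 33) (neExpr (.cell 6 (.add (.cell 1
        (.add (.cell 1 (.var 20)) (.var 21))) (.var 20))) (.var 20))))) .skip))

/-- Variable `33` sums up the deviations. Its initial value rejects sequences with a repeated point,
which mark fewer than `k` points. -/
theorem run_checkRows {T : ℕ → Perm ℕ} (hs : Ready s n) (hT : HoldsTable s n T) :
    (checkRows.run s).var 33 = 0 ↔ s.var 5 + s.var 2 = n ∧
      ∀ i, s.var 5 ≤ i → i < n → ∀ j < n, T (i * n + j) i = i := by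
  rw [checkRows, run_seq, run_assign]
  set s1 := s.setVar 33 (RamExpr.eval s (neExpr (.add (.var 5) (.var 2)) (.var 0))) with hs1
  have g1 : Ready s1 n := hs.of_eq (by simp [hs1]) (by simp [hs1]) (by simp [hs1])
    (by simp [hs1]) rfl
  have := run_count (x := 20) (b := 0) (s := s1)
    (p := .ite (.sub (.add (.var 20) (.const 1)) (.var 5))
      (.count 21 0 (.assign 33 (.add (.var 33) (neExpr (.cell 6 (.add (.cell 1
        (.add (.cell 1 (.var 20)) (.var 21))) (.var 20))) (.var 20))))) .skip)
    (fun i st => st.var 33 = 0 ↔ s.var 5 + s.var 2 = n ∧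
      ∀ i', s.var 5 ≤ i' → i' < i → ∀ j < n, T (i' * n + j) i' = i') ?_ ?_
  · rwa [g1.var0] at this
  · simp only [hs1, RamStore.setVar_var]
    rw [if_neg (by decide), if_true, eval_neExpr]
    simp [RamExpr.eval, hs.var0]
  · intro i st hi hx e1 e2 h
    rw [g1.var0] at hi
    have gst : Ready st n := g1.of_eq (e1 0 (by decide)) (e1 1 (by decide)) (e1 3 (by decide))
      (e1 4 (by decide)) (e2 1 (by decide))
    have st5 : st.var 5 = s.var 5 := by rw [e1 5 (by decide), hs1]; simp
    rw [run_ite]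
    by_cases hid : s.var 5 ≤ i
    · rw [if_neg (by simp only [RamExpr.eval, hx, st5]; omega)]
      have inner := run_count (x := 21) (b := 0) (s := st)
        (p := .assign 33 (.add (.var 33) (neExpr (.cell 6 (.add (.cell 1
          (.add (.cell 1 (.var 20)) (.var 21))) (.var 20))) (.var 20))))
        (fun j st' => st'.var 33 = 0 ↔ st.var 33 = 0 ∧ ∀ j' < j, T (i * n + j') i = i)
        (by simp) ?_
      · rw [gst.var0] at inner
        rw [RamStore.setVar_var, if_neg (by decide), inner, h, and_assoc]
        refine and_congr_right fun _ => ⟨fun ⟨h1, h2⟩ i' h3 h4 => ?_, fun h1 => ⟨?_, ?_⟩⟩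
        · rcases Nat.lt_succ_iff_lt_or_eq.mp h4 with h4 | rfl
          · exact h1 i' h3 h4
          · exact h2
        · exact fun i' h3 h4 => h1 i' h3 (by omega)
        · exact h1 i hid (by omega)
      · intro j st' hj hx' f1 f2 hh
        rw [gst.var0] at hj
        have gst' : Ready st' n := gst.of_eq (f1 0 (by decide)) (f1 1 (by decide))
          (f1 3 (by decide)) (f1 4 (by decide)) (f2 1 (by decide))
        have v20 : st'.var 20 = i := (f1 20 (by decide)).trans hx
        rw [RamStore.setVar_var, if_neg (by decide), run_assign, RamStore.setVar_var, if_pos rfl,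
          eval_add_eq_zero, eval_neExpr]
        simp only [RamExpr.eval, v20, hx', gst'.mul_mul hi hj]
        rw [f2 6 (by decide), e2 6 (by decide)]
        show _ ∧ s.arr 6 _ = _ ↔ _
        rw [hT _ (index_lt hi hj) _ hi, hh, and_assoc]
        refine and_congr_right fun _ => ⟨fun ⟨h1, h2⟩ j' h4 => ?_, fun h1 => ⟨?_, ?_⟩⟩
        · rcases Nat.lt_succ_iff_lt_or_eq.mp h4 with h4 | rfl
          · exact h1 j' h4
          · exact h2
        · exact fun j' h4 => h1 j' (by omega)
        · exact h1 j (by omega)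
    · rw [if_pos (by simp only [RamExpr.eval, hx, st5]; omega), run_skip, RamStore.setVar_var,
        if_neg (by decide), h]
      refine and_congr_right fun _ => forall_congr' fun i' => ?_
      constructor
      · intro h1 h2 h3; omega
      · intro h1 h2 h3; omega

/-- The search through all sequences of `k` points. -/
def search : ForProg :=
  .seq multiples (.seq (.assign 27 (.const 0)) (.count 28 7 (.seq markDigits (.seq markedChain
    (.seq checkRows (.ite (.var 33) .skip (.assign 27 (.const 1))))))))

theorem run_search {I : CoBaseInstance} (hI : I.IsStoredIn s) (h3 : s.var 3 = I.n * I.n)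
    (h4 : s.var 4 = I.n * I.n + I.m) (h7 : s.var 7 = I.n ^ I.k) (hk : I.k ≠ 0) :
    (I.IsYes → (search.run s).var 27 = 1) ∧ (¬ I.IsYes → (search.run s).var 27 = 0) := by
  have g1 := hasGroup_multiples hI h3 h4
  rw [search, run_seq, run_seq, run_assign]
  set s1 := multiples.run s with hs1
  have hv1 : ∀ y, y ∉ multiples.vars → s1.var y = s.var y := fun y hy => run_var _ _ hy
  set s2 := s1.setVar 27 (RamExpr.eval s1 (.const 0)) with hs2
  have g2 : HasGroup s2 I.n (natGens I) (natGroup I) :=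
    g1.of_eq (by simp [hs2]) (by simp [hs2]) (by simp [hs2]) (by simp [hs2]) rfl rfl
  have w2 : s2.var 2 = I.k := by simp [hs2, hv1 2 (by decide), hI.2.2.1]
  have w7 : s2.var 7 = I.n ^ I.k := by simp [hs2, hv1 7 (by decide), h7]
  let good : ℕ → Prop := fun c => (digitSet I.n I.k c).card = I.k ∧
    Indep (natGroup I) (digitSet I.n I.k c)
  have hmain := run_count (x := 28) (b := 7) (s := s2) (p := .seq markDigits (.seq markedChain
    (.seq checkRows (.ite (.var 33) .skip (.assign 27 (.const 1))))))
    (fun c st => ((∃ c' < c, good c') → st.var 27 = 1) ∧ ((¬ ∃ c' < c, good c') → st.var 27 = 0))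
    ?_ ?_
  · rw [w7] at hmain
    have hiff : I.IsYes ↔ ∃ c < I.n ^ I.k, good c := by
      rw [isYes_iff I 0]
      constructor
      · rintro ⟨S, hS, hSk, hind⟩
        obtain ⟨c, hc, e⟩ := exists_digitSet_eq (n := I.n) S (by
          intro x hx
          simpa using hS hx)
        rw [hSk] at hc e
        exact ⟨c, hc, by rw [e]; exact hSk, by rw [e]; exact hind⟩
      · rintro ⟨c, hc, h1, h2⟩
        refine ⟨_, fun x hx => ?_, h1, h2⟩
        obtain ⟨i, -, rfl⟩ := Finset.mem_image.mp hx
        have hn : 0 < I.n := by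
          rcases Nat.eq_zero_or_pos I.n with h | h
          · rw [h, zero_pow hk] at hc; omega
          · exact h
        simpa using Nat.mod_lt _ hn
    rw [hiff]; exact hmain
  · simp [hs2, RamExpr.eval]
  · rintro c st hc hx e1 e2 ⟨i1, i2⟩
    rw [w7] at hc
    -- Division by `n` must make sense: as `k` is not zero, an empty domain would give no sequences
    -- at all.
    have hn : 0 < I.n := by
      rcases Nat.eq_zero_or_pos I.n with h | h
      · rw [h, zero_pow hk] at hc; omega
      · exact h
    have gst : HasGroup st I.n (natGens I) (natGroup I) := g2.of_eq (e1 0 (by decide))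
      (e1 1 (by decide)) (e1 3 (by decide)) (e1 4 (by decide)) (e2 1 (by decide)) (e2 0 (by decide))
    have st2 : st.var 2 = I.k := (e1 2 (by decide)).trans w2
    have st7 : st.var 7 = I.n ^ I.k := (e1 7 (by decide)).trans w7
    have hm := run_markDigits gst.ready.var0 hn hx (by rw [st7]; exact hc)
    rw [st2] at hm
    rw [run_seq, run_seq, run_seq]
    set s3 := markDigits.run st with hs3
    have g3 : HasGroup s3 I.n (natGens I) (natGroup I) := gst.frame _ (by decide)
    obtain ⟨b, T, hch⟩ := g3.run_markedChain
    set s4 := markedChain.run s3 with hs4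
    have g4 : HasGroup s4 I.n (natGens I) (natGroup I) := g3.frame _ (by decide)
    have hm4 : (Finset.range I.n).filter (fun w => s4.arr 2 w ≠ 0) = digitSet I.n I.k c := by
      rw [← hm, show s4.arr 2 = s3.arr 2 from run_arr _ _ (by decide)]
    have v42 : s4.var 2 = I.k := ((run_var _ _ (by decide)).trans (run_var _ _ (by decide))).trans st2
    have hcheck := run_checkRows g4.ready hch.holds
    have hcard := hch.card_marked
    have hind := hch.indep_iff
    rw [hm4] at hcard hind
    have hle := hch.le
    have hgood : (checkRows.run s4).var 33 = 0 ↔ good c := by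
      rw [hcheck, ← hind, v42]
      refine and_congr_left' ?_
      rw [hcard]; omega
    set s5 := checkRows.run s4 with hs5
    have v527 : s5.var 27 = st.var 27 :=
      ((run_var _ _ (by decide)).trans (run_var _ _ (by decide))).trans (run_var _ _ (by decide))
    have hex : (∃ c' < c + 1, good c') ↔ (∃ c' < c, good c') ∨ good c := by
      constructor
      · rintro ⟨c', h1, h2⟩
        rcases Nat.lt_succ_iff_lt_or_eq.mp h1 with h1 | rfl
        · exact .inl ⟨c', h1, h2⟩
        · exact .inr h2
      · rintro (⟨c', h1, h2⟩ | h)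
        · exact ⟨c', by omega, h2⟩
        · exact ⟨c, by omega, h⟩
    rw [hex, run_ite]
    by_cases hg : good c
    · rw [if_pos (show RamExpr.eval s5 (.var 33) = 0 from hgood.mpr hg), run_assign]
      exact ⟨fun _ => by simp [RamExpr.eval], fun h => absurd (.inr hg) h⟩
    · rw [if_neg (show ¬ RamExpr.eval s5 (.var 33) = 0 from mt hgood.mp hg), run_skip, RamStore.setVar_var, if_neg (by decide), v527]
      exact ⟨fun h => i1 (h.resolve_right hg), fun h => i2 fun h' => h (.inl h')⟩

end CoBase

/-! ### The complete programs -/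

namespace CoBase

open Equiv ForProg

/-- The kernelization. -/
def kernelProg : RamProg :=
  .ite (.sub (.var 2) (.var 0)) (.seq (.assign 0 (.const 0)) (.assign 1 (.const 0)))
    (.seq prepare.compile (.seq reduce.compile (.seq output.compile outSize.compile)))

theorem poly_bound {C d N X : ℕ} (hX : 1 ≤ X) (hN : N ≤ X ^ 2) :
    C * (N + 1) ^ d ≤ C * 2 ^ d * X ^ (2 * d) := by
  have h1 : N + 1 ≤ 2 * X ^ 2 := by have := Nat.one_le_pow 2 X hX; omega
  calc C * (N + 1) ^ d ≤ C * (2 * X ^ 2) ^ d := Nat.mul_le_mul_left _ (Nat.pow_le_pow_left h1 _)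
    _ = _ := by rw [mul_pow, ← pow_mul, mul_assoc]

/-- The case `k > n` is split off because `k` may be arbitrarily large compared with `n` and `m`.
Otherwise all loop bounds, including `k`, are at most `(n + m + 1) ^ 2`. -/
theorem exists_exec_kernelProg : ∃ C, ∀ I : CoBaseInstance, ∃ (t : ℕ) (s : RamStore)
    (J : CoBaseInstance), RamExec kernelProg I.input t s ∧ t ≤ C * (I.n + I.m + 1) ^ C ∧
      J.IsStoredIn s ∧ (J.IsYes ↔ I.IsYes) ∧ J.k = I.k ∧ J.n ≤ I.k ^ (2 * I.k + 1) ∧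
      J.m ≤ J.n ^ 2 := by
  obtain ⟨C₁, d₁, h₁⟩ := exists_exec_le (B := [0]) (p := prepare) (by decide)
  obtain ⟨C₂, d₂, h₂⟩ := exists_exec_le (B := [0, 1, 3, 4]) (p := reduce) (by decide)
  obtain ⟨C₃, d₃, h₃⟩ := exists_exec_le (B := [2, 6]) (p := output) (by decide)
  obtain ⟨C₄, d₄, h₄⟩ := exists_exec_le (B := []) (p := outSize) (by decide)
  refine ⟨10 + C₁ * 2 ^ d₁ + C₂ * 2 ^ d₂ + C₃ * 2 ^ d₃ + C₄ * 2 ^ d₄ +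
    (2 * d₁ + 2 * d₂ + 2 * d₃ + 2 * d₄), fun I => ?_⟩
  set C := 10 + C₁ * 2 ^ d₁ + C₂ * 2 ^ d₂ + C₃ * 2 ^ d₃ + C₄ * 2 ^ d₄ +
    (2 * d₁ + 2 * d₂ + 2 * d₃ + 2 * d₄) with hC
  set X := I.n + I.m + 1 with hX
  have hX1 : 1 ≤ X := by omega
  have hstored := I.isStoredIn_input
  obtain ⟨v0, v1, v2, -⟩ := hstored
  have hpowC : 1 ≤ X ^ C := Nat.one_le_pow _ _ hX1
  by_cases hk : I.n < I.k
  · refine ⟨_, _, ⟨0, 0, fun i => i.elim0, I.k⟩, .iteTrue ?_ (.seq (.assign _ _ _)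
      (.assign _ _ _)), ?_, ⟨?_, ?_, ?_, fun i => i.elim0⟩, ?_, rfl, Nat.zero_le _, Nat.zero_le _⟩
    · simp only [RamExpr.eval, v0, v2]; omega
    · simp only [RamExpr.cost]
      have := Nat.mul_le_mul_left C hpowC
      omega
    · simp [RamExpr.eval]
    · simp [RamExpr.eval]
    · simp [v2]
    · refine iff_of_false ?_ ?_
      · rintro ⟨S, h, -⟩
        simp only at h; omega
      · rintro ⟨S, h, -⟩
        omega
  · have hkn : I.k ≤ I.n := not_lt.mp hk
    have hXX : X ≤ X ^ 2 := Nat.le_self_pow (by omega) X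
    have hnn : I.n * I.n + I.m ≤ X ^ 2 := by rw [hX]; nlinarith
    obtain ⟨t₁, b₁, e₁⟩ := h₁ I.input (X ^ 2) (by simp [v0]; omega)
    obtain ⟨p3, p4⟩ := run_prepare I.input
    set s₁ := prepare.run I.input
    have hs₁ : I.IsStoredIn s₁ := ⟨(run_var _ _ (by decide)).trans v0,
      (run_var _ _ (by decide)).trans v1, (run_var _ _ (by decide)).trans v2, fun i j => by
        rw [show s₁.arr 0 = I.input.arr 0 from run_arr _ _ (by decide)]
        exact I.isStoredIn_input.2.2.2 i j⟩
    rw [v0] at p3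
    rw [v0, v1] at p4
    obtain ⟨t₂, b₂, e₂⟩ := h₂ s₁ (X ^ 2) (by
      simp [hs₁.1, hs₁.2.1, p3, p4]; omega)
    obtain ⟨b, T, hc, hR, h6, hm⟩ := run_reduce hs₁ p3 p4
    have k2 : (reduce.run s₁).var 2 = I.k := (run_var _ _ (by decide)).trans hs₁.2.2.1
    set s₂ := reduce.run s₁
    obtain ⟨t₃, b₃, e₃⟩ := h₃ s₂ (X ^ 2) (by
      simp [k2, h6]; omega)
    obtain ⟨t₄, b₄, e₄⟩ := h₄ (output.run s₂) (X ^ 2) (by simp)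
    obtain ⟨J, j1, j2, j3, j4, j5⟩ := run_output hc hR k2 h6 hm
    refine ⟨_, _, J, .iteFalse ?_ (.seq e₁ (.seq e₂ (.seq e₃ e₄))), ?_, j1, j2, j3, j4, j5⟩
    · simp only [RamExpr.eval, v0, v2]; omega
    · have hexp : ∀ c e : ℕ, 2 * e ≤ C → c * 2 ^ e * X ^ (2 * e) ≤ c * 2 ^ e * X ^ C :=
        fun c e he => Nat.mul_le_mul_left _ (Nat.pow_le_pow_right hX1 he)
      have q₁ := b₁.trans ((poly_bound hX1 le_rfl).trans (hexp C₁ d₁ (by omega)))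
      have q₂ := b₂.trans ((poly_bound hX1 le_rfl).trans (hexp C₂ d₂ (by omega)))
      have q₃ := b₃.trans ((poly_bound hX1 le_rfl).trans (hexp C₃ d₃ (by omega)))
      have q₄ := b₄.trans ((poly_bound hX1 le_rfl).trans (hexp C₄ d₄ (by omega)))
      simp only [RamExpr.cost]
      calc _ ≤ 10 * X ^ C + C₁ * 2 ^ d₁ * X ^ C + C₂ * 2 ^ d₂ * X ^ C + C₃ * 2 ^ d₃ * X ^ C +
            C₄ * 2 ^ d₄ * X ^ C := by omega
        _ = (10 + C₁ * 2 ^ d₁ + C₂ * 2 ^ d₂ + C₃ * 2 ^ d₃ + C₄ * 2 ^ d₄) * X ^ C := by ring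
        _ ≤ C * X ^ C := Nat.mul_le_mul_right _ (by omega)

/-- The number of sequences of `k` points. -/
def countTuples : ForProg := .seq (.assign 7 (.const 1)) (mulPow 0)

/-- The decision procedure: exhaustive search in the kernel. -/
def decideProg : RamProg :=
  .ite (.var 2) (.seq kernelProg (.seq prepare.compile (.seq countTuples.compile
    (.seq search.compile (.assign 0 (.var 27)))))) (.assign 0 (.const 1))

/-- The exhaustive search, with a time bound in terms of the loop bounds. -/
theorem exists_exec_search : ∃ C d, ∀ (J : CoBaseInstance) (s : RamStore) (N : ℕ),
    J.IsStoredIn s → J.k ≠ 0 → J.n ≤ N → J.k ≤ N → J.n * J.n + J.m ≤ N → J.n ^ J.k ≤ N →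
    ∃ (t : ℕ) (s' : RamStore), RamExec (.seq prepare.compile (.seq countTuples.compile
      (.seq search.compile (.assign 0 (.var 27))))) s t s' ∧ t ≤ C * (N + 1) ^ d ∧
      (J.IsYes → s'.var 0 = 1) ∧ (¬ J.IsYes → s'.var 0 = 0) := by
  obtain ⟨C₁, d₁, h₁⟩ := exists_exec_le (B := [0]) (p := prepare) (by decide)
  obtain ⟨C₂, d₂, h₂⟩ := exists_exec_le (B := [0, 2]) (p := countTuples) (by decide)
  obtain ⟨C₃, d₃, h₃⟩ := exists_exec_le (B := [0, 1, 2, 3, 4, 7]) (p := search) (by decide)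
  refine ⟨C₁ + C₂ + C₃ + 2, d₁ + d₂ + d₃, fun J s N hs hk hn hkN hm hpow => ?_⟩
  obtain ⟨v0, v1, v2, v3⟩ := hs
  have hmN : J.m ≤ N := by omega
  have hnnN : J.n * J.n ≤ N := by omega
  obtain ⟨t₁, b₁, e₁⟩ := h₁ s N (by simp [v0, hn])
  obtain ⟨p3, p4⟩ := run_prepare s
  have hs₁ : J.IsStoredIn (prepare.run s) := ⟨(run_var _ _ (by decide)).trans v0,
      (run_var _ _ (by decide)).trans v1, (run_var _ _ (by decide)).trans v2, fun i j => by
        rw [show (prepare.run s).arr 0 = s.arr 0 from run_arr _ _ (by decide)]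
        exact v3 i j⟩
  set s₁ := prepare.run s
  rw [v0] at p3
  rw [v0, v1] at p4
  obtain ⟨t₂, b₂, e₂⟩ := h₂ s₁ N (by simp [hs₁.1, hs₁.2.2.1, hn, hkN])
  have hs₂ : J.IsStoredIn (countTuples.run s₁) := ⟨(run_var _ _ (by decide)).trans hs₁.1,
      (run_var _ _ (by decide)).trans hs₁.2.1, (run_var _ _ (by decide)).trans hs₁.2.2.1,
      fun i j => by
        rw [show (countTuples.run s₁).arr 0 = s₁.arr 0 from run_arr _ _ (by decide)]
        exact hs₁.2.2.2 i j⟩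
  have p7 : (countTuples.run s₁).var 7 = J.n ^ J.k := by
    rw [countTuples, run_seq, run_mulPow _ (by decide), run_assign]
    simp [RamExpr.eval, hs₁.1, hs₁.2.2.1]
  have p3' : (countTuples.run s₁).var 3 = J.n * J.n := (run_var _ _ (by decide)).trans p3
  have p4' : (countTuples.run s₁).var 4 = J.n * J.n + J.m := (run_var _ _ (by decide)).trans p4
  set s₂ := countTuples.run s₁
  obtain ⟨t₃, b₃, e₃⟩ := h₃ s₂ N (by
    simp [hs₂.1, hs₂.2.1, hs₂.2.2.1, p3', p4', p7, hn, hkN, hmN, hnnN, hm, hpow])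
  have hfin := run_search hs₂ p3' p4' p7 hk
  refine ⟨_, _, .seq e₁ (.seq e₂ (.seq e₃ (.assign _ _ _))), ?_, ?_⟩
  · have hexp : ∀ c e : ℕ, e ≤ d₁ + d₂ + d₃ →
        c * (N + 1) ^ e ≤ c * (N + 1) ^ (d₁ + d₂ + d₃) :=
      fun c e he => Nat.mul_le_mul_left _ (Nat.pow_le_pow_right (by omega) he)
    have q₁ := b₁.trans (hexp C₁ d₁ (by omega))
    have q₂ := b₂.trans (hexp C₂ d₂ (by omega))
    have q₃ := b₃.trans (hexp C₃ d₃ (by omega))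
    have q₄ := Nat.one_le_pow (d₁ + d₂ + d₃) (N + 1) (by omega)
    simp only [RamExpr.cost, Nat.add_mul]
    omega
  · simpa [RamExpr.eval] using hfin

/-- This case needs its own branch in the decision procedure: for `k = 0` the time bound is a
constant, so the program must not even look at the generators. -/
theorem isYes_of_k_eq_zero {I : CoBaseInstance} (hk : I.k = 0) : I.IsYes :=
  ⟨Finset.univ, by simp [hk], fun g _ h => Equiv.ext fun i => h i (by simp)⟩

/-- The largest exponents are `(2 * k + 1) * k` for the number of sequences and `(2 * k + 1) * 2`
for the square of the domain. Both are below `9 * k ^ 2`, and the factor 2 pays for the sum of `n *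
n` and `m`. -/
theorem kernel_size_bounds {k n m : ℕ} (hk : 1 ≤ k) (hn : n ≤ k ^ (2 * k + 1)) (hm : m ≤ n ^ 2) :
    n ≤ 2 * k ^ (9 * k ^ 2) ∧ k ≤ 2 * k ^ (9 * k ^ 2) ∧ n * n + m ≤ 2 * k ^ (9 * k ^ 2) ∧
      n ^ k ≤ 2 * k ^ (9 * k ^ 2) := by
  have mono : ∀ e, e ≤ 9 * k ^ 2 → k ^ e ≤ k ^ (9 * k ^ 2) := fun e he =>
    Nat.pow_le_pow_right hk he
  have hkk : k ≤ k ^ 2 := Nat.le_self_pow (by omega) k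
  have h1 := mono (2 * k + 1) (by omega)
  have h2 := mono 1 (by omega)
  have h3 : n ^ 2 ≤ k ^ (9 * k ^ 2) := by
    refine (Nat.pow_le_pow_left hn 2).trans ?_
    rw [← pow_mul]; exact mono _ (by omega)
  have h4 : n ^ k ≤ k ^ (9 * k ^ 2) := by
    refine (Nat.pow_le_pow_left hn k).trans ?_
    rw [← pow_mul]; exact mono _ (by nlinarith)
  rw [pow_one] at h2
  refine ⟨by omega, by omega, ?_, by omega⟩
  rw [← sq]; omega

theorem exists_decides : ∃ (p : RamProg) (C : ℕ),
    DecidesCoBase p (fun I => C * (I.k ^ (C * I.k ^ 2) + I.k * (I.n + I.m + 1) ^ C)) := by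
  obtain ⟨A, hA⟩ := exists_exec_kernelProg
  obtain ⟨D, d, hD⟩ := exists_exec_search
  refine ⟨decideProg, A + D * 3 ^ d + 9 * d + 4, fun I => ?_⟩
  -- The summands pay for the kernelization, for the factor of the search time, for its exponent,
  -- and for the test at the start together with the assignment in the case `k = 0`.
  set C := A + D * 3 ^ d + 9 * d + 4 with hC
  by_cases hk : I.k = 0
  · refine ⟨_, _, .iteFalse ?_ (.assign _ _ _), ?_, fun _ => ?_,
      fun h => absurd (isYes_of_k_eq_zero hk) h⟩
    · simpa [RamExpr.eval] using I.isStoredIn_input.2.2.1.trans hk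
    · simp only [RamExpr.cost, hk]
      simp
      omega
    · simp [RamExpr.eval]
  · obtain ⟨t₁, s₁, J, e₁, b₁, hJ, hyes, hJk, hJn, hJm⟩ := hA I
    have hk1 : 1 ≤ I.k := by omega
    obtain ⟨n1, n2, n3, n4⟩ := kernel_size_bounds hk1 hJn hJm
    obtain ⟨t₂, s₂, e₂, b₂, y₁, y₂⟩ := hD J s₁ (2 * I.k ^ (9 * I.k ^ 2)) hJ (by rw [hJk]; exact hk)
      n1 (by rw [hJk]; exact n2) n3 (by rw [hJk]; exact n4)
    refine ⟨_, s₂, .iteTrue ?_ (.seq e₁ e₂), ?_, fun h => y₁ (hyes.mpr h),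
      fun h => y₂ fun h' => h (hyes.mp h')⟩
    · simpa [RamExpr.eval] using fun h => hk (I.isStoredIn_input.2.2.1.symm.trans h)
    · set X := I.n + I.m + 1 with hX
      have hX1 : 1 ≤ X := by omega
      have hP : ∀ e, 1 ≤ I.k ^ e := fun e => Nat.one_le_pow _ _ hk1
      -- The factor `k` in front of the polynomial comes for free, because `k` is positive in this
      -- branch.
      have c₁ : t₁ ≤ C * (I.k * X ^ C) := by
        calc t₁ ≤ A * X ^ A := b₁
          _ ≤ C * X ^ C := Nat.mul_le_mul (by omega) (Nat.pow_le_pow_right hX1 (by omega))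
          _ ≤ C * (I.k * X ^ C) := Nat.mul_le_mul_left _ (Nat.le_mul_of_pos_left _ hk1)
      have c₂ : t₂ ≤ D * 3 ^ d * I.k ^ (C * I.k ^ 2) := by
        calc t₂ ≤ D * (2 * I.k ^ (9 * I.k ^ 2) + 1) ^ d := b₂
          _ ≤ D * (3 * I.k ^ (9 * I.k ^ 2)) ^ d := by
              refine Nat.mul_le_mul_left _ (Nat.pow_le_pow_left ?_ _)
              have := hP (9 * I.k ^ 2)
              omega
          _ = D * 3 ^ d * I.k ^ (9 * d * I.k ^ 2) := by
              rw [mul_pow, ← pow_mul, show 9 * I.k ^ 2 * d = 9 * d * I.k ^ 2 by ring, ← mul_assoc]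
          _ ≤ _ := Nat.mul_le_mul_left _ (Nat.pow_le_pow_right hk1
              (Nat.mul_le_mul_right _ (by omega)))
      have c₃ : (D * 3 ^ d + 4) * I.k ^ (C * I.k ^ 2) ≤ C * I.k ^ (C * I.k ^ 2) :=
        Nat.mul_le_mul_right _ (by omega)
      have c₄ := hP (C * I.k ^ 2)
      simp only [RamExpr.cost]
      rw [← hX, Nat.mul_add]
      rw [Nat.add_mul] at c₃
      omega

end CoBase

theorem mainTheorem5 :
    (∃ (p : RamProg) (C : ℕ),
      DecidesCoBase p (fun I => C * (I.k ^ (C * I.k ^ 2) + I.k * (I.n + I.m + 1) ^ C))) ∧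
    (∃ (p : RamProg) (C : ℕ),
      KernelizesCoBase p (fun I => C * (I.n + I.m + 1) ^ C) (fun k => k ^ (2 * k + 1))) := by
  refine ⟨CoBase.exists_decides, ?_⟩
  obtain ⟨C, h⟩ := CoBase.exists_exec_kernelProg
  exact ⟨CoBase.kernelProg, C, h⟩
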